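/- Let $V\subset\mathbb R^3$ be the ball of radius $R_V>0$ centred at the origin. Let $\omega,\mu,k>0$ be the angular frequency, the permeability and the wave number, and let $\eta$ be the wave impedance, so that $\omega\mu=\eta k$. Let $$\mathbf G(\mathbf r,\mathbf r')=\Big(\mathbf I+\frac1{k^2}\nabla\nabla\Big)\frac{e^{ik|\mathbf r-\mathbf r'|}}{4\pi|\mathbf r-\mathbf r'|}$$ be the free-space dyadic Green function. For integers $n\ge1$, $-n\le m\le n$ and $l\in\{1,2\}$ put $p=2(n(n+1)+m-1)+l$ (a bijection onto the positive integers), and let $$\mathbf V_{nm1}=\nabla\times\big(\mathbf r\,j_n(kr)Y_{nm}(\theta,\phi)\big),\qquad \mathbf V_{nm2}=\frac1k\nabla\times\nabla\times\big(\mathbf r\,j_n(kr)Y_{nm}(\theta,\phi)\big),\qquad \mathbf v_p=\frac{\mathbf V_p}{\sqrt{\int_V|\mathbf V_p|^2\,d\mathbf r}},$$ where $j_n$ is the spherical Bessel function of the first kind and $Y_{nm}$ the orthonormal spherical harmonic. Let $\mathbf J$ be a random current density on $V$ (with values in $\mathbb C^3$, jointly measurable) that is almost surely square integrable on $V$, and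 let $J_p=\int_V\mathbf J(\mathbf r)\cdot\mathbf v_p^*(\mathbf r)\,d\mathbf r$ be its coefficients in the modes $\mathbf v_p$. Then the (time-averaged) transmit power satisfies $$E\left[-\frac12\,\mathrm{Re}\left\{i\omega\mu\int_V\int_V\big(\mathbf G(\mathbf r,\mathbf r')\mathbf J(\mathbf r')\big)\cdot\mathbf J^*(\mathbf r)\,d\mathbf r'\,d\mathbf r\right\}\right]=E\left[\sum_{p=1}^\infty T_p|J_p|^2\right],$$ where the double integral is read as a principal value: the real part for the double integral restricted to $|\mathbf r-\mathbf r'|\ge\delta$ converges almost surely as $\delta\to0^+$. The quantities inside the two expectations are almost surely equal, the terms are non-negative, and the expectations are taken in $[0,\infty]$. With $n$ the degree that belongs to $p$ and $x=kR_V$, $$T_p=\frac{\eta k^2R_V^3}{4}\Big[j_{n-1}^2(x)+j_n^2(x)-\frac{2n+1}{x}j_{n-1}(x)j_n(x)\Big]\quad\text{for odd }p,$$ $$T_p=\frac{\eta k^2R_V^3}{4}\Big\{\frac{n+1}{2n+1}\Big[j_{n-2}^2(x)+j_{n-1}^2(x)-\frac{2n-1}{x}j_{n-2}(x)j_{n-1}(x)\Big]+\frac{n}{2n+1}\Big[j_n^2(x)+j_{n+1}^2(x)-\frac{2n+3}{x}j_n(x)j_{n+1}(x)\Big]\Big\}\quad\text{for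 even }p.$$ In particular $T_p$ depends only on $\eta$, $k$, $R_V$ and $p$, and not on the radius $R_S$ of the sphere on which the field is observed. -/

import Mathlib

open MeasureTheory Filter Topology
open scoped ENNReal ComplexConjugate

namespace SphericalModes

noncomputable section

/-- Physical space `ℝ³`. -/
abbrev E3 := EuclideanSpace ℝ (Fin 3)

/-- Complex vectors `ℂ³`. -/
abbrev C3 := EuclideanSpace ℂ (Fin 3)

/-- The source region: the ball of radius `R` centred at the origin. -/
def region (R : ℝ) : Set E3 := Metric.closedBall 0 R

/-- Partial derivative of a complex scalar field along the `i`-th coordinate axis. -/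
def pderiv (i : Fin 3) (f : E3 → ℂ) (r : E3) : ℂ :=
  lineDeriv ℝ f r (EuclideanSpace.single i (1 : ℝ))

/-- The curl of a complex vector field. -/
def curl (F : E3 → C3) (r : E3) : C3 :=
  !₂[pderiv 1 (fun x => F x 2) r - pderiv 2 (fun x => F x 1) r,
     pderiv 2 (fun x => F x 0) r - pderiv 0 (fun x => F x 2) r,
     pderiv 0 (fun x => F x 1) r - pderiv 1 (fun x => F x 0) r]

/-! ### The free-space dyadic Green function -/

/-- The outgoing scalar Green function `e^{ikr} / (4πr)`, `r = ‖x‖`, of the Helmholtz operator. -/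
def scalarGreen (k : ℝ) (x : E3) : ℂ :=
  Complex.exp (Complex.I * k * ‖x‖) / (4 * Real.pi * ‖x‖)

/-- The dyadic Green function `G(r, r') = (I + k⁻² ∇∇) e^{ik‖r - r'‖} / (4π‖r - r'‖)`
(derivatives in `r`), for `r ≠ r'`. -/
def dyadicGreen (k : ℝ) (r r' : E3) : Matrix (Fin 3) (Fin 3) ℂ :=
  fun i j =>
    (if i = j then scalarGreen k (r - r') else 0) +
      1 / (k : ℂ) ^ 2 *
        pderiv i (fun x => pderiv j (fun y => scalarGreen k (y - r')) x) r

/-- The power `-½ Re { iωμ ∫_V ∫_V (G(r,r') J(r')) · J*(r) dr' dr }` with the pairs of points at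
distance less than `δ` left out of the double integral (`G` is not locally integrable on the
diagonal). -/
def truncatedPower (ω μ k R : ℝ) (J : E3 → C3) (δ : ℝ) : ℝ :=
  -(1 / 2) *
    (Complex.I * ω * μ *
      ∫ r in region R, ∫ r' in region R \ Metric.ball r δ,
        ∑ i, (∑ j, dyadicGreen k r r' i j * J r' j) * conj (J r i)).re

/-- The transmit power of the current density `J` on the ball of radius `R`: the double integral
`-½ Re { iωμ ∫_V ∫_V (G(r,r') J(r')) · J*(r) dr' dr }` as a principal value. The local term
`-J(r) / (3k²)` by which the action of `G` on `J` differs from the principal value contributes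
`iωμ` times a real number to the braces, hence nothing to the power. -/
def transmitPower (ω μ k R : ℝ) (J : E3 → C3) : ℝ :=
  limUnder (𝓝[>] (0 : ℝ)) (truncatedPower ω μ k R J)

/-! ### Spherical Bessel functions and spherical harmonics -/

/-- The spherical Bessel function of the first kind `j_n(x) = √(π/(2x)) J_{n+1/2}(x)`, of integer
order (negative orders included), by its power series. -/
def sphBessel (n : ℤ) (x : ℝ) : ℝ :=
  Real.sqrt Real.pi / 2 *
    ∑' s : ℕ, (-1) ^ s / ((s.factorial : ℝ) * Real.Gamma (n + s + 3 / 2)) *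
      (x / 2) ^ (n + 2 * (s : ℤ))

/-- `dⁿ⁺ᵐ/dxⁿ⁺ᵐ (x² - 1)ⁿ / (2ⁿ n!)`, the `m`-th derivative of the Legendre polynomial `P_n`
(Rodrigues' formula). -/
def legendreDeriv (n m : ℕ) (x : ℝ) : ℝ :=
  (Polynomial.derivative^[n + m] ((Polynomial.X ^ 2 - 1 : Polynomial ℝ) ^ n)).eval x /
    (2 ^ n * (n.factorial : ℝ))

/-- The associated Legendre function `P_n^m(x) = (-1)^m (1 - x²)^{m/2} (d/dx)^m P_n(x)` for
`0 ≤ m`, `-1 ≤ x ≤ 1`. -/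
def assocLegendre (n m : ℕ) (x : ℝ) : ℝ :=
  (-1) ^ m * Real.sqrt (1 - x ^ 2) ^ m * legendreDeriv n m x

/-- The orthonormal spherical harmonic `Y_{nm}(θ, φ)`, `-n ≤ m ≤ n`, with
`Y_{n,-m} = (-1)^m conj Y_{nm}`. -/
def sphHarmonic (n : ℕ) (m : ℤ) (θ φ : ℝ) : ℂ :=
  (if m < 0 then (-1) ^ m.natAbs else 1) *
    (Real.sqrt ((2 * n + 1) / (4 * Real.pi) *
      (((n - m.natAbs).factorial : ℝ) / ((n + m.natAbs).factorial : ℝ))) : ℂ) *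
    (assocLegendre n m.natAbs (Real.cos θ) : ℂ) * Complex.exp (Complex.I * m * φ)

/-- The polar angle of a point of space. -/
def polarAngle (r : E3) : ℝ := Real.arccos (r 2 / ‖r‖)

/-- The azimuthal angle of a point of space. -/
def azimuth (r : E3) : ℝ := Complex.arg ⟨r 0, r 1⟩

/-! ### Spherical vector-wave modes -/

/-- The vector field `r ↦ r j_n(k‖r‖) Y_{nm}(θ, φ)`. -/
def radialWave (k : ℝ) (n : ℕ) (m : ℤ) (r : E3) : C3 :=
  WithLp.toLp 2 fun i =>
    (r i : ℂ) * ((sphBessel n (k * ‖r‖) : ℂ) * sphHarmonic n m (polarAngle r) (azimuth r))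

/-- The degree `n` in the numbering `p = 2 (n (n + 1) + m - 1) + l` of the triples `(n, m, l)`,
`n ≥ 1`, `-n ≤ m ≤ n`, `l ∈ {1, 2}`, by the positive integers `p`. -/
def degree (p : ℕ+) : ℕ := Nat.sqrt (((p : ℕ) - 1) / 2 + 1)

/-- The order `m` in the numbering `p = 2 (n (n + 1) + m - 1) + l`. -/
def order (p : ℕ+) : ℤ :=
  ((((p : ℕ) - 1) / 2 + 1 : ℕ) : ℤ) - (degree p : ℤ) * ((degree p : ℤ) + 1)

/-- The polarization `l` in the numbering `p = 2 (n (n + 1) + m - 1) + l`. -/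
def polarization (p : ℕ+) : ℕ := if Odd (p : ℕ) then 1 else 2

/-- Each `p` is the number of the triple assigned to it, and that triple is admissible. -/
theorem mode_numbering (p : ℕ+) :
    1 ≤ degree p ∧ |order p| ≤ (degree p : ℤ) ∧
      ((p : ℕ) : ℤ) =
        2 * ((degree p : ℤ) * ((degree p : ℤ) + 1) + order p - 1) + (polarization p : ℤ) := by
  have hp : 1 ≤ (p : ℕ) := p.2
  have h1 : degree p * degree p ≤ ((p : ℕ) - 1) / 2 + 1 := Nat.sqrt_le _
  have h2 : ((p : ℕ) - 1) / 2 + 1 < (degree p + 1) * (degree p + 1) := Nat.lt_succ_sqrt _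
  have h0 : 1 ≤ degree p := by
    by_contra h
    have h3 : degree p = 0 := by omega
    rw [h3] at h2
    omega
  unfold order polarization
  generalize degree p = d at *
  zify at h1 h2
  refine ⟨h0, ?_, ?_⟩
  · rw [abs_le]
    push_cast
    constructor <;> nlinarith
  · split_ifs with h
    · obtain ⟨t, ht⟩ := h
      rw [ht]
      have : (2 * t + 1 - 1) / 2 = t := by omega
      rw [this]
      push_cast
      ring
    · rw [Nat.not_odd_iff_even] at h
      obtain ⟨t, ht⟩ := h
      have : ((p : ℕ) - 1) / 2 + 1 = t := by omega
      rw [this, ht]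
      push_cast
      ring

/-- Each admissible triple is assigned to its number. -/
theorem mode_numbering_unique (n : ℕ) (m : ℤ) (l : ℕ) (hn : 1 ≤ n) (hm : |m| ≤ (n : ℤ))
    (hl : l = 1 ∨ l = 2) (p : ℕ+)
    (hp : ((p : ℕ) : ℤ) = 2 * ((n : ℤ) * ((n : ℤ) + 1) + m - 1) + (l : ℤ)) :
    degree p = n ∧ order p = m ∧ polarization p = l := by
  rw [abs_le] at hm
  have hq : ((((p : ℕ) - 1) / 2 + 1 : ℕ) : ℤ) = (n : ℤ) * ((n : ℤ) + 1) + m := by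
    have h1 : 1 ≤ (n : ℤ) * ((n : ℤ) + 1) + m := by
      have : (1 : ℤ) ≤ n := by exact_mod_cast hn
      nlinarith
    generalize (n : ℤ) * ((n : ℤ) + 1) + m = q at *
    omega
  have hd : degree p = n := by
    symm
    rw [degree, Nat.eq_sqrt]
    zify at hq ⊢
    rw [hq]
    constructor <;> nlinarith
  refine ⟨hd, ?_, ?_⟩
  · rw [order, hd, hq]
    ring
  · unfold polarization
    split_ifs with h
    · obtain ⟨t, ht⟩ := h
      generalize (n : ℤ) * ((n : ℤ) + 1) + m = q at *
      omega
    · rw [Nat.not_odd_iff_even] at h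
      obtain ⟨t, ht⟩ := h
      generalize (n : ℤ) * ((n : ℤ) + 1) + m = q at *
      omega

/-- The mode `V_p`: `V_{nm1} = ∇ × (r j_n Y_{nm})` for odd `p` (TE), and
`V_{nm2} = k⁻¹ ∇ × ∇ × (r j_n Y_{nm})` for even `p` (TM). -/
def mode (k : ℝ) (p : ℕ+) (r : E3) : C3 :=
  if Odd (p : ℕ) then curl (radialWave k (degree p) (order p)) r
  else (1 / (k : ℂ)) • curl (curl (radialWave k (degree p) (order p))) r

/-- The normalized mode `v_p = V_p / √(∫_V |V_p|²)`. -/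
def normalizedMode (k R : ℝ) (p : ℕ+) (r : E3) : C3 :=
  ((1 / Real.sqrt (∫ x in region R, ‖mode k p x‖ ^ 2) : ℝ) : ℂ) • mode k p r

/-- The coefficient `J_p = ∫_V J(r) · v_p*(r) dr` of the current density `J`. -/
def coeff (k R : ℝ) (J : E3 → C3) (p : ℕ+) : ℂ :=
  ∫ r in region R, ∑ i, J r i * conj (normalizedMode k R p r i)

/-- The coefficient `T_p` of the mode `p`, in terms of `x = k R` and the degree `n` of `p`. -/
def modeResistance (η k R : ℝ) (p : ℕ+) : ℝ :=
  let n : ℤ := degree p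
  let x : ℝ := k * R
  if Odd (p : ℕ) then
    η * k ^ 2 * R ^ 3 / 4 *
      (sphBessel (n - 1) x ^ 2 + sphBessel n x ^ 2
        - (2 * n + 1) / x * sphBessel (n - 1) x * sphBessel n x)
  else
    η * k ^ 2 * R ^ 3 / 4 *
      ((n + 1) / (2 * n + 1) *
          (sphBessel (n - 2) x ^ 2 + sphBessel (n - 1) x ^ 2
            - (2 * n - 1) / x * sphBessel (n - 2) x * sphBessel (n - 1) x)
        + n / (2 * n + 1) *
          (sphBessel n x ^ 2 + sphBessel (n + 1) x ^ 2
            - (2 * n + 3) / x * sphBessel n x * sphBessel (n + 1) x))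

end

end SphericalModes

open SphericalModes

/-! Only the part of the Green dyad that is anti-Hermitian under exchange of the two points enters
the power. Subtracting the conjugate of the exchanged dyad cancels the singular `cos(kρ)/ρ` part and
leaves `(ik/2π)(I + k⁻²∇∇)(sin(kρ)/(kρ))`, which is smooth (`dyad_scalarGreen_sub_conj`). The
excluded set `|r - r'| < δ` is symmetric, so for every `δ > 0` the truncated power is exactly a
double integral of this smooth kernel (`truncatedPower_eq`); the limit `δ → 0` is then dominated
convergence.

It remains to expand the smooth kernel in the modes. Solid harmonics are realized as Laurent
coefficients in `t` of the powers `(z + (w t - v/t)/2)^n` with `w = x + iy`, `v = x - iy`. This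
makes their derivatives along `∂x ± i∂y` and `∂z` purely algebraic, and together with the Bessel
recurrences it yields first-derivative formulas for the vector waves (`hasLadder_te`,
`hasLadder_tm`). Let `K_N(r, r')` be the weighted sum of the dyads of all modes of degree at most
`N`. When both points are translated together, its derivative telescopes: the TE-TM terms cancel,
raising from one degree cancels lowering from the next, and only a term linking the degrees `N` and
`N + 1` survives (`hasLadder_kernelSum`). That term decays factorially, so the mean value inequality
gives `K_N(r, r') - K_N(r - r', 0) → 0` uniformly on the ball (`norm_kernelSum_sub_le`). With one
point at the origin only the TM waves of degree 1 survive, and they give the smooth dyad exactly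
(`kernelSum_origin_eq_smoothDyadic`). Integrated against the current, each dyad becomes the squared
modulus of a coefficient.

The values `T_p` come from the energies of the waves on the ball. Rotation invariance of the ball
gives a relation between inner products of solid harmonics of consecutive orders, from which both
the orthogonality of distinct degrees (`solidInner_eq_zero`) and the dependence of the norms on the
order follow. The remaining radial integral of `j_n²` has a closed antiderivative
(`hasDerivAt_besselEnergy`). Finally the terms are non-negative, so convergence along the sums of
bounded degree is unconditional convergence (`exists_hasSum_power`), and the expectations are
compared sample by sample. -/

namespace SphericalModes

noncomputable section

/-! ### Laurent coefficients of powers of a linear form -/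

/-- The coefficient of `t ^ m` in `(z + (w t - v / t) / 2) ^ n`. -/
def nullCoeff (w v z : ℂ) : ℕ → ℤ → ℂ
  | 0, m => if m = 0 then 1 else 0
  | n + 1, m =>
    z * nullCoeff w v z n m + (w * nullCoeff w v z n (m - 1) - v * nullCoeff w v z n (m + 1)) / 2

section nullCoeff
variable (w v z : ℂ)

theorem nullCoeff_succ (n : ℕ) (m : ℤ) : nullCoeff w v z (n + 1) m =
    z * nullCoeff w v z n m +
      (w * nullCoeff w v z n (m - 1) - v * nullCoeff w v z n (m + 1)) / 2 := rfl

theorem nullCoeff_eq_zero (n : ℕ) : ∀ m : ℤ, (n : ℤ) < |m| → nullCoeff w v z n m = 0 := by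
  induction n with
  | zero =>
    intro m hm
    have : m ≠ 0 := by rintro rfl; simp at hm
    simp [nullCoeff, this]
  | succ n ih =>
    intro m hm
    push_cast at hm
    have h1 : (n : ℤ) < |m| := by omega
    have h2 : (n : ℤ) < |m - 1| := by
      rcases abs_cases m with ⟨h, _⟩ | ⟨h, _⟩ <;> rcases abs_cases (m - 1) with ⟨h', _⟩ | ⟨h', _⟩ <;>
        omega
    have h3 : (n : ℤ) < |m + 1| := by
      rcases abs_cases m with ⟨h, _⟩ | ⟨h, _⟩ <;> rcases abs_cases (m + 1) with ⟨h', _⟩ | ⟨h', _⟩ <;>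
        omega
    rw [nullCoeff_succ, ih _ h1, ih _ h2, ih _ h3]
    ring

/-- This is the Euler operator `t d/dt` applied to the power of degree `n + 1`: it multiplies the
coefficient of `t^m` by `m`, and it sends the form itself to `(w t + v/t)/2`. -/
theorem order_mul_nullCoeff (n : ℕ) : ∀ m : ℤ, (m : ℂ) * nullCoeff w v z (n + 1) m =
    (n + 1) * (w * nullCoeff w v z n (m - 1) + v * nullCoeff w v z n (m + 1)) / 2 := by
  induction n with
  | zero =>
    intro m
    by_cases h0 : m = 0
    · subst h0; simp [nullCoeff]
    by_cases h1 : m = 1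
    · subst h1; simp [nullCoeff]
    by_cases h2 : m = -1
    · subst h2; simp [nullCoeff]; ring
    have e1 : m - 1 ≠ 0 := by omega
    have e2 : m + 1 ≠ 0 := by omega
    simp [nullCoeff, h0, e1, e2]
  | succ n ih =>
    intro m
    have a1 := ih m
    have a2 := ih (m - 1)
    have a3 := ih (m + 1)
    have e1 : m - 1 + 1 = m := by ring
    have e2 : m + 1 - 1 = m := by ring
    have b1 := nullCoeff_succ w v z n (m - 1)
    have b2 := nullCoeff_succ w v z n (m + 1)
    have b3 := nullCoeff_succ w v z (n + 1) m
    rw [e1] at a2 b1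
    rw [e2] at a3 b2
    rw [b3]
    push_cast at *
    linear_combination z * a1 + w / 2 * a2 - v / 2 * a3 - w * (n + 1) / 2 * b1
      - v * (n + 1) / 2 * b2

/-- Adding the Euler relation to the defining recursion eliminates `v`; subtracting them, in the
next lemma, eliminates `w`. -/
theorem fst_mul_nullCoeff (n : ℕ) (m : ℤ) : (n + 1) * (w * nullCoeff w v z n m) =
    (n + m + 2) * nullCoeff w v z (n + 1) (m + 1) - (n + 1) * (z * nullCoeff w v z n (m + 1)) := by
  have h1 := order_mul_nullCoeff w v z n (m + 1)
  have h2 := nullCoeff_succ w v z n (m + 1)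
  rw [add_sub_cancel_right] at h1 h2
  push_cast at h1
  linear_combination - h1 - (n + 1) * h2

theorem snd_mul_nullCoeff (n : ℕ) (m : ℤ) : (n + 1) * (v * nullCoeff w v z n m) =
    (n + 1) * (z * nullCoeff w v z n (m - 1)) - (n + 2 - m) * nullCoeff w v z (n + 1) (m - 1) := by
  have h1 := order_mul_nullCoeff w v z n (m - 1)
  have h2 := nullCoeff_succ w v z n (m - 1)
  rw [sub_add_cancel] at h1 h2
  push_cast at h1
  linear_combination - h1 + (n + 1) * h2

/-- Multiplication by `z` splits into degrees `n + 1` and `n - 1`. The product `v · (w ·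
coefficient)` is evaluated by the two preceding relations, and the combination `w v + z²`, later the
squared radius, appears. The factor `n` makes the truncated `n - 1` harmless at `n = 0`. -/
theorem thd_mul_nullCoeff (n : ℕ) (m : ℤ) : (2 * n + 1) * (n + 1) * (z * nullCoeff w v z n m) =
    n * (n + 1) * ((w * v + z ^ 2) * nullCoeff w v z (n - 1) m) +
      ((n + 1) ^ 2 - m ^ 2) * nullCoeff w v z (n + 1) m := by
  cases n with
  | zero =>
    by_cases h0 : m = 0
    · subst h0; simp [nullCoeff]
    by_cases h1 : m = 1
    · subst h1; simp [nullCoeff]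
    by_cases h2 : m = -1
    · subst h2; simp [nullCoeff]
    have e1 : m - 1 ≠ 0 := by omega
    have e2 : m + 1 ≠ 0 := by omega
    simp [nullCoeff, h0, e1, e2]
  | succ n =>
    rw [Nat.add_sub_cancel]
    have h1 := fst_mul_nullCoeff w v z n m
    have h2 := snd_mul_nullCoeff w v z (n + 1) (m + 1)
    have h3 := snd_mul_nullCoeff w v z n (m + 1)
    rw [add_sub_cancel_right] at h2 h3
    push_cast at *
    linear_combination (-(n + 2) * v) * h1 - (n + m + 2) * h2 + (n + 2) * z * h3

theorem fst_mul_nullCoeff' (n : ℕ) (m : ℤ) : (n + 1) * (2 * n + 1) * (w * nullCoeff w v z n m) =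
    (n + m + 2) * (n + m + 1) * nullCoeff w v z (n + 1) (m + 1) -
      n * (n + 1) * ((w * v + z ^ 2) * nullCoeff w v z (n - 1) (m + 1)) := by
  have h1 := fst_mul_nullCoeff w v z n m
  have h2 := thd_mul_nullCoeff w v z n (m + 1)
  push_cast at h2
  linear_combination (2 * n + 1) * h1 - h2

theorem snd_mul_nullCoeff' (n : ℕ) (m : ℤ) : (n + 1) * (2 * n + 1) * (v * nullCoeff w v z n m) =
    n * (n + 1) * ((w * v + z ^ 2) * nullCoeff w v z (n - 1) (m - 1)) -
      (n - m + 2) * (n - m + 1) * nullCoeff w v z (n + 1) (m - 1) := by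
  have h1 := snd_mul_nullCoeff w v z n m
  have h2 := thd_mul_nullCoeff w v z n (m - 1)
  push_cast at h2
  linear_combination (2 * n + 1) * h1 + h2

/-- The substitution `t ↦ -1/t` exchanges `w` and `v` in the form. -/
theorem nullCoeff_neg (n : ℕ) : ∀ m : ℤ,
    nullCoeff w v z n (-m) = (-1) ^ m * nullCoeff v w z n m := by
  induction n with
  | zero =>
    intro m
    by_cases h0 : m = 0
    · subst h0; simp [nullCoeff]
    · simp [nullCoeff, h0]
  | succ n ih =>
    intro m
    rw [nullCoeff_succ, nullCoeff_succ, ih, show -m - 1 = -(m + 1) by ring,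
      show -m + 1 = -(m - 1) by ring, ih, ih, zpow_add₀ (by norm_num), zpow_sub₀ (by norm_num)]
    simp
    ring

theorem nullCoeff_smul (c : ℂ) (n : ℕ) : ∀ m : ℤ,
    nullCoeff (c * w) (c * v) (c * z) n m = c ^ n * nullCoeff w v z n m := by
  induction n with
  | zero => intro m; simp [nullCoeff]
  | succ n ih => intro m; simp only [nullCoeff_succ, ih]; ring

theorem norm_nullCoeff_le {ρ : ℝ} (hw : ‖w‖ ≤ ρ) (hv : ‖v‖ ≤ ρ) (hz : ‖z‖ ≤ ρ) (n : ℕ) : ∀ m : ℤ,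
    ‖nullCoeff w v z n m‖ ≤ (2 * ρ) ^ n := by
  have hρ : 0 ≤ ρ := (norm_nonneg _).trans hw
  induction n with
  | zero => intro m; by_cases h0 : m = 0 <;> simp [nullCoeff, h0]
  | succ n ih =>
    intro m
    rw [nullCoeff_succ]
    calc _ ≤ ‖z‖ * ‖nullCoeff w v z n m‖ + (‖w‖ * ‖nullCoeff w v z n (m - 1)‖
          + ‖v‖ * ‖nullCoeff w v z n (m + 1)‖) / 2 := by
          refine (norm_add_le _ _).trans ?_
          rw [norm_mul, norm_div, Complex.norm_ofNat]
          gcongr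
          refine (norm_sub_le _ _).trans ?_
          rw [norm_mul, norm_mul]
      _ ≤ ρ * (2 * ρ) ^ n + (ρ * (2 * ρ) ^ n + ρ * (2 * ρ) ^ n) / 2 := by
          gcongr <;> exact ih _
      _ = (2 * ρ) ^ (n + 1) := by ring

theorem nullCoeff_eq_of_fst_eq_zero (n : ℕ) : ∀ m : ℤ,
    nullCoeff 0 0 z n m = if m = 0 then z ^ n else 0 := by
  induction n with
  | zero => intro m; simp [nullCoeff]
  | succ n ih => intro m; rw [nullCoeff_succ, ih]; split_ifs <;> ring

/-- With `u = w t` and `w v = 1 - z²` the form equals `((u + z)² - 1)/(2u)`. Its powers are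
therefore Taylor expansions of `(x² - 1)^n` at `z`, which is the link to Rodrigues' formula. -/
theorem nullCoeff_eq_coeff (hw : w ≠ 0) (h : w * v = 1 - z ^ 2) (n : ℕ) : ∀ j : ℕ,
    nullCoeff w v z n ((j : ℤ) - n) =
      w ^ ((j : ℤ) - n) * ((((Polynomial.X + Polynomial.C z) ^ 2 - 1) ^ n).coeff j / 2 ^ n) := by
  have hv : v = (1 - z ^ 2) / w := by rw [← h]; field_simp
  induction n with
  | zero =>
    intro j
    by_cases hj : j = 0
    · simp [nullCoeff, hj]
    · simp [nullCoeff, hj, Polynomial.coeff_one]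
  | succ n ih =>
    intro j
    set Q := ((Polynomial.X + Polynomial.C z) ^ 2 - 1 : Polynomial ℂ) with hQ
    have e1 : ((j : ℤ) - (n + 1 : ℕ)) + 1 = (j : ℤ) - n := by push_cast; ring
    have hQ' : Q ^ (n + 1) = Q ^ n * Polynomial.X * Polynomial.X + Polynomial.C (2 * z) *
        (Q ^ n * Polynomial.X) + Polynomial.C (z ^ 2 - 1) * Q ^ n := by
      rw [pow_succ, hQ]
      simp only [map_mul, map_pow, map_sub, map_one, map_ofNat]
      ring
    rw [nullCoeff_succ, e1, ih j, hQ']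
    simp only [Polynomial.coeff_add, Polynomial.coeff_C_mul]
    match j with
    | 0 =>
      rw [nullCoeff_eq_zero _ _ _ _ _ (by push_cast; rw [abs_of_neg] <;> omega),
        nullCoeff_eq_zero _ _ _ _ _ (by push_cast; rw [abs_of_neg] <;> omega), hv, ← e1,
        zpow_add_one₀ hw]
      simp only [Polynomial.coeff_mul_X_zero]
      field_simp
      ring
    | 1 =>
      have h1 := ih 0
      have e2 : (((1 : ℕ) : ℤ) - (n + 1 : ℕ)) = ((0 : ℕ) : ℤ) - n := by push_cast; ring
      rw [e2, nullCoeff_eq_zero _ _ _ _ (((0 : ℕ) : ℤ) - n - 1)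
        (by push_cast; rw [abs_of_neg] <;> omega), h1, hv,
        show ((1 : ℕ) : ℤ) - (n : ℤ) = ((0 : ℕ) : ℤ) - n + 1 by push_cast; ring, zpow_add_one₀ hw]
      have c1 := Polynomial.coeff_mul_X (Q ^ n * Polynomial.X) 0
      have c2 := Polynomial.coeff_mul_X (Q ^ n) 0
      rw [zero_add] at c1 c2
      rw [c1, c2, Polynomial.coeff_mul_X_zero]
      generalize w ^ (((0 : ℕ) : ℤ) - n) = q
      field_simp
      ring
    | j + 2 =>
      have h1 := ih (j + 1)
      have h0 := ih j
      have e2 : (((j + 2 : ℕ) : ℤ) - (n + 1 : ℕ)) = ((j + 1 : ℕ) : ℤ) - n := by push_cast; ring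
      have e3 : ((j + 1 : ℕ) : ℤ) - n = (j : ℤ) - n + 1 := by push_cast; ring
      have e4 : ((j + 2 : ℕ) : ℤ) - n = (j : ℤ) - n + 1 + 1 := by push_cast; ring
      rw [e2, h1, e3, add_sub_cancel_right, h0, hv, e4]
      simp only [Polynomial.coeff_mul_X, zpow_add_one₀ hw]
      generalize w ^ ((j : ℤ) - n) = q
      field_simp
      ring

end nullCoeff

/-! ### Spherical Bessel functions through entire functions of the squared argument -/

/-- The coefficients of the entire function `besselEntire n`. -/
def besselCoeff (n : ℤ) (j : ℕ) : ℝ :=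
  Real.sqrt Real.pi / 2 * (2 ^ n)⁻¹ * ((-1 / 4) ^ j / (j.factorial * Real.Gamma (n + j + 3 / 2)))

/-- The entire function `D_n` with `j_n(x) = x ^ n D_n(x ^ 2)`. -/
def besselEntire (n : ℤ) (s : ℝ) : ℝ := ∑' j : ℕ, besselCoeff n j * s ^ j

theorem intCast_add_half_ne_zero (n : ℤ) : (n : ℝ) + 1 / 2 ≠ 0 := by
  intro h
  have h1 : (2 * n + 1 : ℝ) = 0 := by linarith
  have h2 : 2 * n + 1 = 0 := by exact_mod_cast h1
  omega

theorem besselCoeff_succ_mul (n : ℤ) (j : ℕ) :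
    besselCoeff n (j + 1) * (j + 1) = -1 / 2 * besselCoeff (n + 1) j := by
  have h1 : ((n : ℝ) + (j + 1 : ℕ) + 3 / 2) = ((n + 1 : ℤ) : ℝ) + j + 3 / 2 := by push_cast; ring
  rw [besselCoeff, besselCoeff, h1, Nat.factorial_succ, zpow_add_one₀ (by norm_num)]
  have : ((j : ℝ) + 1) ≠ 0 := by positivity
  push_cast
  generalize Real.Gamma _ = g
  rw [mul_inv, pow_succ, mul_assoc ((j : ℝ) + 1), ← div_div]
  field_simp
  ring

/-- This is the functional equation of `Γ`. The argument is a half-integer, never zero, so negative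
orders are allowed. -/
theorem besselCoeff_pred (n : ℤ) (j : ℕ) :
    besselCoeff (n - 1) j = (2 * (n + j) + 1) * besselCoeff n j := by
  have h0 := intCast_add_half_ne_zero (n + j)
  push_cast at h0
  have h1 : ((n - 1 : ℤ) : ℝ) + j + 3 / 2 = n + j + 1 / 2 := by push_cast; ring
  have h2 : ((n : ℝ) + j + 3 / 2) = (n + j + 1 / 2) + 1 := by ring
  rw [besselCoeff, besselCoeff, h1, h2, Real.Gamma_add_one h0, zpow_sub_one₀ (by norm_num)]
  generalize Real.Gamma _ = g
  have h3 : (2 * ((n : ℝ) + j) + 1) = 2 * (n + j + 1 / 2) := by ring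
  rw [h3]
  have h4 : 2 * ((n : ℝ) + j + 1 / 2) ≠ 0 := mul_ne_zero two_ne_zero h0
  rw [← div_div, mul_inv, inv_inv, ← div_div, ← div_div]
  generalize (n : ℝ) + j + 1 / 2 = y at *
  field_simp

/-- Coefficientwise form of `j_{n-1} + j_{n+1} = (2n+1) j_n / x`. -/
theorem besselCoeff_recurrence (n : ℤ) (j : ℕ) :
    (2 * n + 1) * besselCoeff n (j + 1) - besselCoeff (n + 1) j = besselCoeff (n - 1) (j + 1) := by
  have h1 := besselCoeff_succ_mul n j
  have h2 := besselCoeff_pred n (j + 1)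
  push_cast at h2
  linear_combination -2 * h1 - h2

theorem factorial_le_Gamma (n : ℕ) :
    Real.sqrt Real.pi / 2 * n.factorial ≤ Real.Gamma (n + 3 / 2) := by
  induction n with
  | zero =>
    have := Real.Gamma_add_one (s := 1 / 2) (by norm_num)
    rw [Real.Gamma_one_half_eq] at this
    norm_num at this ⊢
    rw [this]
    linarith
  | succ n ih =>
    have := Real.Gamma_add_one (s := n + 3 / 2) (by positivity)
    push_cast
    rw [show (n : ℝ) + 1 + 3 / 2 = n + 3 / 2 + 1 by ring, this, Nat.factorial_succ]
    push_cast
    have h : 0 ≤ Real.sqrt Real.pi / 2 * n.factorial := by positivity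
    nlinarith

/-- The factor `1/n!`, uniform in `j`, is what later yields factorial decay in the degree. -/
theorem abs_besselCoeff_le (n j : ℕ) :
    |besselCoeff n j| ≤ (1 / n.factorial : ℝ) * ((1 / 4) ^ j / j.factorial) := by
  have h1 := factorial_le_Gamma (n + j)
  have h2 : (n.factorial : ℝ) ≤ (n + j).factorial := by
    exact_mod_cast Nat.factorial_le (Nat.le_add_right n j)
  have hs : 0 < Real.sqrt Real.pi / 2 := by positivity
  have hf : (0 : ℝ) < n.factorial := by positivity
  have h3 : Real.sqrt Real.pi / 2 * n.factorial ≤ Real.Gamma (n + j + 3 / 2) := by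
    push_cast at h1
    refine le_trans ?_ h1
    gcongr
  have hG : 0 < Real.Gamma (n + j + 3 / 2) := lt_of_lt_of_le (by positivity) h3
  have hp : (1 : ℝ) ≤ 2 ^ n := one_le_pow₀ (by norm_num)
  rw [besselCoeff, abs_mul, abs_mul, abs_of_pos hs]
  simp only [zpow_natCast, Int.cast_natCast]
  rw [abs_div, abs_pow, abs_mul, abs_of_pos hG, abs_of_nonneg (a := ((2 : ℝ) ^ n)⁻¹) (by positivity),
    Nat.abs_cast, show |(-1 / 4 : ℝ)| = 1 / 4 by norm_num]
  calc _ = (Real.sqrt Real.pi / 2 / Real.Gamma (n + j + 3 / 2)) * (2 ^ n)⁻¹ *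
        ((1 / 4) ^ j / j.factorial) := by
        field_simp
    _ ≤ (1 / n.factorial) * 1 * ((1 / 4) ^ j / j.factorial) := by
        have h4 : Real.sqrt Real.pi / 2 / Real.Gamma (n + j + 3 / 2) ≤ 1 / n.factorial := by
          rw [div_le_div_iff₀ hG hf, one_mul]
          exact h3
        exact mul_le_mul_of_nonneg_right (mul_le_mul h4 (inv_le_one_of_one_le₀ hp) (by positivity)
          (by positivity)) (by positivity)
    _ = _ := by ring

theorem summable_besselCoeff_nat (n : ℕ) (s : ℝ) :
    Summable fun j => besselCoeff n j * s ^ j := by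
  refine Summable.of_norm_bounded (g := fun j : ℕ => (|s| / 4) ^ j / (j.factorial : ℝ) *
    (1 / n.factorial : ℝ)) ((Real.summable_pow_div_factorial _).mul_right _) fun j => ?_
  rw [norm_mul, Real.norm_eq_abs, norm_pow, Real.norm_eq_abs]
  calc _ ≤ (1 / n.factorial : ℝ) * ((1 / 4) ^ j / j.factorial) * |s| ^ j := by
        gcongr; exact abs_besselCoeff_le n j
    _ = _ := by rw [div_pow, div_pow, one_pow]; field_simp

/-- Order `-1` is included because the even coefficients of degree 1 contain `j_{-1}`. Its series is
obtained from those of orders 0 and 1 through the three-term recurrence. -/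
theorem summable_besselCoeff {n : ℤ} (hn : -1 ≤ n) (s : ℝ) :
    Summable fun j => besselCoeff n j * s ^ j := by
  rcases hn.lt_or_eq with hn | rfl
  · obtain ⟨n, rfl⟩ := Int.eq_ofNat_of_zero_le (by omega : 0 ≤ n)
    exact summable_besselCoeff_nat n s
  · have h0 := summable_besselCoeff_nat 0 s
    have h1 := summable_besselCoeff_nat 1 s
    refine (summable_nat_add_iff 1).1 ?_
    have := ((summable_nat_add_iff 1).2 h0).sub (h1.mul_left s)
    refine this.congr fun j => ?_
    have := besselCoeff_recurrence 0 j
    norm_num at this ⊢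
    rw [← this]
    ring

theorem besselEntire_recurrence (n : ℕ) (s : ℝ) :
    besselEntire (n - 1) s = (2 * n + 1) * besselEntire n s - s * besselEntire (n + 1) s := by
  have h0 := summable_besselCoeff (n := n) (by omega) s
  have h1 := summable_besselCoeff (n := n + 1) (by omega) s
  have h2 := summable_besselCoeff (n := n - 1) (by omega) s
  have hp := besselCoeff_pred n 0
  rw [besselEntire, besselEntire, besselEntire, h0.tsum_eq_zero_add, h2.tsum_eq_zero_add, mul_add,
    ← tsum_mul_left, ← tsum_mul_left, add_sub_assoc,
    ← (((summable_nat_add_iff 1).2 h0).mul_left _).tsum_sub (h1.mul_left _)]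
  congr 1
  · rw [hp]; push_cast; ring
  · refine tsum_congr fun j => ?_
    rw [← besselCoeff_recurrence]
    push_cast
    ring

/-- Termwise differentiation: the differentiated series is, up to the factor `-1/2`, the series of
the next order. -/
theorem hasDerivAt_besselEntire {n : ℤ} (hn : -1 ≤ n) (s : ℝ) :
    HasDerivAt (besselEntire n) (-1 / 2 * besselEntire (n + 1) s) s := by
  obtain ⟨q, hq⟩ := Int.eq_ofNat_of_zero_le (by omega : 0 ≤ n + 1)
  have key : HasDerivAt (fun z => ∑' j, besselCoeff n j * z ^ j)
      (∑' j : ℕ, besselCoeff n j * (j * s ^ (j - 1))) s := by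
    -- The dominating series is the differentiated one at `|s| + 1`, which bounds it on the whole
    -- ball of that radius around 0, a neighbourhood of `s`.
    have hu : Summable fun j : ℕ => |besselCoeff n j| * (j * (|s| + 1) ^ (j - 1)) := by
      refine (summable_nat_add_iff 1).1 ?_
      have h1 := (summable_besselCoeff (n := n + 1) (by omega) (|s| + 1)).norm.mul_left (1 / 2)
      refine h1.congr fun j => ?_
      have h2 := congrArg abs (besselCoeff_succ_mul n j)
      rw [abs_mul, abs_mul, abs_of_nonneg (by positivity : (0 : ℝ) ≤ j + 1)] at h2
      norm_num at h2 ⊢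
      rw [abs_of_nonneg (by positivity : 0 ≤ |s| + 1), ← mul_assoc, ← mul_assoc, h2]
    refine hasDerivAt_tsum_of_isPreconnected (g := fun (j : ℕ) (z : ℝ) => besselCoeff n j * z ^ j)
      (g' := fun (j : ℕ) (z : ℝ) => besselCoeff n j * (j * z ^ (j - 1)))
      (t := Metric.ball 0 (|s| + 1)) hu Metric.isOpen_ball
      (convex_ball _ _).isPreconnected (fun j y _ => ?_) (fun j y hy => ?_)
      (y₀ := s) (by simp) (summable_besselCoeff hn s) (by simp)
    · exact (hasDerivAt_pow j y).const_mul _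
    · rw [Metric.mem_ball, dist_zero_right, Real.norm_eq_abs] at hy
      rw [norm_mul, norm_mul, norm_pow, Real.norm_eq_abs, Real.norm_eq_abs, Real.norm_eq_abs,
        Nat.abs_cast]
      gcongr
  have h2 : (∑' j : ℕ, besselCoeff n j * (j * s ^ (j - 1))) = -1 / 2 * besselEntire (n + 1) s := by
    rw [tsum_eq_zero_add', besselEntire, ← tsum_mul_left]
    · simp only [Nat.cast_zero, zero_mul, mul_zero, zero_add]
      refine tsum_congr fun j => ?_
      rw [← mul_assoc, ← mul_assoc, ← besselCoeff_succ_mul]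
      push_cast
      simp [mul_assoc]
    · refine ((summable_besselCoeff (n := n + 1) (by omega) s).mul_left (-1 / 2)).congr fun j => ?_
      rw [← mul_assoc, ← besselCoeff_succ_mul]
      push_cast
      simp [mul_assoc]
  rw [← h2]
  exact key

theorem abs_besselEntire_le (n : ℕ) {s ρ : ℝ} (hs : |s| ≤ ρ) :
    |besselEntire n s| ≤ Real.exp ρ / n.factorial := by
  have hρ : 0 ≤ ρ := (abs_nonneg _).trans hs
  rw [besselEntire, ← Real.norm_eq_abs]
  have h := (NormedSpace.expSeries_div_hasSum_exp (𝔸 := ℝ) ρ).mul_right (1 / n.factorial : ℝ)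
  rw [← congrFun Real.exp_eq_exp_ℝ ρ, mul_one_div] at h
  refine tsum_of_norm_bounded h fun j => ?_
  rw [norm_mul, Real.norm_eq_abs, norm_pow, Real.norm_eq_abs]
  calc _ ≤ (1 / n.factorial : ℝ) * ((1 / 4) ^ j / j.factorial) * ρ ^ j := by
        gcongr; exact abs_besselCoeff_le n j
    _ ≤ (1 / n.factorial : ℝ) * (1 / j.factorial) * ρ ^ j := by
        gcongr; exact pow_le_one₀ (by norm_num) (by norm_num)
    _ = _ := by field_simp

theorem sphBessel_natCast (n : ℕ) (x : ℝ) : sphBessel n x = x ^ n * besselEntire n (x ^ 2) := by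
  rw [sphBessel, besselEntire, ← tsum_mul_left, ← tsum_mul_left]
  refine tsum_congr fun j => ?_
  rw [besselCoeff, show (n : ℤ) + 2 * (j : ℤ) = ((n + 2 * j : ℕ) : ℤ) by push_cast; ring,
    zpow_natCast, zpow_natCast, div_pow, pow_add, pow_add, pow_mul, pow_mul, div_pow]
  norm_num
  field_simp

theorem sphBessel_neg_one {x : ℝ} (hx : x ≠ 0) : sphBessel (-1) x = x⁻¹ * besselEntire (-1) (x ^ 2) := by
  rw [sphBessel, besselEntire, ← tsum_mul_left, ← tsum_mul_left]
  refine tsum_congr fun j => ?_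
  rw [besselCoeff, zpow_add₀ (by positivity), zpow_mul, div_pow]
  norm_num
  rw [div_pow, div_pow, show (4 : ℝ) = 2 ^ 2 by norm_num]
  field_simp

/-- Closed form needed to recognize order 0 as `sin x / x`, the function that arises from the Green
function. -/
theorem besselCoeff_zero (j : ℕ) : besselCoeff 0 j = (-1) ^ j / (2 * j + 1).factorial := by
  induction j with
  | zero =>
    have := Real.Gamma_add_one (s := 1 / 2) (by norm_num)
    rw [Real.Gamma_one_half_eq] at this
    norm_num at this
    simp [besselCoeff]
    rw [this]
    have : Real.sqrt Real.pi ≠ 0 := by positivity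
    field_simp
  | succ j ih =>
    have h1 := besselCoeff_succ_mul 0 j
    have h2 := besselCoeff_pred 1 j
    rw [show (0 : ℤ) + 1 = 1 from rfl] at h1
    rw [show (1 : ℤ) - 1 = 0 from rfl, ih] at h2
    push_cast at h2
    have h3 : besselCoeff 1 j = (-1) ^ j / (2 * j + 1).factorial / (2 * (1 + j) + 1) := by
      rw [h2]; field_simp
    have h4 : besselCoeff 0 (j + 1) = -1 / 2 * besselCoeff 1 j / (j + 1) := by
      rw [← h1]; field_simp
    rw [h4, h3, show 2 * (j + 1) + 1 = 2 * j + 1 + 1 + 1 by ring, Nat.factorial_succ (2 * j + 1 + 1),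
      Nat.factorial_succ (2 * j + 1)]
    push_cast
    field_simp
    ring

theorem mul_besselEntire_zero (x : ℝ) : x * besselEntire 0 (x ^ 2) = Real.sin x := by
  rw [besselEntire, ← tsum_mul_left, ← (Real.hasSum_sin x).tsum_eq]
  refine tsum_congr fun j => ?_
  rw [besselCoeff_zero, pow_succ x (2 * j), pow_mul x]
  ring

theorem besselEntire_zero_zero : besselEntire 0 0 = 1 := by
  rw [besselEntire, tsum_eq_single 0 (fun j hj => by simp [hj]), besselCoeff_zero]
  simp

/-! ### Derivatives along `∂x ± i∂y` and `∂z` -/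

/-- The complex coordinate `x + i y`. -/
def planar (r : E3) : ℂ := r 0 + Complex.I * r 1

/-- The `i`-th complex coordinate as a continuous linear map. -/
def coordCLM (i : Fin 3) : E3 →L[ℝ] ℂ := Complex.ofRealCLM.comp (EuclideanSpace.proj i)

@[simp] theorem coordCLM_apply (i : Fin 3) (v : E3) : coordCLM i v = v i := rfl

/-- The real-linear form with `(∂x + i ∂y, ∂x - i ∂y, ∂z)` components `(p, q, s)`. -/
def ladderForm (p q s : ℂ) : E3 →L[ℝ] ℂ :=
  ((p + q) / 2) • coordCLM 0 + ((p - q) / (2 * Complex.I)) • coordCLM 1 + s • coordCLM 2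

theorem ladderForm_apply (p q s : ℂ) (v : E3) : ladderForm p q s v =
    (p + q) / 2 * v 0 + (p - q) / (2 * Complex.I) * v 1 + s * v 2 := by
  simp [ladderForm]

theorem ladderForm_apply' (p q s : ℂ) (v : E3) : ladderForm p q s v =
    (conj (planar v) * p + planar v * q) / 2 + s * v 2 := by
  rw [ladderForm_apply, planar]
  simp only [map_add, map_mul, Complex.conj_ofReal, Complex.conj_I]
  field_simp
  linear_combination (p - q) * v 1 * Complex.I_sq

/-- `f` is differentiable at `r` and its derivatives along `∂x + i ∂y`, `∂x - i ∂y`, `∂z` are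
`p`, `q`, `s`. -/
def HasLadder (f : E3 → ℂ) (p q s : ℂ) (r : E3) : Prop := HasFDerivAt f (ladderForm p q s) r

namespace HasLadder
variable {f g : E3 → ℂ} {p q s p' q' s' : ℂ} {r : E3}

theorem congr_form (h : HasLadder f p q s r) (hp : p = p') (hq : q = q') (hs : s = s') :
    HasLadder f p' q' s' r := by subst hp hq hs; exact h

theorem differentiableAt (h : HasLadder f p q s r) : DifferentiableAt ℝ f r :=
  HasFDerivAt.differentiableAt h

theorem const (c : ℂ) : HasLadder (fun _ => c) 0 0 0 r := by
  have h := hasFDerivAt_const (𝕜 := ℝ) c r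
  have e : (0 : E3 →L[ℝ] ℂ) = ladderForm 0 0 0 := by ext v; simp [ladderForm_apply]
  rw [e] at h
  exact h

theorem add (hf : HasLadder f p q s r) (hg : HasLadder g p' q' s' r) :
    HasLadder (fun x => f x + g x) (p + p') (q + q') (s + s') r := by
  have h := HasFDerivAt.add hf hg
  have e : ladderForm p q s + ladderForm p' q' s' = ladderForm (p + p') (q + q') (s + s') := by
    ext v; simp [ladderForm_apply]; ring
  rw [e] at h
  exact h

theorem mul (hf : HasLadder f p q s r) (hg : HasLadder g p' q' s' r) :
    HasLadder (fun x => f x * g x) (f r * p' + p * g r) (f r * q' + q * g r)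
      (f r * s' + s * g r) r := by
  have h := HasFDerivAt.mul hf hg
  have e : f r • ladderForm p' q' s' + g r • ladderForm p q s =
      ladderForm (f r * p' + p * g r) (f r * q' + q * g r) (f r * s' + s * g r) := by
    ext v; simp [ladderForm_apply]; ring
  rw [e] at h
  exact h

theorem const_mul (c : ℂ) (hf : HasLadder f p q s r) :
    HasLadder (fun x => c * f x) (c * p) (c * q) (c * s) r := by
  refine ((const c).mul hf).congr_form ?_ ?_ ?_ <;> ring

theorem sub (hf : HasLadder f p q s r) (hg : HasLadder g p' q' s' r) :
    HasLadder (fun x => f x - g x) (p - p') (q - q') (s - s') r := by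
  have h := hf.add (hg.const_mul (-1))
  convert h using 2 <;> ring

/-- Conjugating a field exchanges the operators `∂x + i∂y` and `∂x - i∂y`. -/
theorem conjugate (hf : HasLadder f p q s r) :
    HasLadder (fun x => starRingEnd ℂ (f x)) (starRingEnd ℂ q) (starRingEnd ℂ p)
      (starRingEnd ℂ s) r := by
  have h := (Complex.conjCLE.toContinuousLinearMap.hasFDerivAt (x := f r)).comp r hf
  have e : Complex.conjCLE.toContinuousLinearMap.comp (ladderForm p q s) =
      ladderForm (starRingEnd ℂ q) (starRingEnd ℂ p) (starRingEnd ℂ s) := by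
    ext v
    simp only [ContinuousLinearMap.comp_apply, ladderForm_apply]
    simp [map_ofNat]
    field_simp
    ring
  rw [e] at h
  exact h

theorem finset_sum {ι : Type*} (t : Finset ι) {f : ι → E3 → ℂ} {p q s : ι → ℂ}
    (h : ∀ i ∈ t, HasLadder (f i) (p i) (q i) (s i) r) :
    HasLadder (fun x => ∑ i ∈ t, f i x) (∑ i ∈ t, p i) (∑ i ∈ t, q i) (∑ i ∈ t, s i) r := by
  classical
  induction t using Finset.induction_on with
  | empty => simpa using const 0
  | insert a t ha ih =>
    simp only [Finset.sum_insert ha]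
    exact (h a (Finset.mem_insert_self _ _)).add
      (ih fun i hi => h i (Finset.mem_insert_of_mem hi))

theorem pderiv_zero (h : HasLadder f p q s r) : pderiv 0 f r = (p + q) / 2 := by
  rw [pderiv, (HasFDerivAt.hasLineDerivAt h _).lineDeriv, ladderForm_apply]; simp

theorem pderiv_one (h : HasLadder f p q s r) : pderiv 1 f r = (p - q) / (2 * Complex.I) := by
  rw [pderiv, (HasFDerivAt.hasLineDerivAt h _).lineDeriv, ladderForm_apply]; simp

theorem pderiv_two (h : HasLadder f p q s r) : pderiv 2 f r = s := by
  rw [pderiv, (HasFDerivAt.hasLineDerivAt h _).lineDeriv, ladderForm_apply]; simp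

end HasLadder

theorem hasLadder_planar (r : E3) : HasLadder planar 0 2 0 r := by
  have h := (coordCLM 0 + Complex.I • coordCLM 1).hasFDerivAt (x := r)
  have e : (coordCLM 0 + Complex.I • coordCLM 1) = ladderForm 0 2 0 := by
    ext v
    rw [ladderForm_apply']
    simp [planar]
  rw [e] at h
  refine h.congr_of_eventuallyEq (Eventually.of_forall fun x => ?_)
  rw [← e]
  simp [planar]

theorem hasLadder_conj_planar (r : E3) : HasLadder (fun x => conj (planar x)) 2 0 0 r := by
  refine (hasLadder_planar r).conjugate.congr_form ?_ ?_ ?_ <;> simp [map_ofNat]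

theorem hasLadder_coord_two (r : E3) : HasLadder (fun x => (x 2 : ℂ)) 0 0 1 r := by
  have h := (coordCLM 2).hasFDerivAt (x := r)
  have e : coordCLM 2 = ladderForm 0 0 1 := by ext v; simp [ladderForm_apply]
  rw [e] at h
  refine h.congr_of_eventuallyEq (Eventually.of_forall fun x => ?_)
  rw [← e]
  simp

theorem planar_mul_conj (r : E3) :
    planar r * conj (planar r) + (r 2 : ℂ) ^ 2 = ((‖r‖ ^ 2 : ℝ) : ℂ) := by
  rw [EuclideanSpace.norm_sq_eq, Fin.sum_univ_three, planar]
  simp only [map_add, map_mul, Complex.conj_ofReal, Complex.conj_I, Real.norm_eq_abs, sq_abs]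
  push_cast
  linear_combination - (r 1 : ℂ) ^ 2 * Complex.I_sq

theorem norm_planar_le (r : E3) : ‖planar r‖ ≤ ‖r‖ := by
  have h := planar_mul_conj r
  rw [Complex.mul_conj] at h
  have h' : Complex.normSq (planar r) + (r 2) ^ 2 = ‖r‖ ^ 2 := by exact_mod_cast h
  rw [Complex.normSq_eq_norm_sq] at h'
  exact abs_le_of_sq_le_sq' (by nlinarith [sq_nonneg (r 2)]) (norm_nonneg _) |>.2

theorem norm_coord_le (r : E3) (i : Fin 3) : ‖(r i : ℂ)‖ ≤ ‖r‖ := by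
  rw [Complex.norm_real]
  exact PiLp.norm_apply_le r i

/-! ### Solid harmonics and scalar waves -/

/-- The (unnormalized) solid harmonic of degree `n` and order `m`. -/
def solid (n : ℕ) (m : ℤ) (r : E3) : ℂ := nullCoeff (planar r) (conj (planar r)) (r 2) n m

theorem solid_succ (n : ℕ) (m : ℤ) (r : E3) : solid (n + 1) m r = r 2 * solid n m r +
    (planar r * solid n (m - 1) r - conj (planar r) * solid n (m + 1) r) / 2 := rfl

theorem solid_eq_zero {n : ℕ} {m : ℤ} (h : (n : ℤ) < |m|) (r : E3) : solid n m r = 0 :=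
  nullCoeff_eq_zero _ _ _ _ _ h

/-- At a point of space `w v + z²` is the squared radius, so the algebraic relation becomes the
splitting of coordinate times harmonic into a harmonic of degree `n + 1` and `r²` times one of
degree `n - 1`. -/
theorem planar_mul_solid (n : ℕ) (m : ℤ) (r : E3) :
    planar r * solid n m r = (n + m + 2) * (n + m + 1) / ((n + 1) * (2 * n + 1)) *
      solid (n + 1) (m + 1) r - n / (2 * n + 1) * ((‖r‖ ^ 2 : ℝ) * solid (n - 1) (m + 1) r) := by
  have h := fst_mul_nullCoeff' (planar r) (conj (planar r)) (r 2) n m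
  rw [planar_mul_conj] at h
  have h1 : (n + 1 : ℂ) ≠ 0 := by exact_mod_cast n.succ_ne_zero
  have h2 : (n * 2 + 1 : ℂ) ≠ 0 := by exact_mod_cast (n * 2).succ_ne_zero
  simp only [solid]
  field_simp
  linear_combination h

theorem conj_planar_mul_solid (n : ℕ) (m : ℤ) (r : E3) :
    conj (planar r) * solid n m r = n / (2 * n + 1) * ((‖r‖ ^ 2 : ℝ) * solid (n - 1) (m - 1) r) -
      (n - m + 2) * (n - m + 1) / ((n + 1) * (2 * n + 1)) * solid (n + 1) (m - 1) r := by
  have h := snd_mul_nullCoeff' (planar r) (conj (planar r)) (r 2) n m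
  rw [planar_mul_conj] at h
  have h1 : (n + 1 : ℂ) ≠ 0 := by exact_mod_cast n.succ_ne_zero
  have h2 : (n * 2 + 1 : ℂ) ≠ 0 := by exact_mod_cast (n * 2).succ_ne_zero
  simp only [solid]
  field_simp
  linear_combination h

theorem coord_two_mul_solid (n : ℕ) (m : ℤ) (r : E3) :
    r 2 * solid n m r = n / (2 * n + 1) * ((‖r‖ ^ 2 : ℝ) * solid (n - 1) m r) +
      ((n + 1) ^ 2 - m ^ 2) / ((n + 1) * (2 * n + 1)) * solid (n + 1) m r := by
  have h := thd_mul_nullCoeff (planar r) (conj (planar r)) (r 2) n m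
  rw [planar_mul_conj] at h
  have h1 : (n + 1 : ℂ) ≠ 0 := by exact_mod_cast n.succ_ne_zero
  have h2 : (n * 2 + 1 : ℂ) ≠ 0 := by exact_mod_cast (n * 2).succ_ne_zero
  simp only [solid]
  field_simp
  linear_combination h

/-- The generating form is linear in the point. Differentiating its `n`-th power brings down `n`
times the power `n - 1` times the derivative of the form, which is `-1/t`, `t` or `1` for the three
operators; hence the shifts of order by one. -/
theorem hasLadder_solid (n : ℕ) (r : E3) : ∀ m : ℤ, HasLadder (solid n m)
    (-n * solid (n - 1) (m + 1) r) (n * solid (n - 1) (m - 1) r) (n * solid (n - 1) m r) r := by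
  induction n with
  | zero =>
    intro m
    exact (HasLadder.const (if m = 0 then 1 else 0)).congr_form (by simp) (by simp) (by simp)
  | succ n ih =>
    intro m
    have h := ((hasLadder_coord_two r).mul (ih m)).add
      ((((hasLadder_planar r).mul (ih (m - 1))).sub
        ((hasLadder_conj_planar r).mul (ih (m + 1)))).const_mul (1 / 2))
    have e : (solid (n + 1) m) = fun x => (x 2 : ℂ) * solid n m x + 1 / 2 *
        (planar x * solid n (m - 1) x - conj (planar x) * solid n (m + 1) x) := by
      funext x; rw [solid_succ]; ring
    rw [e]
    have e1 : m - 1 + 1 = m := by ring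
    have e2 : m + 1 - 1 = m := by ring
    rw [e1, e2] at h
    rw [Nat.add_sub_cancel]
    have hs : ∀ l : ℤ, (n : ℂ) * solid n l r = n * (r 2 * solid (n - 1) l r +
        (planar r * solid (n - 1) (l - 1) r - conj (planar r) * solid (n - 1) (l + 1) r) / 2) := by
      intro l
      cases n with
      | zero => simp
      | succ n => rw [Nat.add_sub_cancel, ← solid_succ]
    have h0 := hs m
    have h1 := hs (m + 1)
    have h2 := hs (m - 1)
    rw [e1] at h2
    rw [e2] at h1
    refine h.congr_form ?_ ?_ ?_ <;> push_cast
    · linear_combination h1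
    · linear_combination -h2
    · linear_combination -h0

theorem hasLadder_besselEntire (k : ℝ) (n : ℕ) (r : E3) :
    HasLadder (fun x => (besselEntire n (k ^ 2 * ‖x‖ ^ 2) : ℂ))
      (-k ^ 2 * besselEntire (n + 1) (k ^ 2 * ‖r‖ ^ 2) * planar r)
      (-k ^ 2 * besselEntire (n + 1) (k ^ 2 * ‖r‖ ^ 2) * conj (planar r))
      (-k ^ 2 * besselEntire (n + 1) (k ^ 2 * ‖r‖ ^ 2) * r 2) r := by
  have h1 := ((hasStrictFDerivAt_norm_sq r).hasFDerivAt.const_mul (k ^ 2))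
  have h2 := (hasDerivAt_besselEntire (n := n) (by omega) (k ^ 2 * ‖r‖ ^ 2)).comp_hasFDerivAt r h1
  have h3 := Complex.ofRealCLM.hasFDerivAt.comp r h2
  refine HasFDerivAt.congr_fderiv h3 ?_
  ext v
  rw [ladderForm_apply']
  simp [PiLp.inner_apply, Fin.sum_univ_three, planar]
  linear_combination -(k : ℂ) ^ 2 * besselEntire (n + 1) (k ^ 2 * ‖r‖ ^ 2) * r 1 * v 1 *
    Complex.I_sq

/-- The scalar wave `k ^ n D_n((k r) ^ 2)` times the solid harmonic of degree `n` and order `m`. -/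
def wave (k : ℝ) (n : ℕ) (m : ℤ) (r : E3) : ℂ :=
  k ^ n * (besselEntire n (k ^ 2 * ‖r‖ ^ 2) * solid n m r)

theorem wave_eq_zero {n : ℕ} {m : ℤ} (h : (n : ℤ) < |m|) (k : ℝ) (r : E3) : wave k n m r = 0 := by
  rw [wave, solid_eq_zero h]; ring

theorem hasLadder_wave_aux (k : ℝ) (n : ℕ) (m : ℤ) (r : E3) : HasLadder (wave k n m)
    (k ^ n * (besselEntire n (k ^ 2 * ‖r‖ ^ 2) * (-n * solid (n - 1) (m + 1) r) +
      -k ^ 2 * besselEntire (n + 1) (k ^ 2 * ‖r‖ ^ 2) * planar r * solid n m r))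
    (k ^ n * (besselEntire n (k ^ 2 * ‖r‖ ^ 2) * (n * solid (n - 1) (m - 1) r) +
      -k ^ 2 * besselEntire (n + 1) (k ^ 2 * ‖r‖ ^ 2) * conj (planar r) * solid n m r))
    (k ^ n * (besselEntire n (k ^ 2 * ‖r‖ ^ 2) * (n * solid (n - 1) m r) +
      -k ^ 2 * besselEntire (n + 1) (k ^ 2 * ‖r‖ ^ 2) * r 2 * solid n m r)) r :=
  ((hasLadder_besselEntire k n r).mul (hasLadder_solid n r m)).const_mul _

/-- The Bessel recurrence multiplied by `n`, so that it also holds for `n = 0`, where `n - 1`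
truncates. -/
theorem pow_mul_besselEntire_recurrence (k : ℝ) (n : ℕ) (s : ℝ) :
    (n : ℂ) * (k ^ n * ((2 * n + 1) * besselEntire n (k ^ 2 * s)
      - k ^ 2 * s * besselEntire (n + 1) (k ^ 2 * s))) =
    n * (k * (k ^ (n - 1) * besselEntire (n - 1 : ℕ) (k ^ 2 * s))) := by
  cases n with
  | zero => simp
  | succ n =>
    have h := besselEntire_recurrence (n + 1) (k ^ 2 * s)
    rw [Nat.add_sub_cancel]
    push_cast at h ⊢
    rw [add_sub_cancel_right] at h
    rw [h]
    push_cast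
    ring

/-- Differentiating the Bessel factor produces coordinate times solid harmonic, which splits into
the degrees `n ± 1`. The two contributions to degree `n - 1` merge through the Bessel recurrence
into a single scalar wave. -/
theorem hasLadder_wave (k : ℝ) (n : ℕ) (m : ℤ) (r : E3) : HasLadder (wave k n m)
    (k * (-(n / (2 * n + 1)) * wave k (n - 1) (m + 1) r -
      (n + m + 2) * (n + m + 1) / ((n + 1) * (2 * n + 1)) * wave k (n + 1) (m + 1) r))
    (k * (n / (2 * n + 1) * wave k (n - 1) (m - 1) r +
      (n - m + 2) * (n - m + 1) / ((n + 1) * (2 * n + 1)) * wave k (n + 1) (m - 1) r))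
    (k * (n / (2 * n + 1) * wave k (n - 1) m r -
      ((n + 1) ^ 2 - m ^ 2) / ((n + 1) * (2 * n + 1)) * wave k (n + 1) m r)) r := by
  have h1 : (n + 1 : ℂ) ≠ 0 := by exact_mod_cast n.succ_ne_zero
  have h2 : (n * 2 + 1 : ℂ) ≠ 0 := by exact_mod_cast (n * 2).succ_ne_zero
  have hr := pow_mul_besselEntire_recurrence k n (‖r‖ ^ 2)
  have hp := planar_mul_solid n m r
  have hq := conj_planar_mul_solid n m r
  have hs := coord_two_mul_solid n m r
  refine (hasLadder_wave_aux k n m r).congr_form ?_ ?_ ?_ <;> simp only [wave, Nat.cast_add, Nat.cast_one]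
  · rw [mul_assoc _ (planar r), hp]
    push_cast at hr ⊢
    field_simp at hr ⊢
    linear_combination -(n + 1) * solid (n - 1) (m + 1) r * hr
  · rw [mul_assoc _ (conj (planar r)), hq]
    push_cast at hr ⊢
    field_simp at hr ⊢
    linear_combination (n + 1) * solid (n - 1) (m - 1) r * hr
  · rw [mul_assoc _ (r 2 : ℂ), hs]
    push_cast at hr ⊢
    field_simp at hr ⊢
    linear_combination (n + 1) * solid (n - 1) m r * hr

/-! ### Vector waves and their derivatives -/

/-- The Cartesian components of the vector with `x + i y`, `x - i y`, `z` components `P`, `M`,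
`Z`. -/
def cartesian (P M Z : ℂ) : Fin 3 → ℂ := ![(P + M) / 2, (P - M) / (2 * Complex.I), Z]

/-- The transverse electric field of degree `n` and order `m`: `-i` times the curl of `r` times
the scalar wave. -/
def te (k : ℝ) (n : ℕ) (m : ℤ) (i : Fin 3) (r : E3) : ℂ :=
  cartesian ((n + m + 1) * wave k n (m + 1) r) ((n - m + 1) * wave k n (m - 1) r)
    (-m * wave k n m r) i

/-- The `x + i y` component of `tm`. -/
def tmPlus (k : ℝ) (n : ℕ) (m : ℤ) (r : E3) : ℂ :=
  n / (2 * n + 1) * (-(n + 1) * wave k (n - 1) (m + 1) r +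
    (n + m + 1) * (n + m + 2) / (n + 1) * wave k (n + 1) (m + 1) r)

/-- The `x - i y` component of `tm`. -/
def tmMinus (k : ℝ) (n : ℕ) (m : ℤ) (r : E3) : ℂ :=
  n / (2 * n + 1) * ((n + 1) * wave k (n - 1) (m - 1) r -
    (n - m + 1) * (n - m + 2) / (n + 1) * wave k (n + 1) (m - 1) r)

/-- The `z` component of `tm`. -/
def tmAxial (k : ℝ) (n : ℕ) (m : ℤ) (r : E3) : ℂ :=
  n / (2 * n + 1) * ((n + 1) * wave k (n - 1) m r +
    (n - m + 1) * (n + m + 1) / (n + 1) * wave k (n + 1) m r)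

/-- The transverse magnetic field of degree `n` and order `m`. -/
def tm (k : ℝ) (n : ℕ) (m : ℤ) (i : Fin 3) (r : E3) : ℂ :=
  cartesian (tmPlus k n m r) (tmMinus k n m r) (tmAxial k n m r) i

/-- The coefficient with which derivatives lower the degree of a vector wave. -/
def lowCoeff (n : ℕ) : ℝ := (n + 1) / (2 * n + 1)

/-- The coefficient with which `∂z` raises the degree of a vector wave. -/
def raiseAxial (n : ℕ) (m : ℤ) : ℝ :=
  n * ((n + 1) ^ 2 - m ^ 2) / ((n + 1) ^ 2 * (2 * n + 1))

/-- The coefficient with which `∂x + i ∂y` raises the degree of a vector wave. -/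
def raisePlus (n : ℕ) (m : ℤ) : ℝ :=
  n * ((n + m + 1) * (n + m + 2)) / ((n + 1) ^ 2 * (2 * n + 1))

/-- The coefficient with which `∂x - i ∂y` raises the degree of a vector wave. -/
def raiseMinus (n : ℕ) (m : ℤ) : ℝ :=
  n * ((n - m + 1) * (n - m + 2)) / ((n + 1) ^ 2 * (2 * n + 1))

/-- The coefficient with which `∂z` turns a TE wave into a TM wave. -/
def mixAxial (n : ℕ) (m : ℤ) : ℝ := m / (n * (n + 1))

/-- The coefficient with which `∂x + i ∂y` turns a TE wave into a TM wave. -/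
def mixPlus (n : ℕ) (m : ℤ) : ℝ := (n + m + 1) / (n * (n + 1))

/-- The coefficient with which `∂x - i ∂y` turns a TE wave into a TM wave. -/
def mixMinus (n : ℕ) (m : ℤ) : ℝ := (n - m + 1) / (n * (n + 1))

theorem hasLadder_cartesian {fP fM fZ : E3 → ℂ} {aP bP cP aM bM cM aZ bZ cZ : ℂ} {r : E3}
    (hP : HasLadder fP aP bP cP r) (hM : HasLadder fM aM bM cM r) (hZ : HasLadder fZ aZ bZ cZ r)
    (i : Fin 3) : HasLadder (fun x => cartesian (fP x) (fM x) (fZ x) i)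
      (cartesian aP aM aZ i) (cartesian bP bM bZ i) (cartesian cP cM cZ i) r := by
  fin_cases i
  · have h := (hP.add hM).const_mul (1 / 2)
    convert h using 2 <;> simp [cartesian] <;> ring
  · have h := (hP.sub hM).const_mul (-(Complex.I / 2))
    convert h using 2 <;> simp only [cartesian, div_eq_mul_inv, mul_inv, Complex.inv_I] <;>
      simp <;> ring
  · simpa [cartesian] using hZ

theorem cartesian_combination (a b c P M Z P' M' Z' P'' M'' Z'' : ℂ) (i : Fin 3) :
    a * cartesian P M Z i + b * cartesian P' M' Z' i + c * cartesian P'' M'' Z'' i =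
      cartesian (a * P + b * P' + c * P'') (a * M + b * M' + c * M'')
        (a * Z + b * Z' + c * Z'') i := by
  fin_cases i <;> simp [cartesian] <;> ring

section ladder
variable (k : ℝ) (n : ℕ) (m : ℤ) (r : E3)

theorem hasLadder_te (i : Fin 3) : HasLadder (te k (n + 1) m i)
    (-(k * lowCoeff (n + 1)) * te k n (m + 1) i r
      + -(k * raisePlus (n + 1) m) * te k (n + 2) (m + 1) i r
      + -(k * mixPlus (n + 1) m) * tm k (n + 1) (m + 1) i r)
    ((k * lowCoeff (n + 1)) * te k n (m - 1) i r
      + (k * raiseMinus (n + 1) m) * te k (n + 2) (m - 1) i r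
      + -(k * mixMinus (n + 1) m) * tm k (n + 1) (m - 1) i r)
    ((k * lowCoeff (n + 1)) * te k n m i r
      + -(k * raiseAxial (n + 1) m) * te k (n + 2) m i r
      + (k * mixAxial (n + 1) m) * tm k (n + 1) m i r) r := by
  have e1 : m - 1 + 1 = m := by ring
  have e2 : m + 1 - 1 = m := by ring
  have hP := (hasLadder_wave k (n + 1) (m + 1) r).const_mul ((n + 1 : ℕ) + m + 1)
  have hM := (hasLadder_wave k (n + 1) (m - 1) r).const_mul ((n + 1 : ℕ) - m + 1)
  have hZ := (hasLadder_wave k (n + 1) m r).const_mul (-m)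
  have h1 : (n + 1 : ℂ) ≠ 0 := by exact_mod_cast n.succ_ne_zero
  have h2 : (n + 1 + 1 : ℂ) ≠ 0 := by exact_mod_cast (n + 1).succ_ne_zero
  have h3 : ((n + 1) * 2 + 1 : ℂ) ≠ 0 := by exact_mod_cast ((n + 1) * 2).succ_ne_zero
  refine (hasLadder_cartesian hP hM hZ i).congr_form ?_ ?_ ?_ <;>
    simp only [te, tm, cartesian_combination, tmPlus, tmMinus, tmAxial, lowCoeff, raisePlus,
      raiseMinus, raiseAxial, mixPlus, mixMinus, mixAxial, e1, e2, Nat.add_sub_cancel,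
      show n + 1 + 1 = n + 2 from rfl] <;>
    congr 1 <;> push_cast <;> field_simp <;> ring

/-- The coefficients are those of the TE case except that the polarization-changing ones have the
opposite sign. This sign makes the mixed terms of the kernel cancel. -/
theorem hasLadder_tm (i : Fin 3) : HasLadder (tm k (n + 1) m i)
    (-(k * lowCoeff (n + 1)) * tm k n (m + 1) i r
      + -(k * raisePlus (n + 1) m) * tm k (n + 2) (m + 1) i r
      + (k * mixPlus (n + 1) m) * te k (n + 1) (m + 1) i r)
    ((k * lowCoeff (n + 1)) * tm k n (m - 1) i r
      + (k * raiseMinus (n + 1) m) * tm k (n + 2) (m - 1) i r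
      + (k * mixMinus (n + 1) m) * te k (n + 1) (m - 1) i r)
    ((k * lowCoeff (n + 1)) * tm k n m i r
      + -(k * raiseAxial (n + 1) m) * tm k (n + 2) m i r
      + -(k * mixAxial (n + 1) m) * te k (n + 1) m i r) r := by
  have e1 : m - 1 + 1 = m := by ring
  have e2 : m + 1 - 1 = m := by ring
  have hP := (((hasLadder_wave k n (m + 1) r).const_mul (-(n + 2))).add
    ((hasLadder_wave k (n + 2) (m + 1) r).const_mul ((n + 1 + m + 1) * (n + 1 + m + 2) / (n + 2)))).const_mul
      ((n + 1) / (2 * n + 3))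
  have hM := (((hasLadder_wave k n (m - 1) r).const_mul (n + 2)).sub
    ((hasLadder_wave k (n + 2) (m - 1) r).const_mul ((n + 1 - m + 1) * (n + 1 - m + 2) / (n + 2)))).const_mul
      ((n + 1) / (2 * n + 3))
  have hZ := (((hasLadder_wave k n m r).const_mul (n + 2)).add
    ((hasLadder_wave k (n + 2) m r).const_mul ((n + 1 - m + 1) * (n + 1 + m + 1) / (n + 2)))).const_mul
      ((n + 1) / (2 * n + 3))
  have h1 : (n + 1 : ℂ) ≠ 0 := by exact_mod_cast n.succ_ne_zero
  have h2 : (n + 2 : ℂ) ≠ 0 := by exact_mod_cast (n + 1).succ_ne_zero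
  have h2' : (n + 3 : ℂ) ≠ 0 := by exact_mod_cast (n + 2).succ_ne_zero
  have h3 : (n * 2 + 1 : ℂ) ≠ 0 := by exact_mod_cast (n * 2).succ_ne_zero
  have h4 : (n * 2 + 3 : ℂ) ≠ 0 := by exact_mod_cast (n * 2 + 2).succ_ne_zero
  have h5 : (n * 2 + 5 : ℂ) ≠ 0 := by exact_mod_cast (n * 2 + 4).succ_ne_zero
  have c1 : (2 * (n + 1) + 1 : ℂ) = 2 * n + 3 := by ring
  have c2 : (n + 1 + 1 : ℂ) = n + 2 := by ring
  have c3 : (2 * (n + 2) + 1 : ℂ) = 2 * n + 5 := by ring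
  have c4 : (n + 2 + 1 : ℂ) = n + 3 := by ring
  have key := hasLadder_cartesian hP hM hZ i
  have e : tm k (n + 1) m i = fun x => cartesian
      ((n + 1) / (2 * n + 3) * (-(n + 2) * wave k n (m + 1) x +
        (n + 1 + m + 1) * (n + 1 + m + 2) / (n + 2) * wave k (n + 2) (m + 1) x))
      ((n + 1) / (2 * n + 3) * ((n + 2) * wave k n (m - 1) x -
        (n + 1 - m + 1) * (n + 1 - m + 2) / (n + 2) * wave k (n + 2) (m - 1) x))
      ((n + 1) / (2 * n + 3) * ((n + 2) * wave k n m x +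
        (n + 1 - m + 1) * (n + 1 + m + 1) / (n + 2) * wave k (n + 2) m x)) i := by
    funext x
    simp only [tm, tmPlus, tmMinus, tmAxial, Nat.add_sub_cancel, Nat.cast_add, Nat.cast_one, c1, c2,
      show n + 1 + 1 = n + 2 from rfl]
  rw [e]
  refine key.congr_form ?_ ?_ ?_ <;>
    simp only [te, tm, cartesian_combination, tmPlus, tmMinus, tmAxial, lowCoeff, raisePlus,
      raiseMinus, raiseAxial, mixPlus, mixMinus, mixAxial, e1, e2, show n + 2 - 1 = n + 1 from rfl,
      show n + 2 + 1 = n + 3 from rfl] <;>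
    congr 1 <;> push_cast <;> simp only [c1, c2, c3, c4] <;> field_simp <;> ring

end ladder

/-- Just outside the range of orders one neighbouring scalar wave may be non-zero, but then its
numerical coefficient vanishes. -/
theorem te_eq_zero {n : ℕ} {m : ℤ} (h : (n : ℤ) < |m|) (k : ℝ) (i : Fin 3) (r : E3) :
    te k n m i r = 0 := by
  have hZ : wave k n m r = 0 := wave_eq_zero h k r
  have hP : ((n : ℂ) + m + 1) * wave k n (m + 1) r = 0 := by
    rcases eq_or_ne ((n : ℤ) + m + 1) 0 with h0 | h0
    · have : ((n : ℂ) + m + 1) = 0 := by exact_mod_cast h0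
      rw [this, zero_mul]
    · rw [wave_eq_zero _ k r, mul_zero]
      rcases lt_abs.1 h with h | h <;> rw [lt_abs] <;> omega
  have hM : ((n : ℂ) - m + 1) * wave k n (m - 1) r = 0 := by
    rcases eq_or_ne ((n : ℤ) - m + 1) 0 with h0 | h0
    · have : ((n : ℂ) - m + 1) = 0 := by exact_mod_cast h0
      rw [this, zero_mul]
    · rw [wave_eq_zero _ k r, mul_zero]
      rcases lt_abs.1 h with h | h <;> rw [lt_abs] <;> omega
  rw [te, hZ, hP, hM]
  fin_cases i <;> simp [cartesian]

theorem tm_eq_zero {n : ℕ} {m : ℤ} (h : (n : ℤ) < |m|) (k : ℝ) (i : Fin 3) (r : E3) :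
    tm k n m i r = 0 := by
  have a1 : wave k (n - 1) m r = 0 := wave_eq_zero (by omega) k r
  have a2 : wave k (n - 1) (m + 1) r = 0 ∨ n = 0 := by
    rcases Nat.eq_zero_or_pos n with h0 | h0
    · exact Or.inr h0
    · refine Or.inl (wave_eq_zero ?_ k r)
      rcases lt_abs.1 h with h | h <;> rw [lt_abs] <;> omega
  have a3 : wave k (n - 1) (m - 1) r = 0 ∨ n = 0 := by
    rcases Nat.eq_zero_or_pos n with h0 | h0
    · exact Or.inr h0
    · refine Or.inl (wave_eq_zero ?_ k r)
      rcases lt_abs.1 h with h | h <;> rw [lt_abs] <;> omega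
  have b1 : ((n : ℂ) - m + 1) * (n + m + 1) * wave k (n + 1) m r = 0 := by
    rcases eq_or_ne (((n : ℤ) - m + 1) * (n + m + 1)) 0 with h0 | h0
    · have : ((n : ℂ) - m + 1) * (n + m + 1) = 0 := by exact_mod_cast h0
      rw [this, zero_mul]
    · rw [wave_eq_zero _ k r, mul_zero]
      have h1 := left_ne_zero_of_mul h0
      have h2 := right_ne_zero_of_mul h0
      rcases lt_abs.1 h with h | h <;> rw [lt_abs] <;> omega
  have b2 : ((n : ℂ) + m + 1) * (n + m + 2) * wave k (n + 1) (m + 1) r = 0 := by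
    rcases eq_or_ne (((n : ℤ) + m + 1) * (n + m + 2)) 0 with h0 | h0
    · have : ((n : ℂ) + m + 1) * (n + m + 2) = 0 := by exact_mod_cast h0
      rw [this, zero_mul]
    · rw [wave_eq_zero _ k r, mul_zero]
      have h1 := left_ne_zero_of_mul h0
      have h2 := right_ne_zero_of_mul h0
      rcases lt_abs.1 h with h | h <;> rw [lt_abs] <;> omega
  have b3 : ((n : ℂ) - m + 1) * (n - m + 2) * wave k (n + 1) (m - 1) r = 0 := by
    rcases eq_or_ne (((n : ℤ) - m + 1) * (n - m + 2)) 0 with h0 | h0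
    · have : ((n : ℂ) - m + 1) * (n - m + 2) = 0 := by exact_mod_cast h0
      rw [this, zero_mul]
    · rw [wave_eq_zero _ k r, mul_zero]
      have h1 := left_ne_zero_of_mul h0
      have h2 := right_ne_zero_of_mul h0
      rcases lt_abs.1 h with h | h <;> rw [lt_abs] <;> omega
  have hZ : tmAxial k n m r = 0 := by
    rw [tmAxial, a1, div_mul_eq_mul_div ((n - m + 1 : ℂ) * _), b1]; simp
  have hP : tmPlus k n m r = 0 := by
    rw [tmPlus, div_mul_eq_mul_div ((n + m + 1 : ℂ) * _), b2]
    rcases a2 with h | h <;> simp [h]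
  have hM : tmMinus k n m r = 0 := by
    rw [tmMinus, div_mul_eq_mul_div ((n - m + 1 : ℂ) * _), b3]
    rcases a3 with h | h <;> simp [h]
  rw [tm, hZ, hP, hM]
  fin_cases i <;> simp [cartesian]

/-! ### Identification with the spherical vector-wave modes -/

theorem taylor_coeff_rodrigues (n j : ℕ) (z : ℝ) :
    ((((Polynomial.X + Polynomial.C (z : ℂ)) ^ 2 - 1) ^ n).coeff j : ℂ) =
      (((Polynomial.derivative^[j] ((Polynomial.X ^ 2 - 1 : Polynomial ℝ) ^ n)).eval z /
        j.factorial : ℝ) : ℂ) := by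
  have h1 : (((Polynomial.X + Polynomial.C (z : ℂ)) ^ 2 - 1) ^ n) =
      ((Polynomial.taylor z ((Polynomial.X ^ 2 - 1 : Polynomial ℝ) ^ n)).map
        (algebraMap ℝ ℂ)) := by
    simp [Polynomial.taylor_apply]
  have h2 := congrFun (Polynomial.factorial_smul_hasseDeriv (R := ℝ) (k := j))
    ((Polynomial.X ^ 2 - 1 : Polynomial ℝ) ^ n)
  rw [h1, Polynomial.coeff_map, Polynomial.taylor_coeff, ← h2]
  rw [LinearMap.smul_apply, Polynomial.eval_smul, nsmul_eq_mul, Complex.coe_algebraMap]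
  congr 1
  have : (j.factorial : ℝ) ≠ 0 := by positivity
  field_simp

/-- The coefficient of `t^j` comes from the Taylor coefficient of index `n + j`, that is, from the
derivative of order `n + j` in Rodrigues' formula. -/
theorem nullCoeff_eq_legendreDeriv (w : ℂ) (z : ℝ) (h : w * conj w = 1 - (z : ℂ) ^ 2) (n j : ℕ) :
    nullCoeff w (conj w) z n j =
      w ^ j * ((n.factorial / (n + j).factorial * legendreDeriv n j z : ℝ) : ℂ) := by
  have hn : (n.factorial : ℂ) ≠ 0 := by exact_mod_cast n.factorial_ne_zero
  have hnj : ((n + j).factorial : ℂ) ≠ 0 := by exact_mod_cast (n + j).factorial_ne_zero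
  have key : (((Polynomial.X + Polynomial.C (z : ℂ)) ^ 2 - 1) ^ n).coeff (n + j) / 2 ^ n =
      ((n.factorial / (n + j).factorial * legendreDeriv n j z : ℝ) : ℂ) := by
    rw [taylor_coeff_rodrigues, legendreDeriv]
    push_cast
    field_simp
  rw [← key]
  -- On the polar axis `u = w t` is no substitution. There `z² = 1`, the polynomial is `(X + 2z)^n
  -- X^n`, and its coefficients are read off directly.
  by_cases hw : w = 0
  · subst hw
    rw [map_zero, nullCoeff_eq_of_fst_eq_zero]
    rw [zero_mul] at h
    have hQ : (((Polynomial.X + Polynomial.C (z : ℂ)) ^ 2 - 1) ^ n) =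
        (Polynomial.X + Polynomial.C (2 * (z : ℂ))) ^ n * Polynomial.X ^ n := by
      have hC : Polynomial.C (1 - (z : ℂ) ^ 2) = 0 := by rw [← h, map_zero]
      simp only [map_sub, map_pow, map_one] at hC
      rw [← mul_pow]
      congr 1
      simp only [map_mul, map_ofNat]
      linear_combination -hC
    rw [hQ]
    by_cases hj : j = 0
    · subst hj
      have := Polynomial.coeff_mul_X_pow ((Polynomial.X + Polynomial.C (2 * (z : ℂ))) ^ n) n 0
      rw [zero_add] at this
      rw [add_zero, this, Polynomial.coeff_zero_eq_eval_zero]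
      simp [mul_pow]
    · simp [hj]
  · have := nullCoeff_eq_coeff w (conj w) z hw h n (n + j)
    rw [Nat.cast_add, add_sub_cancel_left, zpow_natCast] at this
    exact this

theorem exists_radialWave_eq (k : ℝ) {n : ℕ} (hn : 1 ≤ n) (m : ℤ) :
    ∃ K : ℂ, K ≠ 0 ∧ ∀ r : E3, (sphBessel n (k * ‖r‖) : ℂ) *
      sphHarmonic n m (polarAngle r) (azimuth r) = K * wave k n m r := by
  set M := m.natAbs with hM
  set A : ℝ := Real.sqrt ((2 * n + 1) / (4 * Real.pi) *
      (((n - M).factorial : ℝ) / ((n + M).factorial : ℝ))) with hA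
  have hA0 : (A : ℂ) ≠ 0 := by
    have : 0 < A := by rw [hA]; positivity
    exact_mod_cast this.ne'
  have hf : (n.factorial : ℂ) ≠ 0 := by exact_mod_cast n.factorial_ne_zero
  have hf' : ((n + M).factorial : ℂ) ≠ 0 := by exact_mod_cast (n + M).factorial_ne_zero
  -- The constant collects the phase `(-1)^M`, the normalization of the harmonic and the factorial
  -- ratio from Rodrigues' formula. It serves both signs of `m`, because for `m < 0` the sign in the
  -- harmonic matches the one from exchanging `w` and `v`.
  refine ⟨(-1) ^ M * A * ((n + M).factorial / n.factorial), by simp [hA0, hf, hf'], fun r => ?_⟩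
  rw [sphBessel_natCast]
  -- At the origin the angles are default values, but both sides vanish because `n ≥ 1`.
  by_cases hr : r = 0
  · subst hr
    have : wave k n m 0 = 0 := by
      rw [wave, solid]
      have e : planar 0 = 0 := by simp [planar]
      rw [e, map_zero]
      simp only [PiLp.zero_apply, Complex.ofReal_zero]
      rw [nullCoeff_eq_of_fst_eq_zero]
      simp [show n ≠ 0 by omega]
    rw [this]
    simp [show n ≠ 0 by omega]
  have hr' : (‖r‖ : ℝ) ≠ 0 := norm_ne_zero_iff.2 hr
  have hrc : (‖r‖ : ℂ) ≠ 0 := by exact_mod_cast hr'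
  set ρ := ‖r‖ with hρ
  set z : ℝ := r 2 / ρ with hz
  set w : ℂ := planar r / ρ with hw
  have hww : w * conj w = 1 - (z : ℂ) ^ 2 := by
    have h := planar_mul_conj r
    rw [hw, hz, map_div₀, Complex.conj_ofReal]
    push_cast at h ⊢
    field_simp
    linear_combination h
  have hcos : Real.cos (polarAngle r) = z := by
    have h1 : |z| ≤ 1 := by
      rw [hz, abs_div, abs_of_nonneg (norm_nonneg r), div_le_one (by positivity)]
      exact PiLp.norm_apply_le r 2
    rw [abs_le] at h1
    exact Real.cos_arccos h1.1 h1.2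
  have hsin : Real.sqrt (1 - z ^ 2) = ‖w‖ := by
    rw [Complex.mul_conj, Complex.normSq_eq_norm_sq] at hww
    have : ‖w‖ ^ 2 = 1 - z ^ 2 := by exact_mod_cast hww
    rw [← this, Real.sqrt_sq (norm_nonneg _)]
  have harg : (‖w‖ : ℂ) * Complex.exp (Complex.I * azimuth r) = w := by
    have h1 : azimuth r = Complex.arg (planar r) := by
      rw [azimuth]
      congr 1
      apply Complex.ext <;> simp [planar]
    have h2 := Complex.norm_mul_exp_arg_mul_I (planar r)
    rw [h1, mul_comm Complex.I, hw, norm_div, Complex.norm_real, Real.norm_eq_abs,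
      abs_of_nonneg (norm_nonneg r)]
    push_cast
    rw [div_mul_eq_mul_div, h2]
  have hsolid : solid n m r = ρ ^ n * nullCoeff w (conj w) z n m := by
    rw [← nullCoeff_smul, solid]
    congr 1
    · rw [hw]; field_simp
    · rw [hw, map_div₀, Complex.conj_ofReal]; field_simp
    · rw [hz]; push_cast; field_simp
  rw [wave, hsolid, sphHarmonic, assocLegendre, hcos, hsin, ← hM, ← hA, ← hρ]
  by_cases hm : m < 0
  · have hmM : m = -(M : ℤ) := by omega
    have hexp : Complex.exp (Complex.I * m * azimuth r) =
        conj (Complex.exp (Complex.I * azimuth r)) ^ M := by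
      rw [← Complex.exp_conj, ← Complex.exp_nat_mul, hmM]
      congr 1
      simp
      ring
    have hpow : (‖w‖ : ℂ) ^ M * conj (Complex.exp (Complex.I * azimuth r)) ^ M = conj w ^ M := by
      rw [← mul_pow]
      congr 1
      conv_rhs => rw [← harg]
      simp
    have hww' : conj w * conj (conj w) = 1 - (z : ℂ) ^ 2 := by rw [Complex.conj_conj, mul_comm, hww]
    have hnull := nullCoeff_eq_legendreDeriv (conj w) z hww' n M
    rw [Complex.conj_conj] at hnull
    have hsq : ((-1 : ℂ) ^ M) * (-1) ^ M = 1 := by rw [← mul_pow]; simp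
    rw [hexp, if_pos hm, hmM, nullCoeff_neg, hnull, zpow_natCast]
    push_cast
    rw [mul_pow (k : ℂ)]
    field_simp
    rw [← hpow]
    ring
  · have hmM : m = (M : ℤ) := by omega
    have hexp : Complex.exp (Complex.I * m * azimuth r) =
        (Complex.exp (Complex.I * azimuth r)) ^ M := by
      rw [← Complex.exp_nat_mul, hmM]
      congr 1
      push_cast
      ring
    have hpow : (‖w‖ : ℂ) ^ M * (Complex.exp (Complex.I * azimuth r)) ^ M = w ^ M := by
      rw [← mul_pow, harg]
    have hnull := nullCoeff_eq_legendreDeriv w z hww n M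
    rw [hexp, if_neg hm, hmM, hnull, ← hpow]
    push_cast
    rw [mul_pow (k : ℂ)]
    field_simp

theorem mul_planar_solid_add (n : ℕ) (m : ℤ) (r : E3) :
    n * (planar r * solid (n - 1) m r + r 2 * solid (n - 1) (m + 1) r) =
      (n + m + 1) * solid n (m + 1) r := by
  cases n with
  | zero =>
    rcases eq_or_ne (m + 1) 0 with h | h
    · have : (m : ℂ) + 1 = 0 := by exact_mod_cast h
      simp [this]
    · rw [solid_eq_zero (n := 0) (m := m + 1) (by simpa using h)]
      simp
  | succ n =>
    have h := fst_mul_nullCoeff (planar r) (conj (planar r)) (r 2) n m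
    simp only [solid, Nat.add_sub_cancel]
    push_cast
    linear_combination h

theorem mul_conj_planar_solid_sub (n : ℕ) (m : ℤ) (r : E3) :
    n * (conj (planar r) * solid (n - 1) m r - r 2 * solid (n - 1) (m - 1) r) =
      -((n - m + 1) * solid n (m - 1) r) := by
  cases n with
  | zero =>
    rcases eq_or_ne (1 - m) 0 with h | h
    · have : (-m + 1 : ℂ) = 0 := by rw [neg_add_eq_sub]; exact_mod_cast h
      simp [this]
    · rw [solid_eq_zero (n := 0) (m := m - 1)
        (by simp only [Nat.cast_zero, abs_pos]; omega)]
      simp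
  | succ n =>
    have h := snd_mul_nullCoeff (planar r) (conj (planar r)) (r 2) n m
    simp only [solid, Nat.add_sub_cancel]
    push_cast
    linear_combination h

theorem order_mul_solid (n : ℕ) (m : ℤ) (r : E3) :
    n * (planar r * solid (n - 1) (m - 1) r + conj (planar r) * solid (n - 1) (m + 1) r) =
      2 * (m * solid n m r) := by
  cases n with
  | zero =>
    rcases eq_or_ne m 0 with h | h
    · simp [h]
    · rw [solid_eq_zero (n := 0) (m := m) (by simpa using h)]
      simp
  | succ n =>
    have h := order_mul_nullCoeff (planar r) (conj (planar r)) (r 2) n m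
    simp only [solid, Nat.add_sub_cancel]
    push_cast
    linear_combination -2 * h

/-- The three combinations are, up to constants, the components of `r × ∇`. They annihilate the
radial factor, so they act on a scalar wave as on its solid harmonic, shifting the order and keeping
the degree. -/
theorem exists_hasLadder_wave (k : ℝ) (n : ℕ) (m : ℤ) (r : E3) : ∃ p q s : ℂ,
    HasLadder (wave k n m) p q s r ∧
      planar r * s - r 2 * p = (n + m + 1) * wave k n (m + 1) r ∧
      conj (planar r) * s - r 2 * q = -((n - m + 1) * wave k n (m - 1) r) ∧
      planar r * q - conj (planar r) * p = 2 * (m * wave k n m r) := by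
  have h1 := mul_planar_solid_add n m r
  have h2 := mul_conj_planar_solid_sub n m r
  have h3 := order_mul_solid n m r
  refine ⟨_, _, _, hasLadder_wave_aux k n m r, ?_, ?_, ?_⟩ <;> simp only [wave]
  · linear_combination (k : ℂ) ^ n * besselEntire n (k ^ 2 * ‖r‖ ^ 2) * h1
  · linear_combination (k : ℂ) ^ n * besselEntire n (k ^ 2 * ‖r‖ ^ 2) * h2
  · linear_combination (k : ℂ) ^ n * besselEntire n (k ^ 2 * ‖r‖ ^ 2) * h3

theorem curl_cartesian {fP fM fZ : E3 → ℂ} {aP bP cP aM bM cM aZ bZ cZ : ℂ} {r : E3}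
    (hP : HasLadder fP aP bP cP r) (hM : HasLadder fM aM bM cM r)
    (hZ : HasLadder fZ aZ bZ cZ r) :
    curl (fun x => WithLp.toLp 2 fun i => cartesian (fP x) (fM x) (fZ x) i) r =
      WithLp.toLp 2 fun i => cartesian (-Complex.I * (aZ - cP)) (Complex.I * (bZ - cM))
        (-Complex.I / 2 * (bP - aM)) i := by
  have h := hasLadder_cartesian hP hM hZ
  have d21 := (h 2).pderiv_one
  have d12 := (h 1).pderiv_two
  have d02 := (h 0).pderiv_two
  have d20 := (h 2).pderiv_zero
  have d10 := (h 1).pderiv_zero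
  have d01 := (h 0).pderiv_one
  simp only [curl]
  rw [d21, d12, d02, d20, d10, d01]
  have hI := Complex.I_sq
  ext i
  fin_cases i <;>
    simp only [cartesian, div_eq_mul_inv, mul_inv, Complex.inv_I, Fin.zero_eta, Fin.mk_one,
      Fin.reduceFinMk, Matrix.cons_val_zero, Matrix.cons_val_one, Matrix.cons_val]
  · ring
  · linear_combination (cM + cP - aZ - bZ) / 2 * hI
  · ring

theorem cartesian_coord (r : E3) (c : ℂ) (i : Fin 3) :
    cartesian (planar r * c) (conj (planar r) * c) (r 2 * c) i = r i * c := by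
  have h5 : conj (planar r) = r 0 - Complex.I * r 1 := by
    rw [planar, map_add, map_mul, Complex.conj_I, Complex.conj_ofReal, Complex.conj_ofReal]; ring
  rw [h5, planar]
  fin_cases i <;> simp only [cartesian, div_eq_mul_inv, mul_inv, Complex.inv_I, Fin.zero_eta,
      Fin.mk_one, Fin.reduceFinMk, Matrix.cons_val_zero, Matrix.cons_val_one, Matrix.cons_val]
  · ring
  · linear_combination -(r 1 : ℂ) * c * Complex.I_sq

theorem mul_cartesian (a P M Z : ℂ) (i : Fin 3) :
    a * cartesian P M Z i = cartesian (a * P) (a * M) (a * Z) i := by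
  fin_cases i <;> simp [cartesian] <;> ring

/-- Since the position vector is curl-free, `∇ × (r f) = -r × ∇f`, and the components of `r × ∇` are
known on scalar waves. -/
theorem curl_wave (k : ℝ) (n : ℕ) (m : ℤ) (K : ℂ) (r : E3) :
    curl (fun x => WithLp.toLp 2 fun i => (x i : ℂ) * (K * wave k n m x)) r =
      WithLp.toLp 2 fun i => K * Complex.I * te k n m i r := by
  obtain ⟨p, q, s, hw, h1, h2, h3⟩ := exists_hasLadder_wave k n m r
  have hK := hw.const_mul K
  have e : (fun x : E3 => (WithLp.toLp 2 fun i => (x i : ℂ) * (K * wave k n m x) : C3)) =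
      fun x => WithLp.toLp 2 fun i => cartesian (planar x * (K * wave k n m x))
        (conj (planar x) * (K * wave k n m x)) (x 2 * (K * wave k n m x)) i := by
    funext x
    congr 1
    funext i
    rw [cartesian_coord]
  rw [e, curl_cartesian ((hasLadder_planar r).mul hK) ((hasLadder_conj_planar r).mul hK)
    ((hasLadder_coord_two r).mul hK)]
  simp only [te, mul_cartesian]
  congr 2 with i
  congr 1
  · linear_combination K * Complex.I * h1
  · linear_combination -K * Complex.I * h2
  · linear_combination -K * Complex.I / 2 * h3

theorem curl_te (k : ℝ) (n : ℕ) (m : ℤ) (K : ℂ) (r : E3) :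
    curl (fun x => WithLp.toLp 2 fun i => K * te k (n + 1) m i x) r =
      WithLp.toLp 2 fun i => -(K * Complex.I * k) * tm k (n + 1) m i r := by
  have e1 : m - 1 + 1 = m := by ring
  have e2 : m + 1 - 1 = m := by ring
  have hP := ((hasLadder_wave k (n + 1) (m + 1) r).const_mul ((n + 1 : ℕ) + m + 1)).const_mul K
  have hM := ((hasLadder_wave k (n + 1) (m - 1) r).const_mul ((n + 1 : ℕ) - m + 1)).const_mul K
  have hZ := ((hasLadder_wave k (n + 1) m r).const_mul (-m)).const_mul K
  have h1 : (n + 1 : ℂ) ≠ 0 := by exact_mod_cast n.succ_ne_zero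
  have h2 : (n + 1 + 1 : ℂ) ≠ 0 := by exact_mod_cast (n + 1).succ_ne_zero
  have h3 : ((n + 1) * 2 + 1 : ℂ) ≠ 0 := by exact_mod_cast ((n + 1) * 2).succ_ne_zero
  simp only [te, mul_cartesian]
  rw [curl_cartesian hP hM hZ]
  simp only [tm, tmPlus, tmMinus, tmAxial, mul_cartesian, e1, e2]
  congr 2 with i
  congr 1 <;> push_cast <;> field_simp <;> ring

/-- The unnormalized mode number `p` up to a constant factor. -/
def vectorWave (k : ℝ) (p : ℕ+) (i : Fin 3) (r : E3) : ℂ :=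
  if Odd (p : ℕ) then te k (degree p) (order p) i r else tm k (degree p) (order p) i r

theorem exists_mode_eq {k : ℝ} (hk : k ≠ 0) (p : ℕ+) :
    ∃ K : ℂ, K ≠ 0 ∧ ∀ r i, mode k p r i = K * vectorWave k p i r := by
  obtain ⟨hn, -, -⟩ := mode_numbering p
  obtain ⟨K, hK, hw⟩ := exists_radialWave_eq k hn (order p)
  have hk' : (k : ℂ) ≠ 0 := by exact_mod_cast hk
  have hr : radialWave k (degree p) (order p) = fun x => WithLp.toLp 2 fun i =>
      (x i : ℂ) * (K * wave k (degree p) (order p) x) := by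
    funext x
    simp only [radialWave, hw]
  have hc : curl (radialWave k (degree p) (order p)) = fun x => WithLp.toLp 2 fun i =>
      K * Complex.I * te k (degree p) (order p) i x := by
    funext x
    rw [hr, curl_wave]
  by_cases hp : Odd (p : ℕ)
  · refine ⟨K * Complex.I, mul_ne_zero hK Complex.I_ne_zero, fun r i => ?_⟩
    simp only [mode, vectorWave, if_pos hp, hc]
  -- The two curls contribute `iK` and `-ik`, and `(1/k)(iK)(-ik) = K`.
  · refine ⟨K, hK, fun r i => ?_⟩
    obtain ⟨n, hn'⟩ : ∃ n, degree p = n + 1 := ⟨degree p - 1, by omega⟩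
    simp only [mode, vectorWave, if_neg hp, hc]
    rw [hn', curl_te]
    simp only [PiLp.smul_apply, smul_eq_mul]
    field_simp
    linear_combination -tm k (n + 1) (order p) i r * Complex.I_sq

/-! ### Weights that make raising and lowering adjoint -/

/-- The weight of the scalar waves of degree `n` and order `m`: the squared normalization constant
of the spherical harmonic. -/
def waveWeight (n : ℕ) (m : ℤ) : ℝ :=
  (2 * n + 1) * (((n - m).toNat.factorial : ℝ) * ((n + m).toNat.factorial : ℝ)) /
    (4 * Real.pi * (n.factorial : ℝ) ^ 2)

/-- The weight of the vector waves of degree `n` and order `m`. -/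
def vecWeight (n : ℕ) (m : ℤ) : ℝ := waveWeight n m / (n * (n + 1))

/-- Natural numbers for `n - m` and `n + m`, so that the factorials in the weights can be unfolded.
-/
theorem exists_nat_of_abs_le {n : ℕ} {m : ℤ} (h : |m| ≤ n) :
    ∃ a b : ℕ, (n : ℤ) - m = a ∧ (n : ℤ) + m = b ∧ (m : ℝ) = b - n ∧ (n : ℝ) = (a + b) / 2 := by
  rw [abs_le] at h
  obtain ⟨a, ha⟩ := Int.eq_ofNat_of_zero_le (by omega : 0 ≤ (n : ℤ) - m)
  obtain ⟨b, hb⟩ := Int.eq_ofNat_of_zero_le (by omega : 0 ≤ (n : ℤ) + m)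
  have h1 : (n : ℝ) - m = a := by exact_mod_cast ha
  have h2 : (n : ℝ) + m = b := by exact_mod_cast hb
  exact ⟨a, b, ha, hb, by linarith, by linarith⟩

theorem waveWeight_order_succ {n : ℕ} {m : ℤ} (h : |m| ≤ n) (h' : |m + 1| ≤ n) :
    (n - m) * waveWeight n (m + 1) = (n + m + 1) * waveWeight n m := by
  rw [abs_le] at h'
  obtain ⟨a, b, ha, hb, hm, hn⟩ := exists_nat_of_abs_le h
  obtain ⟨a, rfl⟩ : ∃ a', a = a' + 1 := ⟨a - 1, by omega⟩
  rw [waveWeight, waveWeight, show (n : ℤ) - (m + 1) = a by omega,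
    show (n : ℤ) + (m + 1) = (b + 1 : ℕ) by push_cast; omega, ha, hb, Int.toNat_natCast,
    Int.toNat_natCast, Int.toNat_natCast, Int.toNat_natCast, Nat.factorial_succ, Nat.factorial_succ,
    hm]
  have hpi := Real.pi_ne_zero
  have hf : (n.factorial : ℝ) ≠ 0 := by positivity
  push_cast at hn ⊢
  field_simp
  linear_combination (2 * (b + 1) : ℝ) * hn

theorem waveWeight_degree_succ {n : ℕ} {m : ℤ} (h : |m| ≤ n) :
    waveWeight (n + 1) m * ((2 * n + 1) * (n + 1) ^ 2) =
      waveWeight n m * ((2 * n + 3) * ((n + 1) ^ 2 - m ^ 2)) := by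
  obtain ⟨a, b, ha, hb, hm, hn⟩ := exists_nat_of_abs_le h
  rw [waveWeight, waveWeight, show ((n + 1 : ℕ) : ℤ) - m = (a + 1 : ℕ) by push_cast; omega,
    show ((n + 1 : ℕ) : ℤ) + m = (b + 1 : ℕ) by push_cast; omega, ha, hb, Int.toNat_natCast,
    Int.toNat_natCast, Int.toNat_natCast, Int.toNat_natCast, Nat.factorial_succ, Nat.factorial_succ,
    Nat.factorial_succ, hm]
  have hpi := Real.pi_ne_zero
  have hf : (n.factorial : ℝ) ≠ 0 := by positivity
  have hb' : (b : ℝ) = 2 * n - a := by linarith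
  push_cast
  rw [hb']
  field_simp
  ring

theorem waveWeight_degree_order_succ {n : ℕ} {m : ℤ} (h : |m| ≤ n) :
    waveWeight (n + 1) (m + 1) * ((2 * n + 1) * (n + 1) ^ 2) =
      waveWeight n m * ((2 * n + 3) * ((n + m + 1) * (n + m + 2))) := by
  obtain ⟨a, b, ha, hb, hm, hn⟩ := exists_nat_of_abs_le h
  rw [waveWeight, waveWeight, show ((n + 1 : ℕ) : ℤ) - (m + 1) = a by push_cast; omega,
    show ((n + 1 : ℕ) : ℤ) + (m + 1) = (b + 1 + 1 : ℕ) by push_cast; omega, ha, hb,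
    Int.toNat_natCast, Int.toNat_natCast, Int.toNat_natCast, Nat.factorial_succ,
    Nat.factorial_succ b, Nat.factorial_succ n, hm]
  have hpi := Real.pi_ne_zero
  have hf : (n.factorial : ℝ) ≠ 0 := by positivity
  push_cast
  field_simp
  ring

theorem waveWeight_neg (n : ℕ) (m : ℤ) : waveWeight n (-m) = waveWeight n m := by
  rw [waveWeight, waveWeight, sub_neg_eq_add, ← sub_eq_add_neg, mul_comm (((n : ℤ) + m).toNat.factorial : ℝ)]

/-- Symmetry of the polarization-changing coefficients with respect to the weights. It lets the
mixed terms of neighbouring orders cancel. -/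
theorem vecWeight_mul_mixPlus {n : ℕ} {m : ℤ} (h : |m| ≤ n) (h' : |m + 1| ≤ n) :
    vecWeight n m * mixPlus n m = vecWeight n (m + 1) * mixMinus n (m + 1) := by
  have := waveWeight_order_succ h h'
  rw [vecWeight, vecWeight, mixPlus, mixMinus]
  push_cast
  rw [div_mul_div_comm, div_mul_div_comm]
  congr 1
  linear_combination -this

/-- Weighted raising from a degree equals weighted lowering from the next one. This identity and its
analogues for the shifted orders cause the telescoping. -/
theorem vecWeight_mul_raiseAxial {n : ℕ} {m : ℤ} (h : |m| ≤ n + 1) :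
    vecWeight (n + 1) m * raiseAxial (n + 1) m = vecWeight (n + 2) m * lowCoeff (n + 2) := by
  have := waveWeight_degree_succ (n := n + 1) (m := m) (by exact_mod_cast h)
  have h3 : waveWeight (n + 2) m = waveWeight (n + 1) m * ((2 * (n + 1 : ℕ) + 3) *
      (((n + 1 : ℕ) + 1) ^ 2 - m ^ 2)) / ((2 * (n + 1 : ℕ) + 1) * ((n + 1 : ℕ) + 1) ^ 2) := by
    rw [← this]; field_simp
  rw [vecWeight, vecWeight, raiseAxial, lowCoeff, h3]
  push_cast
  field_simp
  ring

theorem vecWeight_mul_raisePlus {n : ℕ} {m : ℤ} (h : |m| ≤ n + 1) :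
    vecWeight (n + 1) m * raisePlus (n + 1) m = vecWeight (n + 2) (m + 1) * lowCoeff (n + 2) := by
  have := waveWeight_degree_order_succ (n := n + 1) (m := m) (by exact_mod_cast h)
  have h3 : waveWeight (n + 2) (m + 1) = waveWeight (n + 1) m * ((2 * (n + 1 : ℕ) + 3) *
      (((n + 1 : ℕ) + m + 1) * ((n + 1 : ℕ) + m + 2))) /
        ((2 * (n + 1 : ℕ) + 1) * ((n + 1 : ℕ) + 1) ^ 2) := by
    rw [← this]; field_simp
  rw [vecWeight, vecWeight, raisePlus, lowCoeff, h3]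
  push_cast
  field_simp
  ring

/-- Reflection `m ↦ -m` of the preceding identity. -/
theorem vecWeight_mul_raiseMinus {n : ℕ} {m : ℤ} (h : |m| ≤ n + 1) :
    vecWeight (n + 1) m * raiseMinus (n + 1) m = vecWeight (n + 2) (m - 1) * lowCoeff (n + 2) := by
  have := vecWeight_mul_raisePlus (n := n) (m := -m) (by rwa [abs_neg])
  rw [vecWeight, vecWeight, waveWeight_neg, show -m + 1 = -(m - 1) by ring, waveWeight_neg,
    raisePlus] at this
  rw [vecWeight, vecWeight, raiseMinus, ← this]
  push_cast
  ring

/-! ### Telescoping of the truncated kernel under translation -/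

theorem sum_Icc_shift (M : ℕ) (f : ℤ → ℂ) (h1 : f (-M) = 0) (h2 : f (M + 1) = 0) :
    ∑ m ∈ Finset.Icc (-M : ℤ) M, f (m + 1) = ∑ m ∈ Finset.Icc (-M : ℤ) M, f m := by
  have e : ∑ m ∈ Finset.Icc (-M : ℤ) M, f (m + 1) = ∑ m ∈ Finset.Icc (-M + 1 : ℤ) (M + 1), f m := by
    refine Finset.sum_nbij' (· + 1) (· - 1) ?_ ?_ ?_ ?_ ?_ <;> intro x hx <;>
      simp only [Finset.mem_Icc] at hx ⊢ <;> omega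
  rw [e, ← Finset.sum_subset (s₁ := Finset.Icc (-M + 1 : ℤ) M)
      (Finset.Icc_subset_Icc_right (by omega)) ?_,
    ← Finset.sum_subset (s₁ := Finset.Icc (-M + 1 : ℤ) M) (s₂ := Finset.Icc (-M : ℤ) M)
      (Finset.Icc_subset_Icc_left (by omega)) ?_]
  · intro x hx hx'
    simp only [Finset.mem_Icc, not_and, not_le] at hx hx'
    rw [show x = -M by omega, h1]
  · intro x hx hx'
    simp only [Finset.mem_Icc, not_and, not_le] at hx hx'
    rw [show x = M + 1 by omega, h2]

section telescoping
variable {X Y : ℕ → ℤ → ℂ} (hX : ∀ (n : ℕ) (m : ℤ), (n : ℤ) < |m| → X n m = 0)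
  (hY : ∀ (n : ℕ) (m : ℤ), (n : ℤ) < |m| → Y n m = 0) (M : ℕ)

/-- The part of the derivative of the truncated kernel along `∂x + i ∂y` that links the degrees
`n` and `n + 1`. -/
def linkPlus (X Y : ℕ → ℤ → ℂ) (M n : ℕ) : ℂ :=
  ∑ m ∈ Finset.Icc (-M : ℤ) M, (vecWeight (n + 1) m * lowCoeff (n + 1) : ℝ) *
    (X (n + 1) m * Y n (m - 1) - X n (m + 1) * Y (n + 1) m)

/-- The part of the derivative of the truncated kernel along `∂z` that links the degrees
`n` and `n + 1`. -/
def linkAxial (X Y : ℕ → ℤ → ℂ) (M n : ℕ) : ℂ :=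
  ∑ m ∈ Finset.Icc (-M : ℤ) M, (vecWeight (n + 1) m * lowCoeff (n + 1) : ℝ) *
    (X n m * Y (n + 1) m + X (n + 1) m * Y n m)

include hX hY in
theorem sum_raise_eq_linkAxial (n : ℕ) :
    ∑ m ∈ Finset.Icc (-M : ℤ) M, (vecWeight (n + 1) m * raiseAxial (n + 1) m : ℝ) *
      (X (n + 2) m * Y (n + 1) m + X (n + 1) m * Y (n + 2) m) = linkAxial X Y M (n + 1) := by
  refine Finset.sum_congr rfl fun m _ => ?_
  by_cases hm : |m| ≤ n + 1
  · rw [vecWeight_mul_raiseAxial hm, add_comm (X (n + 2) m * _)]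
  · push Not at hm
    rw [hX (n + 1) m (by exact_mod_cast hm), hY (n + 1) m (by exact_mod_cast hm)]
    simp

include hX hY in
-- The raising terms of degree `n + 1` become, after a shift of the order in one of the two sums,
-- the lowering terms of degree `n + 2`. The window `M > n + 1` leaves room for the shift, since the
-- terms dropped at its ends vanish.
theorem sum_raise_eq_linkPlus (n : ℕ) (hM : n + 1 < M) :
    ∑ m ∈ Finset.Icc (-M : ℤ) M, ((vecWeight (n + 1) m * raisePlus (n + 1) m : ℝ) *
      (X (n + 2) (m + 1) * Y (n + 1) m) - (vecWeight (n + 1) m * raiseMinus (n + 1) m : ℝ) *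
      (X (n + 1) m * Y (n + 2) (m - 1))) = linkPlus X Y M (n + 1) := by
  have e1 : ∀ m : ℤ, (vecWeight (n + 1) m * raisePlus (n + 1) m : ℝ) *
      (X (n + 2) (m + 1) * Y (n + 1) m) = (fun l : ℤ => (vecWeight (n + 2) l * lowCoeff (n + 2) : ℝ) *
        (X (n + 2) l * Y (n + 1) (l - 1))) (m + 1) := by
    intro m
    simp only [add_sub_cancel_right]
    by_cases hm : |m| ≤ n + 1
    · rw [vecWeight_mul_raisePlus hm]
    · push Not at hm
      rw [hY (n + 1) m (by exact_mod_cast hm)]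
      simp
  have e2 : ∀ m : ℤ, (vecWeight (n + 1) m * raiseMinus (n + 1) m : ℝ) *
      (X (n + 1) m * Y (n + 2) (m - 1)) = (vecWeight (n + 2) (m - 1) * lowCoeff (n + 2) : ℝ) *
        (X (n + 1) m * Y (n + 2) (m - 1)) := by
    intro m
    by_cases hm : |m| ≤ n + 1
    · rw [vecWeight_mul_raiseMinus hm]
    · push Not at hm
      rw [hX (n + 1) m (by exact_mod_cast hm)]
      simp
  have s2 := sum_Icc_shift M (fun m : ℤ => (vecWeight (n + 2) (m - 1) * lowCoeff (n + 2) : ℝ) *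
        (X (n + 1) m * Y (n + 2) (m - 1)))
        (by rw [hX _ _ (by rw [abs_neg, Nat.abs_cast]; exact_mod_cast hM)]; simp)
        (by rw [hX _ _ (by rw [abs_of_nonneg (by positivity)]; push_cast; omega)]; simp)
  simp only [add_sub_cancel_right] at s2
  rw [Finset.sum_sub_distrib, Finset.sum_congr rfl fun m _ => e1 m,
    Finset.sum_congr rfl fun m _ => e2 m, ← s2, sum_Icc_shift M (fun l : ℤ => (vecWeight (n + 2) l * lowCoeff (n + 2) : ℝ) *
      (X (n + 2) l * Y (n + 1) (l - 1))), ← Finset.sum_sub_distrib, linkPlus]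
  · refine Finset.sum_congr rfl fun m _ => ?_
    rw [show n + 1 + 1 = n + 2 from rfl]
    ring
  · rw [hY _ _ (by rw [abs_of_neg (by omega)]; push_cast; omega)]; simp
  · rw [add_sub_cancel_right, hY _ _ (by rw [Nat.abs_cast]; exact_mod_cast hM)]; simp

include hX hY in
-- A shift of the order identifies the mixed sum from `∂x + i∂y` acting on one factor with the one
-- from the conjugate operator acting on the other; in the derivative of the kernel they have
-- opposite signs.
theorem sum_mix_shift (n : ℕ) (hM : n < M) :
    ∑ m ∈ Finset.Icc (-M : ℤ) M, (vecWeight n m * mixPlus n m : ℝ) * (X n (m + 1) * Y n m) =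
      ∑ m ∈ Finset.Icc (-M : ℤ) M, (vecWeight n m * mixMinus n m : ℝ) * (X n m * Y n (m - 1)) := by
  rw [← sum_Icc_shift M (fun m : ℤ => (vecWeight n m * mixMinus n m : ℝ) * (X n m * Y n (m - 1)))
        (by rw [hX _ _ (by rw [abs_neg, Nat.abs_cast]; exact_mod_cast hM)]; simp)
        (by rw [hX _ _ (by rw [abs_of_nonneg (by positivity)]; omega)]; simp)]
  refine Finset.sum_congr rfl fun m _ => ?_
  rw [add_sub_cancel_right]
  by_cases hm : |m| ≤ n
  · by_cases hm' : |m + 1| ≤ n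
    · rw [vecWeight_mul_mixPlus hm hm']
    · push Not at hm'
      rw [hX _ _ hm']
      simp
  · push Not at hm
    rw [hY _ _ hm]
    simp

end telescoping

/-- The sum over the modes of degree at most `N` of the components `i`, `j` of the dyads formed
from the vector waves. -/
def kernelSum (k : ℝ) (M N : ℕ) (i j : Fin 3) (r r' : E3) : ℂ :=
  ∑ n ∈ Finset.range N, ∑ m ∈ Finset.Icc (-M : ℤ) M, (vecWeight (n + 1) m : ℂ) *
    (te k (n + 1) m i r * conj (te k (n + 1) m j r') +
      tm k (n + 1) m i r * conj (tm k (n + 1) m j r'))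

theorem te_zero_degree (k : ℝ) (m : ℤ) (i : Fin 3) (r : E3) : te k 0 m i r = 0 := by
  by_cases hm : m = 0
  · subst hm
    rw [te, wave_eq_zero (by simp), wave_eq_zero (by simp)]
    fin_cases i <;> simp [cartesian]
  · exact te_eq_zero (by simpa using hm) k i r

theorem tm_zero_degree (k : ℝ) (m : ℤ) (i : Fin 3) (r : E3) : tm k 0 m i r = 0 := by
  rw [tm, tmPlus, tmMinus, tmAxial]
  fin_cases i <;> simp [cartesian]

theorem HasLadder.comp_const_add {f : E3 → ℂ} {p q s : ℂ} {r x : E3}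
    (h : HasLadder f p q s (r + x)) : HasLadder (fun y => f (r + y)) p q s x := by
  have := HasFDerivAt.comp x h ((hasFDerivAt_id x).const_add r)
  rw [ContinuousLinearMap.comp_id] at this
  exact this

section
variable (k : ℝ) (M N : ℕ) (i j : Fin 3) (r r' : E3)

/-- The derivative of the truncated kernel along `∂x + i ∂y`, both points moving. -/
def boundaryPlus : ℂ :=
  -k * (linkPlus (fun n m => te k n m i r) (fun n m => conj (te k n m j r')) M N +
    linkPlus (fun n m => tm k n m i r) (fun n m => conj (tm k n m j r')) M N)

/-- The derivative of the truncated kernel along `∂x - i ∂y`, both points moving. -/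
def boundaryMinus : ℂ :=
  -k * (linkPlus (fun n m => conj (te k n m j r')) (fun n m => te k n m i r) M N +
    linkPlus (fun n m => conj (tm k n m j r')) (fun n m => tm k n m i r) M N)

/-- The derivative of the truncated kernel along `∂z`, both points moving. -/
def boundaryAxial : ℂ :=
  -k * (linkAxial (fun n m => te k n m i r) (fun n m => conj (te k n m j r')) M N +
    linkAxial (fun n m => tm k n m i r) (fun n m => conj (tm k n m j r')) M N)

theorem linkPlus_zero {X Y : ℕ → ℤ → ℂ} (hX : ∀ m, X 0 m = 0) (hY : ∀ m, Y 0 m = 0) :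
    linkPlus X Y M 0 = 0 := by
  simp [linkPlus, hX, hY]

theorem linkAxial_zero {X Y : ℕ → ℤ → ℂ} (hX : ∀ m, X 0 m = 0) (hY : ∀ m, Y 0 m = 0) :
    linkAxial X Y M 0 = 0 := by
  simp [linkAxial, hX, hY]

theorem sum_range_sub_succ (f : ℕ → ℂ) (h : f 0 = 0) :
    ∑ n ∈ Finset.range N, (f n - f (n + 1)) = -f N := by
  rw [Finset.sum_range_sub', h, zero_sub]

/-- The kernel is translation invariant up to its last link. At each degree the product rule gives a
lowering link, a raising link and mixed terms; the mixed terms cancel, the links telescope, and the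
link of index 0 vanishes because there are no vector waves of degree 0. -/
theorem hasLadder_kernelSum (hM : N < M) (x : E3) :
    HasLadder (fun y => kernelSum k M N i j (r + y) (r' + y))
      (boundaryPlus k M N i j (r + x) (r' + x)) (boundaryMinus k M N i j (r + x) (r' + x))
      (boundaryAxial k M N i j (r + x) (r' + x)) x := by
  set e := fun (n : ℕ) (m : ℤ) => te k n m i (r + x) with he
  set e' := fun (n : ℕ) (m : ℤ) => conj (te k n m j (r' + x)) with he'
  set b := fun (n : ℕ) (m : ℤ) => tm k n m i (r + x) with hb
  set b' := fun (n : ℕ) (m : ℤ) => conj (tm k n m j (r' + x)) with hb'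
  have ze : ∀ (n : ℕ) (m : ℤ), (n : ℤ) < |m| → e n m = 0 := fun n m h => te_eq_zero h _ _ _
  have zb : ∀ (n : ℕ) (m : ℤ), (n : ℤ) < |m| → b n m = 0 := fun n m h => tm_eq_zero h _ _ _
  have ze' : ∀ (n : ℕ) (m : ℤ), (n : ℤ) < |m| → e' n m = 0 := fun n m h => by
    simp [he', te_eq_zero h]
  have zb' : ∀ (n : ℕ) (m : ℤ), (n : ℤ) < |m| → b' n m = 0 := fun n m h => by
    simp [hb', tm_eq_zero h]
  have e0 : ∀ m, e 0 m = 0 := fun m => te_zero_degree _ _ _ _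
  have b0 : ∀ m, b 0 m = 0 := fun m => tm_zero_degree _ _ _ _
  have e0' : ∀ m, e' 0 m = 0 := fun m => by simp [he', te_zero_degree]
  have b0' : ∀ m, b' 0 m = 0 := fun m => by simp [hb', tm_zero_degree]
  have hterm : ∀ n ∈ Finset.range N, ∀ m ∈ Finset.Icc (-M : ℤ) M, HasLadder
      (fun y => (vecWeight (n + 1) m : ℂ) *
        (te k (n + 1) m i (r + y) * conj (te k (n + 1) m j (r' + y)) +
          tm k (n + 1) m i (r + y) * conj (tm k (n + 1) m j (r' + y)))) _ _ _ x :=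
    fun n _ m _ => HasLadder.const_mul _
      (((hasLadder_te k n m (r + x) i).comp_const_add.mul
        (hasLadder_te k n m (r' + x) j).comp_const_add.conjugate).add
      ((hasLadder_tm k n m (r + x) i).comp_const_add.mul
        (hasLadder_tm k n m (r' + x) j).comp_const_add.conjugate))
  have hsum := HasLadder.finset_sum (r := x) (Finset.range N)
    fun n hn => HasLadder.finset_sum (Finset.Icc (-M : ℤ) M) (hterm n hn)
  refine hsum.congr_form ?_ ?_ ?_
  · refine (Finset.sum_congr rfl (g := fun n => k * ((linkPlus e e' M n - linkPlus e e' M (n + 1)) +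
        (linkPlus b b' M n - linkPlus b b' M (n + 1)))) fun n hn => ?_).trans ?_
    · beta_reduce
      have hn' : n + 1 < M := by have := Finset.mem_range.1 hn; omega
      have R1 := sum_raise_eq_linkPlus ze ze' M n hn'
      have R2 := sum_raise_eq_linkPlus zb zb' M n hn'
      have M1 := sum_mix_shift zb ze' M (n + 1) hn'
      have M2 := sum_mix_shift ze zb' M (n + 1) hn'
      rw [← R1, ← R2]
      -- The mixed sums are added in the form `k · (0 - 0)`, so that both sides agree order by
      -- order.
      refine Eq.trans ?_ (add_eq_left.2 ((congrArg₂ (fun a c => (k : ℂ) * (a - c))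
        (sub_eq_zero.2 M2) (sub_eq_zero.2 M1)).trans (by simp)))
      simp only [linkPlus, ← Finset.sum_add_distrib, ← Finset.sum_sub_distrib, Finset.mul_sum]
      refine Finset.sum_congr rfl fun m _ => ?_
      simp only [he, hb, he', hb', map_add, map_mul, map_neg, Complex.conj_ofReal]
      push_cast
      ring
    · rw [← Finset.mul_sum, Finset.sum_add_distrib,
        sum_range_sub_succ N _ (linkPlus_zero M e0 e0'), sum_range_sub_succ N _ (linkPlus_zero M b0 b0'),
        boundaryPlus]
      ring
  · refine (Finset.sum_congr rfl (g := fun n => k * ((linkPlus e' e M n - linkPlus e' e M (n + 1)) +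
        (linkPlus b' b M n - linkPlus b' b M (n + 1)))) fun n hn => ?_).trans ?_
    · beta_reduce
      have hn' : n + 1 < M := by have := Finset.mem_range.1 hn; omega
      have R1 := sum_raise_eq_linkPlus ze' ze M n hn'
      have R2 := sum_raise_eq_linkPlus zb' zb M n hn'
      have M1 := sum_mix_shift ze' zb M (n + 1) hn'
      have M2 := sum_mix_shift zb' ze M (n + 1) hn'
      rw [← R1, ← R2]
      refine Eq.trans ?_ (add_eq_left.2 ((congrArg₂ (fun a c => (k : ℂ) * (a - c))
        (sub_eq_zero.2 M1) (sub_eq_zero.2 M2)).trans (by simp)))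
      simp only [linkPlus, ← Finset.sum_add_distrib, ← Finset.sum_sub_distrib, Finset.mul_sum]
      refine Finset.sum_congr rfl fun m _ => ?_
      simp only [he, hb, he', hb', map_add, map_mul, map_neg, Complex.conj_ofReal]
      push_cast
      ring
    · rw [← Finset.mul_sum, Finset.sum_add_distrib,
        sum_range_sub_succ N _ (linkPlus_zero M e0' e0), sum_range_sub_succ N _ (linkPlus_zero M b0' b0),
        boundaryMinus]
      ring
  · refine (Finset.sum_congr rfl (g := fun n => k * ((linkAxial e e' M n - linkAxial e e' M (n + 1)) +
        (linkAxial b b' M n - linkAxial b b' M (n + 1)))) fun n hn => ?_).trans ?_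
    · beta_reduce
      rw [← sum_raise_eq_linkAxial ze ze' M n, ← sum_raise_eq_linkAxial zb zb' M n]
      simp only [linkAxial, ← Finset.sum_add_distrib, ← Finset.sum_sub_distrib, Finset.mul_sum]
      refine Finset.sum_congr rfl fun m _ => ?_
      simp only [he, hb, he', hb', map_add, map_mul, map_neg, Complex.conj_ofReal]
      push_cast
      ring
    · rw [← Finset.mul_sum, Finset.sum_add_distrib,
        sum_range_sub_succ N _ (linkAxial_zero M e0 e0'), sum_range_sub_succ N _ (linkAxial_zero M b0 b0'),
        boundaryAxial]
      ring

end

/-! ### Factorial decay of the boundary term -/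

/-- The solid harmonic grows at most like `(2ρ)^n`, while the Bessel factor supplies `1/n!`. -/
theorem norm_wave_le {k ρ q : ℝ} (hk : 0 < k) (hq : 2 * k * ρ ≤ q) (n : ℕ) (m : ℤ) {r : E3}
    (hr : ‖r‖ ≤ ρ) : ‖wave k n m r‖ ≤ Real.exp (k ^ 2 * ρ ^ 2) * q ^ n / n.factorial := by
  have hρ : 0 ≤ ρ := (norm_nonneg r).trans hr
  have h1 : ‖solid n m r‖ ≤ (2 * ρ) ^ n := by
    refine norm_nullCoeff_le _ _ _ ((norm_planar_le r).trans hr) ?_ ((norm_coord_le r 2).trans hr) n m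
    rw [RCLike.norm_conj]
    exact (norm_planar_le r).trans hr
  have h2 : |besselEntire n (k ^ 2 * ‖r‖ ^ 2)| ≤ Real.exp (k ^ 2 * ρ ^ 2) / n.factorial := by
    refine abs_besselEntire_le n ?_
    rw [abs_of_nonneg (by positivity)]
    gcongr
  rw [wave, norm_mul, norm_mul, norm_pow, Complex.norm_real, Complex.norm_real, Real.norm_eq_abs,
    Real.norm_eq_abs, abs_of_pos hk]
  calc _ ≤ k ^ n * (Real.exp (k ^ 2 * ρ ^ 2) / n.factorial * (2 * ρ) ^ n) := by gcongr
    _ = Real.exp (k ^ 2 * ρ ^ 2) * (2 * k * ρ) ^ n / n.factorial := by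
        rw [mul_pow, mul_pow, mul_pow]; ring
    _ ≤ _ := by gcongr

theorem norm_cartesian_le {P M Z : ℂ} {B : ℝ} (hP : ‖P‖ ≤ B) (hM : ‖M‖ ≤ B) (hZ : ‖Z‖ ≤ B)
    (i : Fin 3) : ‖cartesian P M Z i‖ ≤ B := by
  fin_cases i
  · simp only [cartesian, Fin.zero_eta, Matrix.cons_val_zero, norm_div, Complex.norm_ofNat]
    linarith [norm_add_le P M]
  · simp only [cartesian, Fin.mk_one, Matrix.cons_val_one, Matrix.cons_val_zero, norm_div, norm_mul,
      Complex.norm_ofNat, Complex.norm_I]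
    linarith [norm_sub_le P M]
  · simpa [cartesian] using hZ

theorem norm_intCast_le {a : ℤ} {b : ℕ} (h : |a| ≤ b) : ‖(a : ℂ)‖ ≤ b := by
  rw [Complex.norm_intCast]
  exact_mod_cast h

theorem natCast_add_one_le_two_pow (n : ℕ) : (n : ℝ) + 1 ≤ 2 ^ n := by
  exact_mod_cast Nat.lt_two_pow_self

/-- A bound for the vector waves of degree `n`. -/
def waveBound (E q : ℝ) (n : ℕ) : ℝ := 6 * E * (4 * q) ^ (n + 1) / n.factorial

theorem norm_te_le {k ρ q : ℝ} (hk : 0 < k) (hq1 : 1 ≤ q) (hq : 2 * k * ρ ≤ q) (n : ℕ) (m : ℤ) (i : Fin 3) {r : E3} (hr : ‖r‖ ≤ ρ) :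
    ‖te k n m i r‖ ≤ waveBound (Real.exp (k ^ 2 * ρ ^ 2)) q n := by
  set E := Real.exp (k ^ 2 * ρ ^ 2) with hE
  have hE0 : 0 < E := Real.exp_pos _
  by_cases hm : |m| ≤ n
  · have key : ∀ (a l : ℤ), |a| ≤ (2 * n + 1 : ℕ) → ‖(a : ℂ) * wave k n l r‖ ≤ waveBound E q n := by
      intro a l ha
      rw [norm_mul, waveBound]
      calc _ ≤ ((2 * n + 1 : ℕ) : ℝ) * (E * q ^ n / n.factorial) := by
            gcongr
            · exact norm_intCast_le ha
            · exact norm_wave_le hk hq n l hr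
        _ ≤ (6 * 4 ^ (n + 1)) * (E * q ^ (n + 1) / n.factorial) := by
            have h2 := natCast_add_one_le_two_pow n
            have h3 : (2 : ℝ) ^ n ≤ 4 ^ n := by gcongr; norm_num
            gcongr
            · push_cast
              rw [pow_succ]
              linarith
            · omega
        _ = _ := by rw [mul_pow]; ring
    rw [abs_le] at hm
    refine norm_cartesian_le ?_ ?_ ?_ i
    · have := key (n + m + 1) (m + 1) (by rw [abs_le]; push_cast; omega)
      push_cast at this
      exact this
    · have := key (n - m + 1) (m - 1) (by rw [abs_le]; push_cast; omega)
      push_cast at this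
      exact this
    · have := key (-m) m (by rw [abs_le]; push_cast; omega)
      push_cast at this
      exact this
  · rw [te_eq_zero (by simpa using hm), norm_zero, waveBound]
    positivity

/-- Comparing the wave of degree `n - 1` with `1/n!` costs a factor `n`; this and the other
polynomial coefficients are absorbed by `4^(n+1)`. The condition `q ≥ 1` allows all powers of `q` to
be raised to `n + 1`. -/
theorem norm_tm_le {k ρ q : ℝ} (hk : 0 < k) (hq1 : 1 ≤ q) (hq : 2 * k * ρ ≤ q) (n : ℕ) (m : ℤ)
    (i : Fin 3) {r : E3} (hr : ‖r‖ ≤ ρ) :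
    ‖tm k n m i r‖ ≤ waveBound (Real.exp (k ^ 2 * ρ ^ 2)) q n := by
  set E := Real.exp (k ^ 2 * ρ ^ 2) with hE
  have hE0 : 0 < E := Real.exp_pos _
  by_cases hm : |m| ≤ n
  · have key : ∀ (A : ℂ) (a b l : ℤ), ‖A‖ ≤ n + 1 → |a| ≤ (2 * n + 1 : ℕ) → |b| ≤ (2 * n + 2 : ℕ) →
        ‖(n : ℂ) / (2 * n + 1) * (A * wave k (n - 1) l r +
          (a : ℂ) * b / (n + 1) * wave k (n + 1) l r)‖ ≤ waveBound E q n := by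
      intro A a b l hA ha hb
      set X := E * q ^ (n + 1) / n.factorial with hX
      have hX0 : 0 ≤ X := by positivity
      have h1 : (n : ℝ) * ‖wave k (n - 1) l r‖ ≤ n * n * X := by
        rcases n with _ | n
        · simp
        · rw [mul_assoc, Nat.add_sub_cancel]
          gcongr
          refine (norm_wave_le hk hq n l hr).trans ?_
          rw [hX, Nat.factorial_succ, Nat.cast_mul, mul_div_assoc', mul_div_mul_left _ _ (by positivity)]
          gcongr
          omega
      have h2 : ‖wave k (n + 1) l r‖ ≤ X := by
        refine (norm_wave_le hk hq (n + 1) l hr).trans ?_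
        rw [hX]
        gcongr
        omega
      have h3 : ‖(n : ℂ) / (2 * n + 1)‖ = n / (2 * n + 1) := by
        have : (n : ℂ) / (2 * n + 1) = ((n / (2 * n + 1) : ℝ) : ℂ) := by push_cast; rfl
        rw [this, Complex.norm_real, Real.norm_of_nonneg (by positivity)]
      have h4 : ‖(a : ℂ) * b / (n + 1)‖ ≤ 2 * (2 * n + 1) := by
        have h5 : ‖(n + 1 : ℂ)‖ = n + 1 := by
          exact_mod_cast Complex.norm_natCast (n + 1)
        rw [norm_div, norm_mul, h5, div_le_iff₀ (by positivity)]
        have ha' := norm_intCast_le ha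
        have hb' := norm_intCast_le hb
        push_cast at ha' hb'
        calc _ ≤ (2 * n + 1 : ℝ) * (2 * n + 2) := by gcongr
          _ = _ := by ring
      rw [norm_mul, h3]
      calc _ ≤ (n : ℝ) / (2 * n + 1) * ((n + 1) * ‖wave k (n - 1) l r‖ +
              2 * (2 * n + 1) * ‖wave k (n + 1) l r‖) := by
            refine mul_le_mul_of_nonneg_left ((norm_add_le _ _).trans ?_) (by positivity)
            rw [norm_mul, norm_mul]
            gcongr
        _ = (n + 1) / (2 * n + 1) * (n * ‖wave k (n - 1) l r‖) + 2 * n * ‖wave k (n + 1) l r‖ := by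
            field_simp
        _ ≤ 1 * (n * n * X) + 2 * n * X := by
            gcongr
            rw [div_le_one (by positivity)]
            linarith [(n.cast_nonneg : (0 : ℝ) ≤ n)]
        _ ≤ (6 * 4 ^ (n + 1)) * X := by
            have h6 := natCast_add_one_le_two_pow n
            have h7 : ((n : ℝ) + 1) ^ 2 ≤ 4 ^ n := by
              calc _ ≤ ((2 : ℝ) ^ n) ^ 2 := by gcongr
                _ = _ := by rw [← pow_mul, mul_comm, pow_mul]; norm_num
            rw [one_mul, ← add_mul]
            gcongr
            rw [pow_succ]
            nlinarith
        _ = _ := by rw [hX, waveBound, mul_pow]; ring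
    rw [abs_le] at hm
    have hn1 : ‖(n : ℂ) + 1‖ ≤ n + 1 := (norm_add_le _ _).trans (by simp)
    refine norm_cartesian_le ?_ ?_ ?_ i
    · have := key (-(n + 1)) (n + m + 1) (n + m + 2) (m + 1) (by rwa [norm_neg])
        (by rw [abs_le]; push_cast; omega) (by rw [abs_le]; push_cast; omega)
      push_cast at this
      exact this
    · have := key (n + 1) (-(n - m + 1)) (n - m + 2) (m - 1) hn1
        (by rw [abs_le]; push_cast; omega) (by rw [abs_le]; push_cast; omega)
      push_cast at this
      refine (congrArg norm ?_).trans_le this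
      rw [tmMinus]
      ring
    · have := key (n + 1) (n - m + 1) (n + m + 1) m hn1
        (by rw [abs_le]; push_cast; omega) (by rw [abs_le]; push_cast; omega)
      push_cast at this
      exact this
  · rw [tm_eq_zero (by simpa using hm), norm_zero, waveBound]
    positivity

theorem vecWeight_nonneg (n : ℕ) (m : ℤ) : 0 ≤ vecWeight n m := by
  rw [vecWeight, waveWeight]
  positivity

/-- With `a + b = 2n` one has `a! b! ≤ (2n)! ≤ 4^n (n!)²`, the second step because a binomial
coefficient of `2n` is at most `2^(2n)`. -/
theorem vecWeight_le {n : ℕ} {m : ℤ} (hn : 1 ≤ n) (hm : |m| ≤ n) : vecWeight n m ≤ 4 ^ n := by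
  obtain ⟨a, b, ha, hb, -, -⟩ := exists_nat_of_abs_le hm
  rw [vecWeight, waveWeight, ha, hb, Int.toNat_natCast, Int.toNat_natCast]
  have hab : a + b = 2 * n := by omega
  have h1 : a.factorial * b.factorial ≤ 4 ^ n * n.factorial ^ 2 := by
    calc _ ≤ (a + b).factorial :=
          Nat.le_of_dvd (Nat.factorial_pos _) (Nat.factorial_mul_factorial_dvd_factorial_add a b)
      _ = (2 * n).choose n * (n.factorial * n.factorial) := by
          have := Nat.choose_mul_factorial_mul_factorial (n := 2 * n) (k := n) (by omega)
          rw [show 2 * n - n = n by omega] at this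
          rw [hab, ← this, mul_assoc]
      _ ≤ 2 ^ (2 * n) * (n.factorial * n.factorial) :=
          Nat.mul_le_mul_right _ (Nat.choose_le_two_pow _ _)
      _ = _ := by rw [pow_mul, sq (n.factorial)]; norm_num
  have h2 : (a.factorial : ℝ) * b.factorial ≤ 4 ^ n * (n.factorial : ℝ) ^ 2 := by exact_mod_cast h1
  have hn' : (1 : ℝ) ≤ n := by exact_mod_cast hn
  have hpi := Real.pi_gt_three
  have hf : (0 : ℝ) < n.factorial := by positivity
  rw [div_div, div_le_iff₀ (by positivity)]
  calc _ ≤ (2 * n + 1 : ℝ) * (4 ^ n * (n.factorial : ℝ) ^ 2) := by gcongr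
    _ = 4 ^ n * ((n.factorial : ℝ) ^ 2 * (2 * n + 1)) := by ring
    _ ≤ 4 ^ n * ((n.factorial : ℝ) ^ 2 * (4 * Real.pi * (n * (n + 1)))) := by
        gcongr
        have h3 : 1 * (n * (n + 1)) ≤ Real.pi * (n * (n + 1) : ℝ) := by
          gcongr
          linarith
        nlinarith
    _ = _ := by ring

theorem norm_linkWeight_le {n : ℕ} {m : ℤ} (hm : |m| ≤ (n + 1 : ℕ)) :
    ‖((vecWeight (n + 1) m * lowCoeff (n + 1) : ℝ) : ℂ)‖ ≤ 4 ^ (n + 1) := by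
  have h0 : 0 ≤ lowCoeff (n + 1) := by rw [lowCoeff]; positivity
  have h1 : lowCoeff (n + 1) ≤ 1 := by
    rw [lowCoeff, div_le_one (by positivity)]
    have : (0 : ℝ) ≤ (n + 1 : ℕ) := Nat.cast_nonneg _
    linarith
  rw [Complex.norm_real, Real.norm_of_nonneg (mul_nonneg (vecWeight_nonneg _ _) h0)]
  calc _ ≤ (4 : ℝ) ^ (n + 1) * 1 := by
        gcongr
        exact vecWeight_le (by omega) hm
    _ = _ := mul_one _

section
variable {X Y : ℕ → ℤ → ℂ} {n : ℕ} {B B' : ℝ}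

/-- The window contains `2n + 3 ≤ 3 · 2^n` orders, each with a coefficient of size at most
`4^(n+1)`. -/
theorem norm_link_le {F : ℤ → ℂ} {D : ℝ} (h : ∀ m, ‖F m‖ ≤ D) :
    ‖∑ m ∈ Finset.Icc (-(n + 1 : ℕ) : ℤ) (n + 1 : ℕ),
      ((vecWeight (n + 1) m * lowCoeff (n + 1) : ℝ) : ℂ) * F m‖ ≤
        3 * 2 ^ n * 4 ^ (n + 1) * D := by
  have hD : 0 ≤ D := (norm_nonneg _).trans (h 0)
  refine (norm_sum_le_of_le (f := fun m => ((vecWeight (n + 1) m * lowCoeff (n + 1) : ℝ) : ℂ) * F m)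
    _ (n := fun _ => 4 ^ (n + 1) * D) fun m hm => ?_).trans ?_
  · rw [Finset.mem_Icc, ← abs_le] at hm
    rw [norm_mul]
    gcongr
    · exact norm_linkWeight_le hm
    · exact h m
  · rw [Finset.sum_const, nsmul_eq_mul, ← mul_assoc]
    have h1 := natCast_add_one_le_two_pow n
    have h2 : ((Finset.Icc (-(n + 1 : ℕ) : ℤ) (n + 1 : ℕ)).card : ℝ) = 2 * n + 3 := by
      rw [Int.card_Icc, show ((n + 1 : ℕ) : ℤ) + 1 - -((n + 1 : ℕ) : ℤ) = (2 * n + 3 : ℕ) by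
        push_cast; ring, Int.toNat_natCast]
      push_cast
      ring
    rw [h2]
    gcongr
    linarith [(n.cast_nonneg : (0 : ℝ) ≤ n)]

theorem norm_linkPlus_le (hX : ∀ m, ‖X n m‖ ≤ B) (hX' : ∀ m, ‖X (n + 1) m‖ ≤ B')
    (hY : ∀ m, ‖Y n m‖ ≤ B) (hY' : ∀ m, ‖Y (n + 1) m‖ ≤ B') :
    ‖linkPlus X Y (n + 1) n‖ ≤ 3 * 2 ^ n * 4 ^ (n + 1) * (2 * B * B') := by
  have hB : 0 ≤ B := (norm_nonneg _).trans (hX 0)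
  have hB' : 0 ≤ B' := (norm_nonneg _).trans (hX' 0)
  refine norm_link_le fun m => (norm_sub_le _ _).trans ?_
  rw [norm_mul, norm_mul]
  calc _ ≤ B' * B + B * B' := by
        gcongr
        exacts [hX' _, hY _, hX _, hY' _]
    _ = _ := by ring

theorem norm_linkAxial_le (hX : ∀ m, ‖X n m‖ ≤ B) (hX' : ∀ m, ‖X (n + 1) m‖ ≤ B')
    (hY : ∀ m, ‖Y n m‖ ≤ B) (hY' : ∀ m, ‖Y (n + 1) m‖ ≤ B') :
    ‖linkAxial X Y (n + 1) n‖ ≤ 3 * 2 ^ n * 4 ^ (n + 1) * (2 * B * B') := by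
  have hB : 0 ≤ B := (norm_nonneg _).trans (hX 0)
  have hB' : 0 ≤ B' := (norm_nonneg _).trans (hX' 0)
  refine norm_link_le fun m => (norm_add_le _ _).trans ?_
  rw [norm_mul, norm_mul]
  calc _ ≤ B * B' + B' * B := by
        gcongr
        exacts [hX _, hY' _, hX' _, hY _]
    _ = _ := by ring

end

theorem norm_ladderForm_le (p q s : ℂ) : ‖ladderForm p q s‖ ≤ ‖p‖ + ‖q‖ + ‖s‖ := by
  refine ContinuousLinearMap.opNorm_le_bound _ (by positivity) fun v => ?_
  rw [ladderForm_apply']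
  refine (norm_add_le _ _).trans ?_
  rw [norm_div, norm_mul, Complex.norm_ofNat, Complex.norm_real]
  have h1 : ‖conj (planar v) * p + planar v * q‖ ≤ ‖v‖ * ‖p‖ + ‖v‖ * ‖q‖ := by
    refine (norm_add_le _ _).trans ?_
    rw [norm_mul, norm_mul, RCLike.norm_conj]
    gcongr <;> exact norm_planar_le v
  have h2 : ‖s‖ * ‖v 2‖ ≤ ‖s‖ * ‖v‖ := by
    gcongr
    exact (Complex.norm_real (v 2)).symm.trans_le (norm_coord_le v 2)
  have h3 : 0 ≤ ‖v‖ * ‖p‖ + ‖v‖ * ‖q‖ := by positivity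
  linarith

/-- A bound for the part of the kernel of degree greater than `n`. -/
def kernelBound (k R E q : ℝ) (n : ℕ) : ℝ :=
  5184 * k * R * E ^ 2 * (4 * q) ^ 3 * ((128 * q ^ 2) ^ n / n.factorial)

theorem tendsto_kernelBound (k R E q : ℝ) :
    Tendsto (kernelBound k R E q) atTop (𝓝 0) := by
  have := (FloorSemiring.tendsto_pow_div_factorial_atTop (128 * q ^ 2)).const_mul
    (5184 * k * R * E ^ 2 * (4 * q) ^ 3)
  rwa [mul_zero] at this

/-- Mean value inequality for the common translation by `x`, from `x = 0` to `x = -r'`. All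
translated points stay in the ball of radius `2R`, and the derivative there is only the boundary
term. -/
theorem norm_kernelSum_sub_le {k R q : ℝ} (hk : 0 < k) (hq1 : 1 ≤ q) (hq : 2 * k * (2 * R) ≤ q)
    (n : ℕ) (i j : Fin 3) {r r' : E3} (hr : ‖r‖ ≤ R) (hr' : ‖r'‖ ≤ R) :
    ‖kernelSum k (n + 1) n i j r r' - kernelSum k (n + 1) n i j (r - r') 0‖ ≤
      kernelBound k R (Real.exp (k ^ 2 * (2 * R) ^ 2)) q n := by
  set E := Real.exp (k ^ 2 * (2 * R) ^ 2) with hE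
  have hR : 0 ≤ R := (norm_nonneg r).trans hr
  -- The factor 6 counts three derivative components, each with two polarizations.
  set C := 6 * k * (3 * 2 ^ n * 4 ^ (n + 1) * (2 * waveBound E q n * waveBound E q (n + 1))) with hC
  have hbound : ∀ x ∈ Metric.closedBall (0 : E3) R,
      ‖ladderForm (boundaryPlus k (n + 1) n i j (r + x) (r' + x))
        (boundaryMinus k (n + 1) n i j (r + x) (r' + x))
        (boundaryAxial k (n + 1) n i j (r + x) (r' + x))‖ ≤ C := by
    intro x hx
    rw [mem_closedBall_zero_iff] at hx
    have h1 : ‖r + x‖ ≤ 2 * R := (norm_add_le _ _).trans (by linarith)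
    have h2 : ‖r' + x‖ ≤ 2 * R := (norm_add_le _ _).trans (by linarith)
    have e1 := fun l m => norm_te_le hk hq1 hq l m i h1
    have e2 := fun l m => norm_tm_le hk hq1 hq l m i h1
    have e3 : ∀ l m, ‖conj (te k l m j (r' + x))‖ ≤ waveBound E q l := fun l m => by
      rw [RCLike.norm_conj]
      exact norm_te_le hk hq1 hq l m j h2
    have e4 : ∀ l m, ‖conj (tm k l m j (r' + x))‖ ≤ waveBound E q l := fun l m => by
      rw [RCLike.norm_conj]
      exact norm_tm_le hk hq1 hq l m j h2
    have hk' : ‖(-k : ℂ)‖ = k := by rw [norm_neg, Complex.norm_real, Real.norm_of_nonneg hk.le]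
    set D := 3 * 2 ^ n * 4 ^ (n + 1) * (2 * waveBound E q n * waveBound E q (n + 1)) with hD
    have hp : ‖boundaryPlus k (n + 1) n i j (r + x) (r' + x)‖ ≤ k * (D + D) := by
      rw [boundaryPlus, norm_mul, hk']
      gcongr
      exact (norm_add_le _ _).trans (add_le_add
        (norm_linkPlus_le (e1 _) (e1 _) (e3 _) (e3 _)) (norm_linkPlus_le (e2 _) (e2 _) (e4 _) (e4 _)))
    have hm : ‖boundaryMinus k (n + 1) n i j (r + x) (r' + x)‖ ≤ k * (D + D) := by
      rw [boundaryMinus, norm_mul, hk']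
      gcongr
      exact (norm_add_le _ _).trans (add_le_add
        (norm_linkPlus_le (e3 _) (e3 _) (e1 _) (e1 _)) (norm_linkPlus_le (e4 _) (e4 _) (e2 _) (e2 _)))
    have hz : ‖boundaryAxial k (n + 1) n i j (r + x) (r' + x)‖ ≤ k * (D + D) := by
      rw [boundaryAxial, norm_mul, hk']
      gcongr
      exact (norm_add_le _ _).trans (add_le_add
        (norm_linkAxial_le (e1 _) (e1 _) (e3 _) (e3 _)) (norm_linkAxial_le (e2 _) (e2 _) (e4 _) (e4 _)))
    refine (norm_ladderForm_le _ _ _).trans ?_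
    rw [hC]
    linarith
  have hmvt := (convex_closedBall (0 : E3) R).norm_image_sub_le_of_norm_hasFDerivWithin_le
    (fun x _ => (hasLadder_kernelSum k (n + 1) n i j r r' n.lt_succ_self x).hasFDerivWithinAt) hbound
    (x := -r') (y := 0) (by simpa using hr') (by simpa using hR)
  rw [add_zero, add_zero, ← sub_eq_add_neg, add_neg_cancel, sub_neg_eq_add, zero_add] at hmvt
  refine hmvt.trans ?_
  have hC0 : 0 ≤ C := (norm_nonneg _).trans (hbound 0 (by simpa using hR))
  calc C * ‖r'‖ ≤ C * R := by gcongr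
    _ = 5184 * k * R * E ^ 2 * (4 * q) ^ 3 *
          ((128 * q ^ 2) ^ n / (n.factorial * (n + 1).factorial)) := by
        have e8 : (8 : ℝ) ^ n = 2 ^ n * 4 ^ n := by rw [← mul_pow]; norm_num
        have e128 : (128 : ℝ) ^ n = 2 ^ n * 4 ^ n * 4 ^ n * 4 ^ n := by
          rw [← mul_pow, ← mul_pow, ← mul_pow]; norm_num
        rw [hC, waveBound, waveBound, mul_pow 128, e128]
        simp only [mul_pow]
        field_simp
        ring
    -- Of the two factorials only `n!` is kept; it already beats the geometric factor.
    _ ≤ _ := by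
        rw [kernelBound]
        gcongr
        exact le_mul_of_one_le_right (by positivity) (by exact_mod_cast (n + 1).factorial_pos)

/-! ### The kernel with one point at the origin -/

theorem wave_origin_succ (k : ℝ) (n : ℕ) (m : ℤ) : wave k (n + 1) m 0 = 0 := by
  rw [wave, solid_succ]
  simp [planar]

theorem wave_origin_zero (k : ℝ) (m : ℤ) : wave k 0 m 0 = if m = 0 then 1 else 0 := by
  have : solid 0 m 0 = if m = 0 then 1 else 0 := rfl
  rw [wave, this]
  simp [besselEntire_zero_zero]

theorem te_origin (k : ℝ) (n : ℕ) (m : ℤ) (i : Fin 3) : te k (n + 1) m i 0 = 0 := by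
  rw [te, wave_origin_succ, wave_origin_succ, wave_origin_succ]
  fin_cases i <;> simp [cartesian]

theorem tm_origin_succ_succ (k : ℝ) (n : ℕ) (m : ℤ) (i : Fin 3) : tm k (n + 2) m i 0 = 0 := by
  have h : ∀ l, wave k (n + 2 - 1) l 0 = 0 := fun l => wave_origin_succ k n l
  have h' : ∀ l, wave k (n + 2 + 1) l 0 = 0 := fun l => wave_origin_succ k (n + 2) l
  rw [tm, tmPlus, tmMinus, tmAxial, h, h, h, h', h', h']
  fin_cases i <;> simp [cartesian]

theorem tm_origin_one (k : ℝ) (m : ℤ) (i : Fin 3) : tm k 1 m i 0 =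
    cartesian (if m = -1 then -2 / 3 else 0) (if m = 1 then 2 / 3 else 0)
      (if m = 0 then 2 / 3 else 0) i := by
  have h' : ∀ l, wave k (1 + 1) l 0 = 0 := fun l => wave_origin_succ k 1 l
  have h : ∀ l, wave k (1 - 1) l 0 = if l = 0 then 1 else 0 := fun l => wave_origin_zero k l
  rw [tm, tmPlus, tmMinus, tmAxial, h, h, h, h', h', h']
  have e1 : m + 1 = 0 ↔ m = -1 := by omega
  have e2 : m - 1 = 0 ↔ m = 1 := by omega
  rw [show (if m + 1 = 0 then (1 : ℂ) else 0) = if m = -1 then 1 else 0 from if_congr e1 rfl rfl,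
    show (if m - 1 = 0 then (1 : ℂ) else 0) = if m = 1 then 1 else 0 from if_congr e2 rfl rfl]
  congr 1 <;> split_ifs <;> norm_num

/-- At the origin only the scalar wave of degree 0 is non-zero. Among the vector waves of positive
degree, only TM of degree 1 contains it. -/
theorem kernelSum_origin (k : ℝ) (M N : ℕ) (hM : 1 ≤ M) (i j : Fin 3) (x : E3) :
    kernelSum k M (N + 1) i j x 0 = ∑ m ∈ ({-1, 0, 1} : Finset ℤ), (vecWeight 1 m : ℂ) *
      (tm k 1 m i x * conj (tm k 1 m j 0)) := by
  rw [kernelSum, Finset.sum_range_succ', Finset.sum_eq_zero, zero_add]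
  · symm
    refine (Finset.sum_subset ?_ ?_).trans (Finset.sum_congr rfl fun m _ => ?_)
    · intro m hm
      simp only [Finset.mem_insert, Finset.mem_singleton] at hm
      rw [Finset.mem_Icc]
      omega
    · intro m _ hm
      simp only [Finset.mem_insert, Finset.mem_singleton] at hm
      rw [tm_eq_zero (by rw [lt_abs]; push_cast; omega)]
      simp
    · rw [zero_add, te_origin k 0]
      simp
  · intro n _
    refine Finset.sum_eq_zero fun m _ => ?_
    rw [te_origin, tm_origin_succ_succ]
    simp

theorem vecWeight_one_zero : vecWeight 1 0 = 3 / (8 * Real.pi) := by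
  rw [vecWeight, waveWeight]
  norm_num
  field_simp
  norm_num

theorem vecWeight_one_one : vecWeight 1 1 = 3 / (4 * Real.pi) := by
  rw [vecWeight, waveWeight]
  norm_num
  field_simp
  rw [show Int.toNat 2 = 2 from rfl]
  norm_num [Nat.factorial]

theorem vecWeight_one_neg_one : vecWeight 1 (-1) = 3 / (4 * Real.pi) := by
  rw [vecWeight, waveWeight]
  norm_num
  field_simp
  rw [show Int.toNat 2 = 2 from rfl]
  norm_num [Nat.factorial]

/-- The dyad `(I + k⁻² ∇∇) D₀(k² r²)`. -/
def smoothDyadic (k : ℝ) (i j : Fin 3) (x : E3) : ℂ :=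
  (if i = j then wave k 0 0 x else 0) + 1 / (k : ℂ) ^ 2 * pderiv i (pderiv j (wave k 0 0)) x

theorem hasLadder_wave_zero (k : ℝ) (x : E3) : HasLadder (wave k 0 0)
    (-(2 * k) * wave k 1 1 x) (2 * k * wave k 1 (-1) x) (-k * wave k 1 0 x) x := by
  refine (hasLadder_wave k 0 0 x).congr_form ?_ ?_ ?_ <;> simp <;> ring

theorem hasLadder_wave_one (k : ℝ) (m : ℤ) (x : E3) : HasLadder (wave k 1 m)
    (k * (-(1 / 3) * wave k 0 (m + 1) x - (m + 3) * (m + 2) / 6 * wave k 2 (m + 1) x))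
    (k * (1 / 3 * wave k 0 (m - 1) x + (3 - m) * (2 - m) / 6 * wave k 2 (m - 1) x))
    (k * (1 / 3 * wave k 0 m x - (4 - m ^ 2) / 6 * wave k 2 m x)) x := by
  refine (hasLadder_wave k 1 m x).congr_form ?_ ?_ ?_ <;>
    simp only [Nat.cast_one, Nat.sub_self, Nat.reduceAdd] <;> ring

set_option linter.unusedSimpArgs false in
-- Both sides are combinations of scalar waves of degrees 0 and 2: on the left through the TM waves
-- of degree 1, on the right through second derivatives of the degree-0 wave. The nine components
-- are compared explicitly.
theorem kernelSum_origin_eq_smoothDyadic {k : ℝ} (hk : k ≠ 0) (M N : ℕ) (hM : 1 ≤ M) (i j : Fin 3)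
    (x : E3) : kernelSum k M (N + 1) i j x 0 = 1 / (4 * Real.pi) * smoothDyadic k i j x := by
  have hk' : (k : ℂ) ≠ 0 := by exact_mod_cast hk
  have hpi : (Real.pi : ℂ) ≠ 0 := by exact_mod_cast Real.pi_ne_zero
  have g0 : pderiv 0 (wave k 0 0) = fun x => -k * wave k 1 1 x + k * wave k 1 (-1) x := by
    funext x
    rw [(hasLadder_wave_zero k x).pderiv_zero]
    ring
  have g1 : pderiv 1 (wave k 0 0) =
      fun x => (Complex.I * k) * wave k 1 1 x + (Complex.I * k) * wave k 1 (-1) x := by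
    funext x
    rw [(hasLadder_wave_zero k x).pderiv_one]
    field_simp
    linear_combination (-1) * (wave k 1 1 x + wave k 1 (-1) x) * Complex.I_sq
  have g2 : pderiv 2 (wave k 0 0) = fun x => -k * wave k 1 0 x := by
    funext x
    rw [(hasLadder_wave_zero k x).pderiv_two]
  have L : ∀ a b y, HasLadder (fun x => a * wave k 1 1 x + b * wave k 1 (-1) x) _ _ _ y :=
    fun a b y => ((hasLadder_wave_one k 1 y).const_mul a).add ((hasLadder_wave_one k (-1) y).const_mul b)
  have L' : ∀ a y, HasLadder (fun x => a * wave k 1 0 x) _ _ _ y :=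
    fun a y => (hasLadder_wave_one k 0 y).const_mul a
  have z1 : ∀ y, wave k 0 1 y = 0 := fun y => wave_eq_zero (by norm_num) k y
  have z2 : ∀ y, wave k 0 (-1) y = 0 := fun y => wave_eq_zero (by norm_num) k y
  have z3 : ∀ y, wave k 0 2 y = 0 := fun y => wave_eq_zero (by norm_num) k y
  have z4 : ∀ y, wave k 0 (-2) y = 0 := fun y => wave_eq_zero (by norm_num) k y
  have hI : Complex.I ^ 2 = -1 := Complex.I_sq
  rw [kernelSum_origin k M N hM, smoothDyadic, Finset.sum_insert (by decide),
    Finset.sum_insert (by decide), Finset.sum_singleton, vecWeight_one_one, vecWeight_one_neg_one,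
    vecWeight_one_zero]
  have e1 : (1 : ℤ) ≠ -1 := by decide
  have e2 : (-1 : ℤ) ≠ 1 := by decide
  have e3 : (0 : ℤ) ≠ -1 := by decide
  have e4 : (-1 : ℤ) ≠ 0 := by decide
  have e5 : (0 : ℤ) ≠ 1 := by decide
  have e6 : (1 : ℤ) ≠ 0 := by decide
  simp only [tm_origin_one, if_neg e1, if_neg e2, if_neg e3, if_neg e4, if_neg e5, if_neg e6,
    if_true]
  simp only [tm, tmPlus, tmMinus, tmAxial, Nat.sub_self, Nat.reduceAdd, Int.reduceAdd,
    Int.reduceSub, Int.reduceNeg, z1, z2, z3, z4]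
  fin_cases j
  · simp only [Fin.zero_eta, g0]
    fin_cases i
    · simp only [Fin.zero_eta, (L _ _ _).pderiv_zero]
      simp [cartesian, z1, z2, z3, z4, map_ofNat]
      field_simp
      ring_nf
      try simp only [hI]
      try ring_nf
    · simp only [Fin.mk_one, (L _ _ _).pderiv_one]
      simp [cartesian, z1, z2, z3, z4, map_ofNat]
      field_simp
      ring_nf
      try simp only [hI]
      try ring_nf
    · simp only [Fin.reduceFinMk, (L _ _ _).pderiv_two]
      simp [cartesian, z1, z2, z3, z4, map_ofNat]
      field_simp
      ring_nf
      try simp only [hI]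
      try ring_nf
  · simp only [Fin.mk_one, g1]
    fin_cases i
    · simp only [Fin.zero_eta, (L _ _ _).pderiv_zero]
      simp [cartesian, z1, z2, z3, z4, map_ofNat]
      field_simp
      ring_nf
      try simp only [hI]
      try ring_nf
    · simp only [Fin.mk_one, (L _ _ _).pderiv_one]
      simp [cartesian, z1, z2, z3, z4, map_ofNat]
      field_simp
      ring_nf
      try simp only [hI]
      try ring_nf
    · simp only [Fin.reduceFinMk, (L _ _ _).pderiv_two]
      simp [cartesian, z1, z2, z3, z4, map_ofNat]
      field_simp
      ring_nf
      try simp only [hI]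
      try ring_nf
  · simp only [Fin.reduceFinMk, g2]
    fin_cases i
    · simp only [Fin.zero_eta, (L' _ _).pderiv_zero]
      simp [cartesian, z1, z2, z3, z4, map_ofNat]
      field_simp
      ring_nf
      try simp only [hI]
      try ring_nf
    · simp only [Fin.mk_one, (L' _ _).pderiv_one]
      simp [cartesian, z1, z2, z3, z4, map_ofNat]
      field_simp
      ring_nf
      try simp only [hI]
      try ring_nf
    · simp only [Fin.reduceFinMk, (L' _ _).pderiv_two]
      simp [cartesian, z1, z2, z3, z4, map_ofNat]
      field_simp
      ring_nf
      try simp only [hI]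
      try ring_nf

/-! ### The smooth anti-Hermitian part of the Green dyad -/

section smoothness

open scoped ContDiff

theorem norm_kernelSum_sub_smoothDyadic_le {k R q : ℝ} (hk : 0 < k) (hq1 : 1 ≤ q)
    (hq : 2 * k * (2 * R) ≤ q) (n : ℕ) (i j : Fin 3) {r r' : E3} (hr : ‖r‖ ≤ R) (hr' : ‖r'‖ ≤ R) :
    ‖kernelSum k (n + 2) (n + 1) i j r r' - 1 / (4 * Real.pi) * smoothDyadic k i j (r - r')‖ ≤
      kernelBound k R (Real.exp (k ^ 2 * (2 * R) ^ 2)) q (n + 1) := by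
  rw [← kernelSum_origin_eq_smoothDyadic hk.ne' (n + 2) n (by omega)]
  exact norm_kernelSum_sub_le hk hq1 hq (n + 1) i j hr hr'

theorem pderiv_comp_sub (i : Fin 3) (f : E3 → ℂ) (r' x : E3) :
    pderiv i (fun y => f (y - r')) x = pderiv i f (x - r') := by
  simp only [pderiv, lineDeriv, add_sub_right_comm]

theorem pderiv_even {f : E3 → ℂ} (hf : ∀ x, f (-x) = f x) (i : Fin 3) (x : E3) :
    pderiv i f (-x) = -pderiv i f x := by
  have h : (fun t : ℝ => f (-x + t • EuclideanSpace.single i (1 : ℝ))) =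
      fun t => (fun s : ℝ => f (x + s • EuclideanSpace.single i (1 : ℝ))) (-t) := by
    funext t
    rw [← hf]
    congr 1
    module
  simp only [pderiv, lineDeriv]
  rw [h, deriv_comp_neg (fun s : ℝ => f (x + s • EuclideanSpace.single i (1 : ℝ))), neg_zero]

theorem pderiv_odd {f : E3 → ℂ} (hf : ∀ x, f (-x) = -f x) (i : Fin 3) (x : E3) :
    pderiv i f (-x) = pderiv i f x := by
  have h : (fun t : ℝ => f (-x + t • EuclideanSpace.single i (1 : ℝ))) =
      fun t => (fun s : ℝ => -f (x + s • EuclideanSpace.single i (1 : ℝ))) (-t) := by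
    funext t
    beta_reduce
    rw [← hf]
    congr 1
    module
  simp only [pderiv, lineDeriv]
  rw [h, deriv_comp_neg (fun s : ℝ => -f (x + s • EuclideanSpace.single i (1 : ℝ))), neg_zero,
    deriv.fun_neg, neg_neg]

theorem pderiv_conj (i : Fin 3) (f : E3 → ℂ) (x : E3) :
    pderiv i (fun y => conj (f y)) x = conj (pderiv i f x) := by
  simp only [pderiv, lineDeriv]
  exact deriv.star

theorem pderiv_congr {f g : E3 → ℂ} {x : E3} (h : f =ᶠ[𝓝 x] g) (i : Fin 3) :
    pderiv i f x = pderiv i g x := h.lineDeriv_eq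

theorem pderiv_eq_fderiv {f : E3 → ℂ} {x : E3} (h : DifferentiableAt ℝ f x) (i : Fin 3) :
    pderiv i f x = fderiv ℝ f x (EuclideanSpace.single i 1) := h.lineDeriv_eq_fderiv

/-- The dyad `(I + k⁻² ∇∇) f`. -/
def dyad (k : ℝ) (f : E3 → ℂ) (i j : Fin 3) (x : E3) : ℂ :=
  (if i = j then f x else 0) + 1 / (k : ℂ) ^ 2 * pderiv i (pderiv j f) x

theorem dyadicGreen_eq_dyad (k : ℝ) (r r' : E3) (i j : Fin 3) :
    dyadicGreen k r r' i j = dyad k (scalarGreen k) i j (r - r') := by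
  simp only [dyadicGreen, dyad, pderiv_comp_sub]

theorem dyad_even {k : ℝ} {f : E3 → ℂ} (hf : ∀ x, f (-x) = f x) (i j : Fin 3) (x : E3) :
    dyad k f i j (-x) = dyad k f i j x := by
  rw [dyad, hf, pderiv_odd (pderiv_even hf j), dyad]

theorem dyad_conj (k : ℝ) (f : E3 → ℂ) (i j : Fin 3) (x : E3) :
    dyad k (fun y => conj (f y)) i j x = conj (dyad k f i j x) := by
  have h : pderiv j (fun y => conj (f y)) = fun y => conj (pderiv j f y) :=
    funext fun y => pderiv_conj j f y
  rw [dyad, h, pderiv_conj, dyad, map_add, map_mul, map_div₀, map_pow, map_one, Complex.conj_ofReal]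
  split_ifs <;> simp

section smooth
variable {f g : E3 → ℂ} {U : Set E3}

theorem contDiffOn_pderiv (hU : IsOpen U) (hf : ContDiffOn ℝ ∞ f U) (j : Fin 3) :
    ContDiffOn ℝ ∞ (pderiv j f) U := by
  have h1 : ContDiffOn ℝ ∞ (fun x => fderiv ℝ f x (EuclideanSpace.single j 1)) U :=
    (hf.fderiv_of_isOpen hU (by simp)).clm_apply contDiffOn_const
  refine h1.congr fun x hx => pderiv_eq_fderiv ?_ j
  exact (hf.contDiffAt (hU.mem_nhds hx)).differentiableAt (by simp)

theorem contDiffOn_dyad (hU : IsOpen U) (hf : ContDiffOn ℝ ∞ f U) (k : ℝ) (i j : Fin 3) :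
    ContDiffOn ℝ ∞ (dyad k f i j) U := by
  refine ContDiffOn.add ?_ (contDiffOn_const.mul
    (contDiffOn_pderiv hU (contDiffOn_pderiv hU hf j) i))
  split_ifs
  exacts [hf, contDiffOn_const]

/-- Symmetry of second derivatives; it makes the dyad a symmetric matrix, so that transposition in
the exchange of the two points is harmless. -/
theorem pderiv_comm (hU : IsOpen U) (hf : ContDiffOn ℝ ∞ f U) (i j : Fin 3) {x : E3} (hx : x ∈ U) :
    pderiv i (pderiv j f) x = pderiv j (pderiv i f) x := by
  have hfx := hf.contDiffAt (hU.mem_nhds hx)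
  have key : ∀ a b : Fin 3, pderiv a (pderiv b f) x =
      fderiv ℝ (fderiv ℝ f) x (EuclideanSpace.single a 1) (EuclideanSpace.single b 1) := by
    intro a b
    have h1 : pderiv b f =ᶠ[𝓝 x] fun y => fderiv ℝ f y (EuclideanSpace.single b 1) := by
      filter_upwards [hU.mem_nhds hx] with y hy
      exact pderiv_eq_fderiv ((hf.contDiffAt (hU.mem_nhds hy)).differentiableAt (by simp)) b
    have h2 : DifferentiableAt ℝ (fderiv ℝ f) x :=
      (hfx.fderiv_right (m := ∞) (by simp)).differentiableAt (by simp)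
    rw [pderiv_congr h1, pderiv_eq_fderiv (h2.clm_apply (differentiableAt_const _)),
      fderiv_clm_apply h2 (differentiableAt_const _)]
    simp
  rw [key, key]
  exact (hfx.isSymmSndFDerivAt (by simpa using (WithTop.coe_le_coe.2 le_top : ((2 : ℕ∞) : WithTop ℕ∞) ≤ (⊤ : ℕ∞)))).eq _ _

theorem dyad_comm (hU : IsOpen U) (hf : ContDiffOn ℝ ∞ f U) (k : ℝ) (i j : Fin 3) {x : E3}
    (hx : x ∈ U) : dyad k f i j x = dyad k f j i x := by
  rw [dyad, dyad, pderiv_comm hU hf i j hx]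
  simp only [eq_comm]

theorem dyad_add_const_mul (hU : IsOpen U) (hf : ContDiffOn ℝ ∞ f U) (hg : ContDiffOn ℝ ∞ g U)
    {h : E3 → ℂ} {c : ℂ} (he : ∀ x ∈ U, h x = f x + c * g x) (k : ℝ) (i j : Fin 3) {x : E3}
    (hx : x ∈ U) : dyad k h i j x = dyad k f i j x + c * dyad k g i j x := by
  have step : ∀ {f g h : E3 → ℂ} (hf : ContDiffOn ℝ ∞ f U) (hg : ContDiffOn ℝ ∞ g U)
      (he : ∀ x ∈ U, h x = f x + c * g x) (j : Fin 3) (x : E3) (hx : x ∈ U),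
      pderiv j h x = pderiv j f x + c * pderiv j g x := by
    intro f g h hf hg he j x hx
    have e : h =ᶠ[𝓝 x] fun x => f x + c * g x := by
      filter_upwards [hU.mem_nhds hx] with y hy using he y hy
    have hf' := (hf.contDiffAt (hU.mem_nhds hx)).differentiableAt (n := ∞) (by simp)
    have hg' := (hg.contDiffAt (hU.mem_nhds hx)).differentiableAt (n := ∞) (by simp)
    rw [pderiv_congr e, pderiv_eq_fderiv hf', pderiv_eq_fderiv hg',
      pderiv_eq_fderiv (hf'.fun_add (hg'.const_mul c))]
    rw [fderiv_fun_add hf' (hg'.const_mul c), fderiv_const_mul hg']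
    rfl
  rw [dyad, dyad, dyad, he x hx, step (contDiffOn_pderiv hU hf j) (contDiffOn_pderiv hU hg j)
    (step hf hg he j) i x hx]
  split_ifs <;> ring

end smooth

theorem contDiffOn_scalarGreen (k : ℝ) : ContDiffOn ℝ ∞ (scalarGreen k) {0}ᶜ := by
  intro x hx
  have hn : ContDiffAt ℝ ∞ (fun x : E3 => ((‖x‖ : ℝ) : ℂ)) x :=
    Complex.ofRealCLM.contDiff.contDiffAt.comp x (contDiffAt_norm ℝ hx)
  have e : scalarGreen k = fun x => Complex.exp (Complex.I * k * ‖x‖) * (4 * Real.pi * ‖x‖ : ℂ)⁻¹ :=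
    funext fun x => div_eq_mul_inv _ _
  rw [e]
  refine (ContDiffAt.mul (contDiffAt_const.mul hn).cexp
    ((contDiffAt_const.mul hn).inv ?_)).contDiffWithinAt
  have : ‖x‖ ≠ 0 := norm_ne_zero_iff.2 hx
  have hpi := Real.pi_ne_zero
  exact_mod_cast mul_ne_zero (mul_ne_zero four_ne_zero hpi) this

theorem contDiff_ladderForm {p q s : E3 → ℂ} {l : WithTop ℕ∞} (hp : ContDiff ℝ l p)
    (hq : ContDiff ℝ l q) (hs : ContDiff ℝ l s) :
    ContDiff ℝ l fun x => ladderForm (p x) (q x) (s x) := by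
  rw [contDiff_clm_apply_iff]
  intro v
  simp only [ladderForm_apply]
  fun_prop

theorem contDiff_wave (k : ℝ) (l : ℕ) : ∀ (n : ℕ) (m : ℤ), ContDiff ℝ l (wave k n m) := by
  induction l with
  | zero =>
    intro n m
    rw [Nat.cast_zero, contDiff_zero, continuous_iff_continuousAt]
    exact fun x => (hasLadder_wave k n m x).differentiableAt.continuousAt
  | succ l ih =>
    intro n m
    have h := fun x => HasFDerivAt.fderiv (hasLadder_wave k n m x)
    rw [Nat.cast_succ, contDiff_succ_iff_fderiv]
    refine ⟨fun x => (hasLadder_wave k n m x).differentiableAt, by simp, ?_⟩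
    rw [funext h]
    have := fun n m => ih n m
    refine contDiff_ladderForm ?_ ?_ ?_ <;> fun_prop

theorem contDiff_wave_zero (k : ℝ) : ContDiff ℝ ∞ (wave k 0 0) :=
  contDiff_infty.2 fun l => contDiff_wave k l 0 0

theorem scalarGreen_neg (k : ℝ) (x : E3) : scalarGreen k (-x) = scalarGreen k x := by
  rw [scalarGreen, norm_neg, scalarGreen]

/-- The cosine parts agree and the sine parts are opposite, and `sin(kρ)/(kρ)` is the degree-0
scalar wave, smooth at the origin. -/
theorem conj_scalarGreen (k : ℝ) {x : E3} (hx : x ≠ 0) : conj (scalarGreen k x) =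
    scalarGreen k x + -(Complex.I * k / (2 * Real.pi)) * wave k 0 0 x := by
  have hw : (k : ℂ) * ‖x‖ * wave k 0 0 x = Complex.sin (k * ‖x‖) := by
    have := mul_besselEntire_zero (k * ‖x‖)
    rw [mul_pow] at this
    rw [wave]
    have hs : solid 0 0 x = 1 := rfl
    rw [hs]
    norm_num
    exact_mod_cast this
  have hx' : (‖x‖ : ℂ) ≠ 0 := by exact_mod_cast norm_ne_zero_iff.2 hx
  have hpi : (Real.pi : ℂ) ≠ 0 := by exact_mod_cast Real.pi_ne_zero
  rw [scalarGreen, map_div₀, ← Complex.exp_conj]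
  simp only [map_mul, Complex.conj_I, Complex.conj_ofReal, map_ofNat]
  have e1 : -Complex.I * k * ‖x‖ = (-(k * ‖x‖)) * Complex.I := by ring
  have e2 : Complex.I * k * ‖x‖ = (k * ‖x‖) * Complex.I := by ring
  rw [e1, e2, Complex.exp_mul_I, Complex.exp_mul_I, Complex.cos_neg, Complex.sin_neg, ← hw]
  field_simp
  ring

/-- Away from the diagonal the dyad is even and symmetric, so its anti-Hermitian part is the dyad of
`2i` times the imaginary part of the scalar Green function. -/
theorem dyad_scalarGreen_sub_conj (k : ℝ) (i j : Fin 3) {x : E3} (hx : x ≠ 0) :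
    dyad k (scalarGreen k) i j x - conj (dyad k (scalarGreen k) j i (-x)) =
      Complex.I * k / (2 * Real.pi) * smoothDyadic k i j x := by
  rw [dyad_even (scalarGreen_neg k), ← dyad_conj, dyad_add_const_mul (U := {0}ᶜ)
    isOpen_compl_singleton (contDiffOn_scalarGreen k) (contDiff_wave_zero k).contDiffOn
    (fun x hx => conj_scalarGreen k hx) k j i hx,
    dyad_comm isOpen_compl_singleton (contDiffOn_scalarGreen k) k j i hx,
    dyad_comm isOpen_compl_singleton (contDiff_wave_zero k).contDiffOn k j i hx]
  rw [show smoothDyadic k i j x = dyad k (wave k 0 0) i j x from rfl]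
  ring

end smoothness

/-! ### The power as a quadratic form with a smooth kernel -/

/-- The Lebesgue measure on the ball of radius `R`. -/
abbrev ballMeasure (R : ℝ) : Measure E3 := volume.restrict (region R)

theorem measurableSet_region (R : ℝ) : MeasurableSet (region R) := Metric.isClosed_closedBall.measurableSet

instance isFiniteMeasure_ballMeasure (R : ℝ) : IsFiniteMeasure (ballMeasure R) :=
  ⟨by rw [Measure.restrict_apply_univ]; exact measure_closedBall_lt_top⟩

/-- The density `(H(r, r') J(r')) · J*(r)`. -/
def pairing (H : Fin 3 → Fin 3 → E3 × E3 → ℂ) (J : E3 → C3) (z : E3 × E3) : ℂ :=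
  ∑ i, (∑ j, H i j z * J z.2 j) * conj (J z.1 i)

theorem pairing_eq (H : Fin 3 → Fin 3 → E3 × E3 → ℂ) (J : E3 → C3) (z : E3 × E3) :
    pairing H J z = ∑ i, ∑ j, H i j z * (conj (J z.1 i) * J z.2 j) := by
  simp only [pairing, Finset.sum_mul]
  exact Finset.sum_congr rfl fun i _ => Finset.sum_congr rfl fun j _ => by ring

section
variable {R : ℝ} {J : E3 → C3}

theorem integrable_component (hJ : Integrable J (ballMeasure R)) (i : Fin 3) :
    Integrable (fun r => J r i) (ballMeasure R) :=
  (EuclideanSpace.proj i : C3 →L[ℂ] ℂ).integrable_comp hJ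

theorem ae_mem_region (R : ℝ) : ∀ᵐ z ∂(ballMeasure R).prod (ballMeasure R),
    z.1 ∈ region R ∧ z.2 ∈ region R := by
  rw [Measure.prod_restrict]
  exact ae_restrict_mem ((measurableSet_region R).prod (measurableSet_region R))

theorem integrable_product (hJ : Integrable J (ballMeasure R)) (i j : Fin 3) :
    Integrable (fun z : E3 × E3 => conj (J z.1 i) * J z.2 j)
      ((ballMeasure R).prod (ballMeasure R)) :=
  Integrable.mul_prod (Complex.conjCLE.toContinuousLinearMap.integrable_comp
    (integrable_component hJ i)) (integrable_component hJ j)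

theorem integrable_kernel_mul (hJ : Integrable J (ballMeasure R)) {K : E3 × E3 → ℂ}
    (hK : AEStronglyMeasurable K ((ballMeasure R).prod (ballMeasure R))) {C : ℝ}
    (hC : ∀ z : E3 × E3, z.1 ∈ region R → z.2 ∈ region R → ‖K z‖ ≤ C) (i j : Fin 3) :
    Integrable (fun z => K z * (conj (J z.1 i) * J z.2 j))
      ((ballMeasure R).prod (ballMeasure R)) := by
  refine (integrable_product hJ i j).bdd_mul hK (c := C) ?_
  filter_upwards [ae_mem_region R] with z hz using hC z hz.1 hz.2

theorem integrable_pairing (hJ : Integrable J (ballMeasure R)) {H : Fin 3 → Fin 3 → E3 × E3 → ℂ}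
    (hH : ∀ i j, AEStronglyMeasurable (H i j) ((ballMeasure R).prod (ballMeasure R)))
    (hC : ∀ i j, ∃ C, ∀ z : E3 × E3, z.1 ∈ region R → z.2 ∈ region R → ‖H i j z‖ ≤ C) :
    Integrable (pairing H J) ((ballMeasure R).prod (ballMeasure R)) := by
  rw [funext (pairing_eq H J)]
  refine integrable_finsetSum _ fun i _ => integrable_finsetSum _ fun j _ => ?_
  obtain ⟨C, hC⟩ := hC i j
  exact integrable_kernel_mul hJ (hH i j) hC i j

theorem exists_bound_of_continuous {K : E3 × E3 → ℂ} (hK : Continuous K) (R : ℝ) :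
    ∃ C, ∀ z : E3 × E3, z.1 ∈ region R → z.2 ∈ region R → ‖K z‖ ≤ C := by
  obtain ⟨C, hC⟩ := ((isCompact_closedBall (0 : E3) R).prod
    (isCompact_closedBall (0 : E3) R)).exists_bound_of_continuousOn hK.continuousOn
  exact ⟨C, fun z h1 h2 => hC z ⟨h1, h2⟩⟩

theorem integrable_pairing_of_continuous (hJ : Integrable J (ballMeasure R))
    {H : Fin 3 → Fin 3 → E3 × E3 → ℂ} (hH : ∀ i j, Continuous (H i j)) :
    Integrable (pairing H J) ((ballMeasure R).prod (ballMeasure R)) :=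
  integrable_pairing hJ (fun i j => (hH i j).aestronglyMeasurable)
    fun i j => exists_bound_of_continuous (hH i j) R

/-- The pairs of points at distance at least `δ`. -/
def apart (δ : ℝ) : Set (E3 × E3) := {z | δ ≤ dist z.2 z.1}

theorem measurableSet_apart (δ : ℝ) : MeasurableSet (apart δ) :=
  (isClosed_le continuous_const (continuous_snd.dist continuous_fst)).measurableSet

theorem indicator_pairing (s : Set (E3 × E3)) (H : Fin 3 → Fin 3 → E3 × E3 → ℂ) :
    s.indicator (pairing H J) = pairing (fun i j => s.indicator (H i j)) J := by
  funext z
  by_cases hz : z ∈ s <;> simp [pairing, hz]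

/-- The differences `r - r'` range over a compact set that stays away from 0, where the dyad is
continuous and hence bounded. -/
theorem integrable_pairing_green (hJ : Integrable J (ballMeasure R)) (k : ℝ) {δ : ℝ} (hδ : 0 < δ) :
    Integrable ((apart δ).indicator
      (pairing (fun i j z => dyad k (scalarGreen k) i j (z.1 - z.2)) J))
      ((ballMeasure R).prod (ballMeasure R)) := by
  rw [indicator_pairing]
  have hc : ∀ i j, ContinuousOn (dyad k (scalarGreen k) i j) {0}ᶜ := fun i j =>
    (contDiffOn_dyad isOpen_compl_singleton (contDiffOn_scalarGreen k) k i j).continuousOn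
  refine integrable_pairing hJ (fun i j => ?_) fun i j => ?_
  · have : Measurable (dyad k (scalarGreen k) i j) := measurable_of_continuousOn_compl_singleton 0 (hc i j)
    exact ((this.comp (measurable_fst.sub measurable_snd)).indicator
      (measurableSet_apart δ)).aestronglyMeasurable
  · have hK : IsCompact (Metric.closedBall (0 : E3) (2 * R) ∩ {x | δ ≤ ‖x‖}) :=
      (isCompact_closedBall _ _).inter_right (isClosed_le continuous_const continuous_norm)
    obtain ⟨C, hC⟩ := hK.exists_bound_of_continuousOn ((hc i j).mono fun x hx => by
      have : δ ≤ ‖x‖ := hx.2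
      exact norm_pos_iff.1 (hδ.trans_le this))
    refine ⟨max C 0, fun z h1 h2 => ?_⟩
    by_cases hz : z ∈ apart δ
    · rw [Set.indicator_of_mem hz]
      refine (hC _ ⟨?_, ?_⟩).trans (le_max_left _ _)
      · rw [region, mem_closedBall_zero_iff] at h1 h2
        rw [mem_closedBall_zero_iff]
        exact (norm_sub_le _ _).trans (by linarith)
      · have : δ ≤ dist z.2 z.1 := hz
        rwa [dist_comm, dist_eq_norm] at this
    · rw [Set.indicator_of_notMem hz, norm_zero]
      exact le_max_right _ _

theorem continuous_smoothDyadic (k : ℝ) (i j : Fin 3) : Continuous (smoothDyadic k i j) :=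
  continuousOn_univ.1 (contDiffOn_dyad isOpen_univ
    (contDiff_wave_zero k).contDiffOn k i j).continuousOn

theorem continuous_smoothDyadic_sub (k : ℝ) (i j : Fin 3) :
    Continuous fun z : E3 × E3 => smoothDyadic k i j (z.1 - z.2) :=
  (continuous_smoothDyadic k i j).comp (continuous_fst.sub continuous_snd)

theorem pairing_green_sub_conj (k : ℝ) {z : E3 × E3} (hz : z.1 ≠ z.2) :
    pairing (fun i j z => dyad k (scalarGreen k) i j (z.1 - z.2)) J z -
      conj (pairing (fun i j z => dyad k (scalarGreen k) i j (z.1 - z.2)) J z.swap) =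
    Complex.I * k / (2 * Real.pi) * pairing (fun i j z => smoothDyadic k i j (z.1 - z.2)) J z := by
  rw [pairing_eq, pairing_eq, pairing_eq, map_sum, Finset.mul_sum]
  simp only [map_sum]
  rw [Finset.sum_comm (f := fun i j => conj _), ← Finset.sum_sub_distrib]
  refine Finset.sum_congr rfl fun i _ => ?_
  rw [← Finset.sum_sub_distrib, Finset.mul_sum]
  refine Finset.sum_congr rfl fun j _ => ?_
  have h := dyad_scalarGreen_sub_conj k i j (sub_ne_zero.2 hz)
  rw [neg_sub] at h
  simp only [Prod.fst_swap, Prod.snd_swap, map_mul, Complex.conj_conj]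
  linear_combination conj (J z.1 i) * J z.2 j * h

/-- The power is proportional to the imaginary part of the double integral. Exchanging the variables
in the conjugate integral, allowed because the excluded set is symmetric, replaces the kernel by its
anti-Hermitian part. The identity is exact for each `δ`. -/
theorem truncatedPower_eq (hJ : Integrable J (ballMeasure R)) (ω μ k : ℝ) {δ : ℝ} (hδ : 0 < δ) :
    (truncatedPower ω μ k R J δ : ℂ) = ω * μ * k / (8 * Real.pi) *
      ∫ z, (apart δ).indicator (pairing (fun i j z => smoothDyadic k i j (z.1 - z.2)) J) z
        ∂(ballMeasure R).prod (ballMeasure R) := by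
  set Q := (apart δ).indicator (pairing (fun i j z => dyad k (scalarGreen k) i j (z.1 - z.2)) J)
    with hQ
  have hint := integrable_pairing_green hJ k hδ
  rw [← hQ] at hint
  have h1 : (∫ r in region R, ∫ r' in region R \ Metric.ball r δ,
      ∑ i, (∑ j, dyadicGreen k r r' i j * J r' j) * conj (J r i)) =
      ∫ z, Q z ∂(ballMeasure R).prod (ballMeasure R) := by
    rw [integral_prod _ hint]
    refine integral_congr_ae (Eventually.of_forall fun r => ?_)
    have e : (fun r' => Q (r, r')) = (Metric.ball r δ)ᶜ.indicator fun r' =>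
        ∑ i, (∑ j, dyadicGreen k r r' i j * J r' j) * conj (J r i) := by
      funext r'
      simp only [dyadicGreen_eq_dyad]
      by_cases h : δ ≤ dist r' r
      · rw [Set.indicator_of_mem (by simpa using h), hQ,
          Set.indicator_of_mem (show (r, r') ∈ apart δ from h)]
        rfl
      · rw [Set.indicator_of_notMem (by simpa using h), hQ,
          Set.indicator_of_notMem (show (r, r') ∉ apart δ from h)]
    beta_reduce
    rw [e, integral_indicator Metric.isOpen_ball.measurableSet.compl,
      Measure.restrict_restrict Metric.isOpen_ball.measurableSet.compl, Set.sdiff_eq, Set.inter_comm]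
  have h2 : conj (∫ z, Q z ∂(ballMeasure R).prod (ballMeasure R)) =
      ∫ z, conj (Q z.swap) ∂(ballMeasure R).prod (ballMeasure R) := by
    rw [← integral_conj, ← integral_prod_swap]
  have hint' : Integrable (fun z : E3 × E3 => conj (Q z.swap))
      ((ballMeasure R).prod (ballMeasure R)) :=
    Complex.conjCLE.toContinuousLinearMap.integrable_comp hint.swap
  have h3 : (∫ z, Q z ∂(ballMeasure R).prod (ballMeasure R)) -
      conj (∫ z, Q z ∂(ballMeasure R).prod (ballMeasure R)) = Complex.I * k / (2 * Real.pi) *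
      ∫ z, (apart δ).indicator (pairing (fun i j z => smoothDyadic k i j (z.1 - z.2)) J) z
        ∂(ballMeasure R).prod (ballMeasure R) := by
    rw [h2, ← integral_sub hint hint', ← integral_const_mul]
    refine integral_congr_ae (Eventually.of_forall fun z => ?_)
    beta_reduce
    by_cases hz : z ∈ apart δ
    · have hz' : z.swap ∈ apart δ := by
        have : δ ≤ dist z.2 z.1 := hz
        rwa [dist_comm] at this
      have hne : z.1 ≠ z.2 := by
        have : δ ≤ dist z.2 z.1 := hz
        exact fun h => absurd this (by rw [h, dist_self]; exact not_le.2 hδ)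
      rw [hQ, Set.indicator_of_mem hz, Set.indicator_of_mem hz', Set.indicator_of_mem hz]
      exact pairing_green_sub_conj k hne
    · have hz' : z.swap ∉ apart δ := by
        intro h
        have : δ ≤ dist z.1 z.2 := h
        rw [dist_comm] at this
        exact hz this
      rw [hQ, Set.indicator_of_notMem hz, Set.indicator_of_notMem hz', Set.indicator_of_notMem hz]
      simp
  rw [truncatedPower, h1]
  set I := ∫ z, Q z ∂(ballMeasure R).prod (ballMeasure R)
  set S := ∫ z, (apart δ).indicator (pairing (fun i j z => smoothDyadic k i j (z.1 - z.2)) J) z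
        ∂(ballMeasure R).prod (ballMeasure R)
  rw [Complex.sub_conj] at h3
  have hre : (Complex.I * ω * μ * I).re = -(ω * μ * I.im) := by
    simp [mul_assoc]
  have hpi : (Real.pi : ℂ) ≠ 0 := by exact_mod_cast Real.pi_ne_zero
  have h4 : (I.im : ℂ) = k / (4 * Real.pi) * S := by
    have h5 : (2 * Complex.I) * (I.im : ℂ) = (2 * Complex.I) * (k / (4 * Real.pi) * S) := by
      push_cast at h3
      rw [mul_comm (2 * Complex.I), ← mul_assoc, mul_comm _ (2 : ℂ), h3]
      field_simp
      ring
    exact mul_left_cancel₀ (mul_ne_zero two_ne_zero Complex.I_ne_zero) h5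
  rw [hre]
  push_cast
  rw [h4]
  field_simp
  ring

theorem tendsto_integral_apart {F : E3 × E3 → ℂ}
    (hF : Integrable F ((ballMeasure R).prod (ballMeasure R))) :
    Tendsto (fun δ => ∫ z, (apart δ).indicator F z ∂(ballMeasure R).prod (ballMeasure R))
      (𝓝[>] (0 : ℝ)) (𝓝 (∫ z, F z ∂(ballMeasure R).prod (ballMeasure R))) := by
  refine tendsto_integral_filter_of_dominated_convergence (fun z => ‖F z‖) ?_ ?_ hF.norm ?_
  · exact Eventually.of_forall fun δ => (hF.indicator (measurableSet_apart δ)).aestronglyMeasurable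
  · exact Eventually.of_forall fun δ => Eventually.of_forall fun z => norm_indicator_le_norm_self _ _
  -- The diagonal is a null set, and each point off it lies in the truncated domain once `δ` is at
  -- most the distance of its two components.
  · have hne : ∀ᵐ z ∂(ballMeasure R).prod (ballMeasure R), z.2 ≠ z.1 := by
      have hm : MeasurableSet {z : E3 × E3 | z.2 ≠ z.1} :=
        (isOpen_ne_fun continuous_snd continuous_fst).measurableSet
      rw [Measure.ae_prod_iff_ae_ae hm]
      refine Eventually.of_forall fun r => ?_
      rw [ae_iff]
      simp
    filter_upwards [hne] with z hz
    refine tendsto_const_nhds.congr' ?_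
    filter_upwards [Ioc_mem_nhdsGT (dist_pos.2 hz)] with δ hδ
    rw [Set.indicator_of_mem (show z ∈ apart δ from hδ.2)]

end

/-! ### Expansion of the power in vector waves -/

/-- The coefficient of the current density `J` in the vector wave `f`. -/
def waveCoeff (R : ℝ) (J : E3 → C3) (f : Fin 3 → E3 → ℂ) : ℂ :=
  ∫ r in region R, ∑ i, J r i * conj (f i r)

theorem continuous_te (k : ℝ) (n : ℕ) (m : ℤ) (i : Fin 3) : Continuous (te k (n + 1) m i) :=
  continuous_iff_continuousAt.2 fun r => (hasLadder_te k n m r i).differentiableAt.continuousAt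

theorem continuous_tm (k : ℝ) (n : ℕ) (m : ℤ) (i : Fin 3) : Continuous (tm k (n + 1) m i) :=
  continuous_iff_continuousAt.2 fun r => (hasLadder_tm k n m r i).differentiableAt.continuousAt

theorem continuous_kernelSum (k : ℝ) (M N : ℕ) (i j : Fin 3) :
    Continuous fun z : E3 × E3 => kernelSum k M N i j z.1 z.2 := by
  unfold kernelSum
  refine continuous_finsetSum _ fun n _ => continuous_finsetSum _ fun m _ =>
    continuous_const.mul (.add ?_ ?_)
  · exact ((continuous_te k n m i).comp continuous_fst).mul
      (Complex.continuous_conj.comp ((continuous_te k n m j).comp continuous_snd))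
  · exact ((continuous_tm k n m i).comp continuous_fst).mul
      (Complex.continuous_conj.comp ((continuous_tm k n m j).comp continuous_snd))

section
variable {R : ℝ} {J : E3 → C3}

/-- A rank-one kernel turns the double integral into the product of a coefficient and its conjugate.
-/
theorem integral_pairing_product (f : Fin 3 → E3 → ℂ) :
    ∫ z, pairing (fun i j z => f i z.1 * conj (f j z.2)) J z ∂(ballMeasure R).prod (ballMeasure R) =
      (‖waveCoeff R J f‖ ^ 2 : ℝ) := by
  have h : ∀ z : E3 × E3, pairing (fun i j z => f i z.1 * conj (f j z.2)) J z =
      conj (∑ i, J z.1 i * conj (f i z.1)) * ∑ j, J z.2 j * conj (f j z.2) := by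
    intro z
    rw [pairing_eq, map_sum, Finset.sum_mul_sum]
    refine Finset.sum_congr rfl fun i _ => Finset.sum_congr rfl fun j _ => ?_
    simp only [map_mul, Complex.conj_conj]
    ring
  simp only [h]
  rw [integral_prod_mul (fun r => conj (∑ i, J r i * conj (f i r)))
    fun r => ∑ i, J r i * conj (f i r), integral_conj, mul_comm, Complex.mul_conj,
    Complex.normSq_eq_norm_sq, waveCoeff]

/-- The contribution to the power of the modes of degree at most `N`. -/
def modeSum (k R : ℝ) (J : E3 → C3) (M N : ℕ) : ℝ :=
  ∑ n ∈ Finset.range N, ∑ m ∈ Finset.Icc (-M : ℤ) M, vecWeight (n + 1) m *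
    (‖waveCoeff R J (te k (n + 1) m)‖ ^ 2 + ‖waveCoeff R J (tm k (n + 1) m)‖ ^ 2)

theorem integral_pairing_kernelSum (hJ : Integrable J (ballMeasure R)) (k : ℝ) (M N : ℕ) :
    ∫ z, pairing (fun i j z => kernelSum k M N i j z.1 z.2) J z
      ∂(ballMeasure R).prod (ballMeasure R) = modeSum k R J M N := by
  set E : ℕ → ℤ → E3 × E3 → ℂ := fun n m =>
    pairing (fun i j z => te k (n + 1) m i z.1 * conj (te k (n + 1) m j z.2)) J with hE
  set B : ℕ → ℤ → E3 × E3 → ℂ := fun n m =>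
    pairing (fun i j z => tm k (n + 1) m i z.1 * conj (tm k (n + 1) m j z.2)) J with hB
  have hEi : ∀ n m, Integrable (E n m) ((ballMeasure R).prod (ballMeasure R)) := fun n m =>
    integrable_pairing_of_continuous hJ fun i j =>
      ((continuous_te k n m i).comp continuous_fst).mul
        (Complex.continuous_conj.comp ((continuous_te k n m j).comp continuous_snd))
  have hBi : ∀ n m, Integrable (B n m) ((ballMeasure R).prod (ballMeasure R)) := fun n m =>
    integrable_pairing_of_continuous hJ fun i j =>
      ((continuous_tm k n m i).comp continuous_fst).mul
        (Complex.continuous_conj.comp ((continuous_tm k n m j).comp continuous_snd))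
  have h : ∀ z, pairing (fun i j z => kernelSum k M N i j z.1 z.2) J z =
      ∑ n ∈ Finset.range N, ∑ m ∈ Finset.Icc (-M : ℤ) M,
        (vecWeight (n + 1) m : ℂ) * (E n m z + B n m z) := by
    intro z
    simp only [hE, hB, pairing_eq, kernelSum]
    simp only [Finset.sum_mul, ← Finset.sum_add_distrib, Finset.mul_sum]
    rw [Finset.sum_congr rfl fun i _ => Finset.sum_comm, Finset.sum_comm]
    refine Finset.sum_congr rfl fun n _ => ?_
    rw [Finset.sum_congr rfl fun i _ => Finset.sum_comm, Finset.sum_comm]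
    refine Finset.sum_congr rfl fun m _ => Finset.sum_congr rfl fun i _ =>
      Finset.sum_congr rfl fun j _ => ?_
    ring
  simp only [h]
  have hi : ∀ n m, Integrable (fun z => (vecWeight (n + 1) m : ℂ) * (E n m z + B n m z))
      ((ballMeasure R).prod (ballMeasure R)) := fun n m => ((hEi n m).add (hBi n m)).const_mul _
  rw [integral_finsetSum _ fun n _ => integrable_finsetSum _ fun m _ => hi n m, modeSum]
  push_cast
  refine Finset.sum_congr rfl fun n _ => ?_
  rw [integral_finsetSum _ fun m _ => hi n m]
  refine Finset.sum_congr rfl fun m _ => ?_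
  rw [integral_const_mul, integral_add (hEi n m) (hBi n m), hE, hB, integral_pairing_product,
    integral_pairing_product]
  push_cast
  rfl

/-- The truncated kernels converge uniformly on the ball and the product of current components is
integrable on pairs, so the double integrals converge. -/
theorem tendsto_modeSum (hJ : Integrable J (ballMeasure R)) {k : ℝ} (hk : 0 < k) :
    Tendsto (fun n => (modeSum k R J (n + 2) (n + 1) : ℂ)) atTop
      (𝓝 (1 / (4 * Real.pi) * ∫ z, pairing (fun i j z => smoothDyadic k i j (z.1 - z.2)) J z
        ∂(ballMeasure R).prod (ballMeasure R))) := by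
  -- The smallest value that meets both conditions of the wave bounds on the ball of radius `2R`.
  set q := max 1 (2 * k * (2 * R)) with hq
  have hpi := Real.pi_ne_zero
  simp only [← integral_pairing_kernelSum hJ]
  rw [← integral_const_mul, tendsto_iff_norm_sub_tendsto_zero]
  set G := fun z : E3 × E3 => ∑ i : Fin 3, ∑ j : Fin 3, ‖conj (J z.1 i) * J z.2 j‖ with hG
  have hGi : Integrable G ((ballMeasure R).prod (ballMeasure R)) :=
    integrable_finsetSum _ fun i _ => integrable_finsetSum _ fun j _ => (integrable_product hJ i j).norm
  set b := fun n => kernelBound k R (Real.exp (k ^ 2 * (2 * R) ^ 2)) q (n + 1) with hb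
  have hb0 : Tendsto b atTop (𝓝 0) := (tendsto_kernelBound _ _ _ _).comp (tendsto_add_atTop_nat 1)
  refine squeeze_zero (fun _ => norm_nonneg _) (g := fun n => b n * ∫ z, G z
    ∂(ballMeasure R).prod (ballMeasure R)) (fun n => ?_) ?_
  · rw [← integral_sub (integrable_pairing_of_continuous hJ fun i j => continuous_kernelSum k _ _ i j)
      ((integrable_pairing_of_continuous hJ fun i j => continuous_smoothDyadic_sub k i j).const_mul _),
      ← integral_const_mul]
    refine norm_integral_le_of_norm_le (hGi.const_mul _) ?_
    filter_upwards [ae_mem_region R] with z hz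
    rw [region, mem_closedBall_zero_iff, mem_closedBall_zero_iff] at hz
    rw [pairing_eq, pairing_eq, Finset.mul_sum, ← Finset.sum_sub_distrib, hG, Finset.mul_sum]
    refine norm_sum_le_of_le _ fun i _ => ?_
    rw [Finset.mul_sum, Finset.mul_sum, ← Finset.sum_sub_distrib]
    refine norm_sum_le_of_le _ fun j _ => ?_
    rw [← mul_assoc (1 / (4 * Real.pi) : ℂ), ← sub_mul, norm_mul]
    gcongr
    exact norm_kernelSum_sub_smoothDyadic_le hk (le_max_left _ _) (le_max_right _ _) n i j hz.1 hz.2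
  · simpa using hb0.mul_const (∫ z, G z ∂(ballMeasure R).prod (ballMeasure R))

/-- The power is the limit of the contributions of the modes of bounded degree. -/
theorem exists_tendsto_truncatedPower (hJ : Integrable J (ballMeasure R)) (ω μ : ℝ) {k : ℝ}
    (hk : 0 < k) : ∃ P : ℝ, Tendsto (truncatedPower ω μ k R J) (𝓝[>] (0 : ℝ)) (𝓝 P) ∧
      Tendsto (fun n => ω * μ * k / 2 * modeSum k R J (n + 2) (n + 1)) atTop (𝓝 P) := by
  set S := ∫ z, pairing (fun i j z => smoothDyadic k i j (z.1 - z.2)) J z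
        ∂(ballMeasure R).prod (ballMeasure R) with hS
  have hpi : (Real.pi : ℂ) ≠ 0 := by exact_mod_cast Real.pi_ne_zero
  have h1 : Tendsto (fun δ => (truncatedPower ω μ k R J δ : ℂ)) (𝓝[>] (0 : ℝ))
      (𝓝 (ω * μ * k / (8 * Real.pi) * S)) := by
    refine ((tendsto_integral_apart (integrable_pairing_of_continuous hJ
      fun i j => continuous_smoothDyadic_sub k i j)).const_mul _).congr' ?_
    filter_upwards [self_mem_nhdsWithin] with δ hδ
    exact (truncatedPower_eq hJ ω μ k hδ).symm
  have h2 := (tendsto_modeSum hJ hk).const_mul (ω * μ * k / 2 : ℂ)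
  have e : (ω * μ * k / 2 : ℂ) * (1 / (4 * Real.pi) * S) = ω * μ * k / (8 * Real.pi) * S := by
    field_simp
    ring
  rw [← hS, e] at h2
  refine ⟨(ω * μ * k / (8 * Real.pi) * S : ℂ).re, ?_, ?_⟩
  · exact (Complex.continuous_re.tendsto _).comp h1
  · refine ((Complex.continuous_re.tendsto _).comp h2).congr fun n => ?_
    rw [Function.comp_apply, ← Complex.ofReal_re (ω * μ * k / 2 * modeSum k R J (n + 2) (n + 1))]
    push_cast
    rfl

end

/-! ### Rotation invariance of integrals over the ball -/

/-- The unit vector of the `i`-th coordinate axis. -/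
abbrev axis (i : Fin 3) : E3 := EuclideanSpace.single i 1

/-- The rotation by the angle `θ` in the plane of the coordinates `a` and `b`, as a linear map. -/
def rotationMap (a b : Fin 3) (θ : ℝ) : E3 →ₗ[ℝ] E3 :=
  IsLinearMap.mk' (fun r => r + ((Real.cos θ - 1) * r a - Real.sin θ * r b) • axis a +
    (Real.sin θ * r a + (Real.cos θ - 1) * r b) • axis b)
    ⟨fun x y => by simp only [PiLp.add_apply]; module,
     fun t x => by simp only [PiLp.smul_apply, smul_eq_mul]; module⟩

theorem rotationMap_apply (a b : Fin 3) (θ : ℝ) (r : E3) : rotationMap a b θ r =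
    r + ((Real.cos θ - 1) * r a - Real.sin θ * r b) • axis a +
      (Real.sin θ * r a + (Real.cos θ - 1) * r b) • axis b := rfl

theorem norm_rotationMap {a b : Fin 3} (hab : a ≠ b) (θ : ℝ) (r : E3) :
    ‖rotationMap a b θ r‖ = ‖r‖ := by
  have h : ‖rotationMap a b θ r‖ ^ 2 = ‖r‖ ^ 2 := by
    rw [EuclideanSpace.real_norm_sq_eq, EuclideanSpace.real_norm_sq_eq, Fin.sum_univ_three,
      Fin.sum_univ_three]
    have := Real.sin_sq_add_cos_sq θ
    have key : ∀ x y : ℝ, (x + ((Real.cos θ - 1) * x - Real.sin θ * y)) ^ 2 +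
        (y + (Real.sin θ * x + (Real.cos θ - 1) * y)) ^ 2 = x ^ 2 + y ^ 2 := fun x y => by
      linear_combination (x ^ 2 + y ^ 2) * this
    have hk := key (r a) (r b)
    fin_cases a <;> fin_cases b <;> first | exact absurd rfl hab | skip
    all_goals
      simp [rotationMap_apply] at hk ⊢
      linarith
  exact (sq_eq_sq₀ (norm_nonneg _) (norm_nonneg _)).1 h

/-- The rotation by the angle `θ` in the plane of the coordinates `a` and `b`. -/
def rotation {a b : Fin 3} (hab : a ≠ b) (θ : ℝ) : E3 ≃ₗᵢ[ℝ] E3 :=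
  LinearIsometry.toLinearIsometryEquiv ⟨rotationMap a b θ, norm_rotationMap hab θ⟩ rfl

theorem rotation_apply {a b : Fin 3} (hab : a ≠ b) (θ : ℝ) (r : E3) :
    rotation hab θ r = rotationMap a b θ r := rfl

theorem integral_comp_isometry (R : ℝ) (e : E3 ≃ₗᵢ[ℝ] E3) (F : E3 → ℂ) :
    ∫ r in region R, F (e r) = ∫ r in region R, F r := by
  have h := (e.measurePreserving.restrict_preimage (measurableSet_region R)).integral_comp
    e.toHomeomorph.measurableEmbedding F
  rwa [show e ⁻¹' region R = region R by ext r; simp [region]] at h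

theorem hasDerivAt_rotationMap (a b : Fin 3) (r : E3) (θ : ℝ) :
    HasDerivAt (fun θ => rotationMap a b θ r)
      ((-Real.sin θ * r a - Real.cos θ * r b) • axis a +
        (Real.cos θ * r a + -Real.sin θ * r b) • axis b) θ := by
  simp only [rotationMap_apply]
  exact (((((Real.hasDerivAt_cos θ).sub_const 1).mul_const (r a)).sub
    ((Real.hasDerivAt_sin θ).mul_const (r b))).smul_const (axis a) |>.const_add r).add
    ((((Real.hasDerivAt_sin θ).mul_const (r a)).add
    (((Real.hasDerivAt_cos θ).sub_const 1).mul_const (r b))).smul_const (axis b))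

theorem norm_rotation_velocity_le (a b : Fin 3) (r : E3) (θ : ℝ) :
    ‖(-Real.sin θ * r a - Real.cos θ * r b) • axis a +
        (Real.cos θ * r a + -Real.sin θ * r b) • axis b‖ ≤ 4 * ‖r‖ := by
  have ha : |r a| ≤ ‖r‖ := PiLp.norm_apply_le r a
  have hb : |r b| ≤ ‖r‖ := PiLp.norm_apply_le r b
  have hs := Real.abs_sin_le_one θ
  have hc := Real.abs_cos_le_one θ
  have m1 : |Real.sin θ * r a| ≤ 1 * ‖r‖ := by rw [abs_mul]; gcongr
  have m2 : |Real.cos θ * r b| ≤ 1 * ‖r‖ := by rw [abs_mul]; gcongr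
  have m3 : |Real.cos θ * r a| ≤ 1 * ‖r‖ := by rw [abs_mul]; gcongr
  have m4 : |Real.sin θ * r b| ≤ 1 * ‖r‖ := by rw [abs_mul]; gcongr
  refine (norm_add_le _ _).trans ?_
  rw [norm_smul, norm_smul, PiLp.norm_single, PiLp.norm_single, norm_one,
    mul_one, mul_one, Real.norm_eq_abs, Real.norm_eq_abs]
  have h1 := abs_sub (-Real.sin θ * r a) (Real.cos θ * r b)
  have h2 := abs_add_le (Real.cos θ * r a) (-Real.sin θ * r b)
  rw [neg_mul, abs_neg] at h1 h2
  rw [neg_mul, neg_mul]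
  linarith

/-- The integral of the derivative of a field along a rotation vanishes. -/
theorem integral_rotation_generator {F : E3 → ℂ} (hF : ContDiff ℝ 1 F) {c : ℝ → ℝ}
    (hc : Continuous c) (R : ℝ) {a b : Fin 3} (hab : a ≠ b) :
    ∫ r in region R, (c (‖r‖ ^ 2) : ℂ) * fderiv ℝ F r (r a • axis b - r b • axis a) = 0 := by
  have hFc : Continuous F := hF.continuous
  have hF' : Continuous (fderiv ℝ F) := hF.continuous_fderiv (by simp)
  have hcn : Continuous fun r : E3 => (c (‖r‖ ^ 2) : ℂ) := by fun_prop
  obtain ⟨C₁, hC₁⟩ := (isCompact_closedBall (0 : E3) R).exists_bound_of_continuousOn hcn.continuousOn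
  obtain ⟨C₂, hC₂⟩ := (isCompact_closedBall (0 : E3) R).exists_bound_of_continuousOn hF'.continuousOn
  set vel : ℝ → E3 → E3 := fun θ r => (-Real.sin θ * r a - Real.cos θ * r b) • axis a +
        (Real.cos θ * r a + -Real.sin θ * r b) • axis b with hvel
  set G : ℝ → E3 → ℂ := fun θ r => (c (‖r‖ ^ 2) : ℂ) * F (rotationMap a b θ r) with hG
  set G' : ℝ → E3 → ℂ := fun θ r => (c (‖r‖ ^ 2) : ℂ) * fderiv ℝ F (rotationMap a b θ r) (vel θ r)
    with hG'
  have hcont : ∀ θ, Continuous (rotationMap a b θ) := fun θ =>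
    (rotationMap a b θ).continuous_of_finiteDimensional
  have hGc : ∀ θ, Continuous (G θ) := fun θ => hcn.mul (hFc.comp (hcont θ))
  have hG'c : ∀ θ, Continuous (G' θ) := fun θ =>
    hcn.mul ((hF'.comp (hcont θ)).clm_apply (by simp only [hvel]; fun_prop))
  have key := hasDerivAt_integral_of_dominated_loc_of_deriv_le (μ := ballMeasure R) (F := G)
    (F' := G') (x₀ := 0) (s := Set.univ) (bound := fun _ => C₁ * (C₂ * (4 * R))) univ_mem
    (Eventually.of_forall fun θ => (hGc θ).aestronglyMeasurable)
    ((hGc 0).continuousOn.integrableOn_compact (isCompact_closedBall _ _))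
    (hG'c 0).aestronglyMeasurable ?_ (integrable_const _) ?_
  -- A rotation preserves the ball and the radial weight, so the integral does not depend on the
  -- angle and its derivative at angle 0 is zero.
  · have hconst : (fun θ => ∫ r in region R, G θ r) = fun _ => ∫ r in region R, G 0 r := by
      have : ∀ θ, ∫ r in region R, G θ r = ∫ r in region R, (c (‖r‖ ^ 2) : ℂ) * F r := by
        intro θ
        refine Eq.trans ?_ (integral_comp_isometry R (rotation hab θ) fun r => (c (‖r‖ ^ 2) : ℂ) * F r)
        refine integral_congr_ae (Eventually.of_forall fun r => ?_)
        simp only [hG, rotation_apply, norm_rotationMap hab]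
      funext θ
      rw [this, this]
    have h2 := key.2
    rw [hconst] at h2
    have h3 := h2.unique (hasDerivAt_const _ _)
    rw [← h3]
    refine integral_congr_ae (Eventually.of_forall fun r => ?_)
    simp only [hG', hvel, rotationMap_apply, Real.sin_zero, Real.cos_zero]
    congr 2
    · simp
    · module
  · filter_upwards [ae_restrict_mem (measurableSet_region R)] with r hr θ _
    have hr' : ‖r‖ ≤ R := by simpa [region] using hr
    have h1 := hC₁ r hr
    have h2 := hC₂ (rotationMap a b θ r) (by simpa [norm_rotationMap hab] using hr')
    rw [hG', norm_mul]
    have h3 : ‖vel θ r‖ ≤ 4 * R := (norm_rotation_velocity_le a b r θ).trans (by linarith)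
    have h4 : 0 ≤ C₁ := (norm_nonneg _).trans h1
    have h5 : 0 ≤ C₂ := (norm_nonneg _).trans h2
    gcongr
    refine (ContinuousLinearMap.le_opNorm _ _).trans ?_
    gcongr
  · refine Eventually.of_forall fun r θ _ => ?_
    have h1 := ((hF.differentiable (by simp)) (rotationMap a b θ r)).hasFDerivAt
    exact (h1.comp_hasDerivAt θ (hasDerivAt_rotationMap a b r θ)).const_mul _

theorem HasLadder.fderiv_apply {F : E3 → ℂ} {p q s : ℂ} {r : E3} (h : HasLadder F p q s r) (v : E3) :
    fderiv ℝ F r v = ladderForm p q s v := by rw [HasFDerivAt.fderiv h]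

theorem contDiff_solid (l : ℕ) : ∀ (n : ℕ) (m : ℤ), ContDiff ℝ l (solid n m) := by
  induction l with
  | zero =>
    intro n m
    rw [Nat.cast_zero, contDiff_zero, continuous_iff_continuousAt]
    exact fun x => (hasLadder_solid n x m).differentiableAt.continuousAt
  | succ l ih =>
    intro n m
    have h := fun x => HasFDerivAt.fderiv (hasLadder_solid n x m)
    rw [Nat.cast_succ, contDiff_succ_iff_fderiv]
    refine ⟨fun x => (hasLadder_solid n x m).differentiableAt, by simp, ?_⟩
    rw [funext h]
    have := fun n m => ih n m
    refine contDiff_ladderForm ?_ ?_ ?_ <;> fun_prop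

theorem continuous_solid (n : ℕ) (m : ℤ) : Continuous (solid n m) := (contDiff_solid 0 n m).continuous

/-- The derivative along `Λ_x + i Λ_y`, up to a factor, of a field has vanishing integral. -/
theorem integral_raising_generator {F : E3 → ℂ} (hF : ContDiff ℝ 1 F) {p q s : E3 → ℂ}
    (h : ∀ r, HasLadder F (p r) (q r) (s r) r) {c : ℝ → ℝ} (hc : Continuous c) (R : ℝ) :
    ∫ r in region R, (c (‖r‖ ^ 2) : ℂ) * (planar r * s r - r 2 * p r) = 0 := by
  have hcn : Continuous fun r : E3 => (c (‖r‖ ^ 2) : ℂ) := by fun_prop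
  have hF' : Continuous (fderiv ℝ F) := hF.continuous_fderiv (by simp)
  have hint : ∀ a b : Fin 3, IntegrableOn
      (fun r => (c (‖r‖ ^ 2) : ℂ) * fderiv ℝ F r (r a • axis b - r b • axis a)) (region R) :=
    fun a b => (hcn.mul (hF'.clm_apply (by fun_prop))).continuousOn.integrableOn_compact
      (isCompact_closedBall _ _)
  have h0 := integral_rotation_generator hF hc R (a := 0) (b := 2) (by decide)
  have h1 := integral_rotation_generator hF hc R (a := 1) (b := 2) (by decide)
  have e : ∀ r, (c (‖r‖ ^ 2) : ℂ) * (planar r * s r - r 2 * p r) =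
      (c (‖r‖ ^ 2) : ℂ) * fderiv ℝ F r (r 0 • axis 2 - r 2 • axis 0) +
      Complex.I * ((c (‖r‖ ^ 2) : ℂ) * fderiv ℝ F r (r 1 • axis 2 - r 2 • axis 1)) := by
    intro r
    rw [(h r).fderiv_apply, (h r).fderiv_apply, ladderForm_apply, ladderForm_apply, planar]
    simp
    field_simp
    ring
  simp only [e]
  rw [integral_add (hint 0 2) ((hint 1 2).const_mul _), integral_const_mul, h0, h1, mul_zero, add_zero]

/-! ### Orthogonality and norms of solid harmonics -/

/-- The radially weighted inner product of solid harmonics over the ball. -/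
def solidInner (R : ℝ) (c : ℝ → ℝ) (n n' : ℕ) (m : ℤ) : ℂ :=
  ∫ r in region R, (c (‖r‖ ^ 2) : ℂ) * (solid n m r * conj (solid n' m r))

section
variable (R : ℝ) {c : ℝ → ℝ}

theorem integrable_solid_mul (hc : Continuous c) (n n' : ℕ) (m m' : ℤ) : IntegrableOn
    (fun r : E3 => (c (‖r‖ ^ 2) : ℂ) * (solid n m r * conj (solid n' m' r))) (region R) := by
  have := continuous_solid n m
  have := continuous_solid n' m'
  exact (Continuous.continuousOn (by fun_prop)).integrableOn_compact (isCompact_closedBall _ _)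

theorem conj_solidInner (c : ℝ → ℝ) (n n' : ℕ) (m : ℤ) :
    conj (solidInner R c n n' m) = solidInner R c n' n m := by
  rw [solidInner, ← integral_conj, solidInner]
  refine integral_congr_ae (Eventually.of_forall fun r => ?_)
  simp only [map_mul, Complex.conj_ofReal, Complex.conj_conj]
  ring

/-- The vanishing integral of the raising generator is applied to the product of the harmonic of
order `m` with the conjugate of the one of order `m + 1`. The product rule raises the first factor
and lowers the second. -/
theorem solidInner_order_succ (hc : Continuous c) (n n' : ℕ) (m : ℤ) :
    (n + m + 1) * solidInner R c n n' (m + 1) = (n' - m) * solidInner R c n n' m := by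
  have hL := fun r => (hasLadder_solid n r m).mul (hasLadder_solid n' r (m + 1)).conjugate
  have hC : ContDiff ℝ 1 fun r => solid n m r * conj (solid n' (m + 1) r) :=
    (contDiff_solid 1 n m).mul (Complex.conjCLE.contDiff.comp (contDiff_solid 1 n' (m + 1)))
  have h := integral_raising_generator hC hL hc R
  have e : ∀ r : E3, (c (‖r‖ ^ 2) : ℂ) * (planar r * (solid n m r * conj (n' * solid (n' - 1) (m + 1) r) +
      n * solid (n - 1) m r * conj (solid n' (m + 1) r)) - r 2 * (solid n m r *
        conj (n' * solid (n' - 1) (m + 1 - 1) r) +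
      -n * solid (n - 1) (m + 1) r * conj (solid n' (m + 1) r))) =
      (n + m + 1) * ((c (‖r‖ ^ 2) : ℂ) * (solid n (m + 1) r * conj (solid n' (m + 1) r))) -
      (n' - m) * ((c (‖r‖ ^ 2) : ℂ) * (solid n m r * conj (solid n' m r))) := by
    intro r
    have h1 := mul_planar_solid_add n m r
    have h2 := congrArg conj (mul_conj_planar_solid_sub n' (m + 1) r)
    simp only [map_mul, map_sub, map_add, map_neg, Complex.conj_conj, Complex.conj_ofReal,
      map_natCast, map_intCast, map_one] at h2 ⊢
    push_cast at h2
    rw [add_sub_cancel_right] at h2 ⊢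
    linear_combination (c (‖r‖ ^ 2) : ℂ) * conj (solid n' (m + 1) r) * h1 +
      (c (‖r‖ ^ 2) : ℂ) * solid n m r * h2
  simp only [e] at h
  rw [integral_sub ((integrable_solid_mul R hc n n' (m + 1) (m + 1)).const_mul _)
    ((integrable_solid_mul R hc n n' m m).const_mul _), integral_const_mul, integral_const_mul] at h
  exact sub_eq_zero.1 h

/-- The relation between consecutive orders and its conjugate with the degrees exchanged disagree
when the degrees differ: together they force the inner product at `m + 1` to be minus that at `m`,
and then `(n + n' + 1)` times the latter to vanish. -/
theorem solidInner_eq_zero (hc : Continuous c) {n n' : ℕ} (hn : n ≠ n') (m : ℤ) :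
    solidInner R c n n' m = 0 := by
  have h1 := solidInner_order_succ R hc n n' m
  have h2 := congrArg conj (solidInner_order_succ R hc n' n m)
  simp only [map_mul, map_sub, map_add, conj_solidInner, map_natCast, map_intCast, map_one] at h2
  have hne : (n' : ℂ) - n ≠ 0 := sub_ne_zero.2 (by exact_mod_cast hn.symm)
  have h3 : solidInner R c n n' (m + 1) = -solidInner R c n n' m := by
    apply mul_left_cancel₀ hne
    linear_combination h2 - h1
  rw [h3] at h1
  have hne' : ((n + n' + 1 : ℕ) : ℂ) ≠ 0 := by exact_mod_cast (n + n').succ_ne_zero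
  apply mul_left_cancel₀ hne'
  push_cast
  linear_combination -h1

/-- The integral of `z` times two harmonics of consecutive degrees is evaluated twice, with `z`
absorbed by one factor or by the other. Orthogonality removes one term in each evaluation. -/
theorem solidInner_degree_succ (hc : Continuous c) (n : ℕ) :
    solidInner R c (n + 1) (n + 1) 0 =
      (2 * n + 1) / (2 * n + 3) * solidInner R (fun t => t * c t) n n 0 := by
  have hc' : Continuous fun t => t * c t := continuous_id.mul hc
  have h1 : (n + 1 : ℂ) ≠ 0 := by exact_mod_cast n.succ_ne_zero
  have h2 : (2 * n + 1 : ℂ) ≠ 0 := by exact_mod_cast (2 * n).succ_ne_zero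
  have h3 : (2 * n + 3 : ℂ) ≠ 0 := by exact_mod_cast (2 * n + 2).succ_ne_zero
  have hA : ∫ r in region R, (c (‖r‖ ^ 2) : ℂ) * ((r 2 * solid n 0 r) * conj (solid (n + 1) 0 r)) =
      n / (2 * n + 1) * solidInner R (fun t => t * c t) (n - 1) (n + 1) 0 +
        (n + 1) / (2 * n + 1) * solidInner R c (n + 1) (n + 1) 0 := by
    rw [solidInner, solidInner, ← integral_const_mul, ← integral_const_mul,
      ← integral_add ((integrable_solid_mul R hc' (n - 1) (n + 1) 0 0).const_mul _)
        ((integrable_solid_mul R hc (n + 1) (n + 1) 0 0).const_mul _)]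
    refine integral_congr_ae (Eventually.of_forall fun r => ?_)
    beta_reduce
    rw [coord_two_mul_solid]
    push_cast
    field_simp
    ring
  have hB : ∫ r in region R, (c (‖r‖ ^ 2) : ℂ) * ((r 2 * solid n 0 r) * conj (solid (n + 1) 0 r)) =
      (n + 1) / (2 * n + 3) * solidInner R (fun t => t * c t) n n 0 +
        (n + 2) / (2 * n + 3) * solidInner R c n (n + 2) 0 := by
    rw [solidInner, solidInner, ← integral_const_mul, ← integral_const_mul,
      ← integral_add ((integrable_solid_mul R hc' n n 0 0).const_mul _)
        ((integrable_solid_mul R hc n (n + 2) 0 0).const_mul _)]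
    refine integral_congr_ae (Eventually.of_forall fun r => ?_)
    beta_reduce
    have h4 : (2 * (n + 1) + 1 : ℂ) = 2 * n + 3 := by ring
    have h5 : (n + 1 + 1 : ℂ) = n + 2 := by ring
    have h6 : (n + 2 : ℂ) ≠ 0 := by exact_mod_cast (n + 1).succ_ne_zero
    have h := congrArg conj (coord_two_mul_solid (n + 1) 0 r)
    simp only [map_mul, map_sub, map_add, map_div₀, map_pow, Complex.conj_ofReal, map_natCast,
      map_intCast, map_one, map_ofNat, Nat.add_sub_cancel] at h
    push_cast at h ⊢
    rw [h4, h5] at h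
    have e : ((n + 2 : ℂ) ^ 2 - 0 ^ 2) / ((n + 2) * (2 * n + 3)) = (n + 2) / (2 * n + 3) := by
      field_simp
      ring
    rw [e] at h
    linear_combination (c (‖r‖ ^ 2) : ℂ) * solid n 0 r * h
  rw [hA, solidInner_eq_zero R hc' (by omega), solidInner_eq_zero R hc (by omega : n ≠ n + 2)] at hB
  rw [mul_comm (2 : ℂ)] at h2 h3
  field_simp at hB ⊢
  apply mul_left_cancel₀ h1
  linear_combination hB

end

theorem solidInner_order_zero (R : ℝ) (n : ℕ) : ∀ {c : ℝ → ℝ}, Continuous c →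
    solidInner R c n n 0 =
      1 / (2 * n + 1) * ((∫ r in region R, c (‖r‖ ^ 2) * (‖r‖ ^ 2) ^ n : ℝ) : ℂ) := by
  induction n with
  | zero =>
    intro c _
    have h : ∀ r, solid 0 0 r = 1 := fun r => rfl
    simp only [solidInner, h]
    norm_num
    exact integral_ofReal
  | succ n ih =>
    intro c hc
    rw [solidInner_degree_succ R hc, ih (c := fun t => t * c t) (continuous_id.mul hc)]
    have h2 : (2 * n + 1 : ℂ) ≠ 0 := by exact_mod_cast (2 * n).succ_ne_zero
    have e : ∀ r : E3, ‖r‖ ^ 2 * c (‖r‖ ^ 2) * (‖r‖ ^ 2) ^ n = c (‖r‖ ^ 2) * (‖r‖ ^ 2) ^ (n + 1) :=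
      fun r => by ring
    simp only [e]
    rw [show (2 * (n + 1 : ℕ) + 1 : ℂ) = 2 * n + 3 by push_cast; ring, ← mul_assoc, div_mul_div_comm,
      mul_one, mul_comm (2 * n + 3 : ℂ), div_mul_eq_div_div, div_self h2]

/-- The weights obey the recursion inverse to that of the norms, so their product is the same for
all orders. -/
theorem waveWeight_mul_solidInner (R : ℝ) {c : ℝ → ℝ} (hc : Continuous c) (n : ℕ) (m : ℤ) :
    |m| ≤ n → (waveWeight n m : ℂ) * solidInner R c n n m = waveWeight n 0 * solidInner R c n n 0 := by
  have step : ∀ m : ℤ, |m| ≤ n → |m + 1| ≤ n →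
      (waveWeight n (m + 1) : ℂ) * solidInner R c n n (m + 1) = waveWeight n m * solidInner R c n n m := by
    intro m h h'
    have h1 : ((n : ℂ) - m) * waveWeight n (m + 1) = (n + m + 1) * waveWeight n m := by
      exact_mod_cast congrArg (fun x : ℝ => (x : ℂ)) (waveWeight_order_succ h h')
    have h2 := solidInner_order_succ R hc n n m
    rw [abs_le] at h h'
    have e1 : ((n : ℂ) - m) ≠ 0 := by
      have : (n : ℤ) - m ≠ 0 := by omega
      exact_mod_cast this
    have e2 : ((n : ℂ) + m + 1) ≠ 0 := by
      have : (n : ℤ) + m + 1 ≠ 0 := by omega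
      exact_mod_cast this
    apply mul_left_cancel₀ (mul_ne_zero e1 e2)
    linear_combination (n + m + 1) * solidInner R c n n (m + 1) * h1 +
      (n + m + 1) * waveWeight n m * h2
  induction m using Int.induction_on with
  | zero => exact fun _ => rfl
  | succ i ih =>
    intro h
    have h' : |(i : ℤ)| ≤ n := by rw [abs_le] at h ⊢; omega
    rw [step i h' h, ih h']
  | pred i ih =>
    intro h
    have h' : |-(i : ℤ)| ≤ n := by rw [abs_le] at h ⊢; omega
    rw [← ih h']
    have := step (-i - 1) h (by rwa [sub_add_cancel])
    rw [sub_add_cancel] at this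
    exact this.symm

theorem continuous_besselEntire {n : ℤ} (hn : -1 ≤ n) : Continuous (besselEntire n) :=
  continuous_iff_continuousAt.2 fun s => (hasDerivAt_besselEntire hn s).continuousAt

/-! ### The radial Bessel integral -/

/-- The radial integral `∫₀ᴿ j_n(kr)² r² dr` in closed form. -/
def besselEnergy (k R : ℝ) (n : ℕ) : ℝ :=
  R ^ 3 / 2 * (k * R) ^ (2 * n) * (besselEntire n (k ^ 2 * R ^ 2) ^ 2 -
    besselEntire (n - 1) (k ^ 2 * R ^ 2) * besselEntire (n + 1) (k ^ 2 * R ^ 2))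

/-- Lommel's antiderivative of `r² j_n(kr)²`, proportional to `r³ (j_n² - j_{n-1} j_{n+1})`. The
recurrences at orders `n` and `n + 1` remove the orders `n - 1` and `n + 2` from its derivative. -/
theorem hasDerivAt_besselEnergy (k R : ℝ) (n : ℕ) : HasDerivAt (fun R => besselEnergy k R n)
    (R ^ 2 * (k ^ (2 * n) * besselEntire n (k ^ 2 * R ^ 2) ^ 2 * (R ^ 2) ^ n)) R := by
  have hs : HasDerivAt (fun R : ℝ => k ^ 2 * R ^ 2) (k ^ 2 * (2 * R)) R := by
    simpa using (hasDerivAt_pow 2 R).const_mul (k ^ 2)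
  have h0 := (hasDerivAt_besselEntire (n := n) (by omega) (k ^ 2 * R ^ 2)).comp R hs
  have h1 := (hasDerivAt_besselEntire (n := n - 1) (by omega) (k ^ 2 * R ^ 2)).comp R hs
  have h2 := (hasDerivAt_besselEntire (n := n + 1) (by omega) (k ^ 2 * R ^ 2)).comp R hs
  have hp : HasDerivAt (fun R : ℝ => R ^ 3 / 2 * (k * R) ^ (2 * n))
      (k ^ (2 * n) / 2 * ((2 * n + 3 : ℕ) * R ^ (2 * n + 2))) R := by
    have := (hasDerivAt_pow (2 * n + 3) R).const_mul (k ^ (2 * n) / 2)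
    refine this.congr_of_eventuallyEq (Eventually.of_forall fun x => ?_)
    beta_reduce
    rw [mul_pow]
    ring
  have h := hp.mul ((h0.pow 2).sub (h1.mul h2))
  refine h.congr_deriv ?_
  simp only [Function.comp_apply, Pi.sub_apply, Pi.pow_apply, Pi.mul_apply]
  have r1 := besselEntire_recurrence n (k ^ 2 * R ^ 2)
  have r2 := besselEntire_recurrence (n + 1) (k ^ 2 * R ^ 2)
  push_cast at r2 ⊢
  rw [add_sub_cancel_right] at r2
  rw [sub_add_cancel]
  linear_combination (k ^ (2 * n) * R ^ (2 * n) * R ^ 2 / 2) *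
    (besselEntire (n - 1) (k ^ 2 * R ^ 2) * r2 - besselEntire n (k ^ 2 * R ^ 2) * r1)

theorem besselEnergy_zero (k : ℝ) (n : ℕ) : besselEnergy k 0 n = 0 := by simp [besselEnergy]

theorem integral_radial {R : ℝ} (hR : 0 ≤ R) (f : ℝ → ℝ) :
    ∫ r in region R, f ‖r‖ = 4 * Real.pi * ∫ t in (0 : ℝ)..R, t ^ 2 * f t := by
  have h := integral_fun_norm_addHaar (volume : Measure E3) ((Set.Iic R).indicator f)
  have e1 : (fun x : E3 => (Set.Iic R).indicator f ‖x‖) = (region R).indicator fun x => f ‖x‖ := by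
    funext x
    by_cases hx : ‖x‖ ≤ R
    · rw [Set.indicator_of_mem (by simpa using hx), Set.indicator_of_mem (by simpa [region] using hx)]
    · rw [Set.indicator_of_notMem (by simpa using hx),
        Set.indicator_of_notMem (by simpa [region] using hx)]
  have e2 : (fun y : ℝ => y ^ (Module.finrank ℝ E3 - 1) • (Set.Iic R).indicator f y) =
      (Set.Iic R).indicator fun y => y ^ 2 * f y := by
    funext y
    by_cases hy : y ∈ Set.Iic R <;> simp [hy]
  have hv : volume.real (Metric.ball (0 : E3) 1) = Real.pi * 4 / 3 := by
    rw [measureReal_def, EuclideanSpace.volume_ball_fin_three]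
    rw [ENNReal.ofReal_one, one_pow, one_mul, ENNReal.toReal_ofReal (by positivity)]
  rw [e1, e2, integral_indicator (measurableSet_region R), integral_indicator measurableSet_Iic,
    Measure.restrict_restrict measurableSet_Iic, Set.inter_comm, Set.Ioi_inter_Iic, hv] at h
  rw [h, intervalIntegral.integral_of_le hR]
  simp
  ring

theorem integral_besselEntire_sq (k : ℝ) {R : ℝ} (hR : 0 ≤ R) (n : ℕ) :
    ∫ r in region R, k ^ (2 * n) * besselEntire n (k ^ 2 * ‖r‖ ^ 2) ^ 2 * (‖r‖ ^ 2) ^ n =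
      4 * Real.pi * besselEnergy k R n := by
  have hc := continuous_besselEntire (n := n) (by omega)
  rw [integral_radial hR fun t => k ^ (2 * n) * besselEntire n (k ^ 2 * t ^ 2) ^ 2 * (t ^ 2) ^ n,
    intervalIntegral.integral_eq_sub_of_hasDerivAt (fun t _ => hasDerivAt_besselEnergy k t n)
      (Continuous.intervalIntegrable (by fun_prop) _ _), besselEnergy_zero, sub_zero]

theorem waveWeight_zero (n : ℕ) : waveWeight n 0 = (2 * n + 1) / (4 * Real.pi) := by
  have hf : (n.factorial : ℝ) ≠ 0 := by positivity
  rw [waveWeight, sub_zero, add_zero, Int.toNat_natCast]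
  field_simp

theorem waveWeight_mul_integral_wave (k : ℝ) {R : ℝ} (hR : 0 ≤ R) {n : ℕ} {m : ℤ} (hm : |m| ≤ n) :
    waveWeight n m * ∫ r in region R, ‖wave k n m r‖ ^ 2 = besselEnergy k R n := by
  have hc0 := continuous_besselEntire (n := n) (by omega)
  have hc : Continuous fun t => k ^ (2 * n) * besselEntire n (k ^ 2 * t) ^ 2 := by fun_prop
  have h1 := waveWeight_mul_solidInner R hc n m hm
  rw [solidInner_order_zero R n hc, integral_besselEntire_sq k hR, waveWeight_zero] at h1
  have h2 : solidInner R (fun t => k ^ (2 * n) * besselEntire n (k ^ 2 * t) ^ 2) n n m =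
      ((∫ r in region R, ‖wave k n m r‖ ^ 2 : ℝ) : ℂ) := by
    have hI : ∫ r in region R, ((‖wave k n m r‖ ^ 2 : ℝ) : ℂ) =
        ((∫ r in region R, ‖wave k n m r‖ ^ 2 : ℝ) : ℂ) := integral_ofReal
    rw [← hI, solidInner]
    refine integral_congr_ae (Eventually.of_forall fun r => ?_)
    have h3 := Complex.mul_conj (solid n m r)
    rw [Complex.normSq_eq_norm_sq] at h3
    beta_reduce
    rw [h3, wave]
    have hk : (|k| ^ n) ^ 2 = k ^ (2 * n) := by
      rw [← pow_mul, mul_comm, pow_mul, sq_abs, ← pow_mul]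
    simp only [norm_mul, norm_pow, Complex.norm_real, mul_pow, Real.norm_eq_abs, sq_abs, hk]
    push_cast
    ring
  rw [h2] at h1
  have hpi := Real.pi_ne_zero
  have h4 : waveWeight n m * (∫ r in region R, ‖wave k n m r‖ ^ 2) =
      (2 * n + 1) / (4 * Real.pi) * (1 / (2 * n + 1) * (4 * Real.pi * besselEnergy k R n)) := by
    generalize (∫ r in region R, ‖wave k n m r‖ ^ 2) = I at h1 ⊢
    apply Complex.ofReal_injective
    push_cast at h1 ⊢
    exact h1
  rw [h4]
  field_simp

theorem integral_wave_mul_conj (k R : ℝ) {n n' : ℕ} (hn : n ≠ n') (m : ℤ) :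
    ∫ r in region R, wave k n m r * conj (wave k n' m r) = 0 := by
  have hc0 := continuous_besselEntire (n := n) (by omega)
  have hc1 := continuous_besselEntire (n := n') (by omega)
  have hc : Continuous fun t => k ^ (n + n') * (besselEntire n (k ^ 2 * t) *
    besselEntire n' (k ^ 2 * t)) := by fun_prop
  rw [← solidInner_eq_zero R hc hn m, solidInner]
  refine integral_congr_ae (Eventually.of_forall fun r => ?_)
  simp only [wave, map_mul, map_pow, Complex.conj_ofReal]
  push_cast
  ring

/-! ### Energies of scalar and vector waves on the ball -/

/-- The integral of the squared modulus of a scalar wave over the ball. -/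
def waveEnergy (k R : ℝ) (n : ℕ) (m : ℤ) : ℝ := ∫ r in region R, ‖wave k n m r‖ ^ 2

theorem waveEnergy_eq_zero (k R : ℝ) {n : ℕ} {m : ℤ} (h : (n : ℤ) < |m|) : waveEnergy k R n m = 0 := by
  simp [waveEnergy, wave_eq_zero h]

theorem continuous_wave (k : ℝ) (n : ℕ) (m : ℤ) : Continuous (wave k n m) :=
  (contDiff_wave k 0 n m).continuous

theorem integrable_region {f : E3 → ℝ} (hf : Continuous f) (R : ℝ) : IntegrableOn f (region R) :=
  hf.continuousOn.integrableOn_compact (isCompact_closedBall _ _)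

section
variable (k : ℝ) {R : ℝ} {n : ℕ} {m : ℤ}

theorem waveWeight_mul_waveEnergy (hR : 0 ≤ R) (hm : |m| ≤ n) :
    waveWeight n m * waveEnergy k R n m = besselEnergy k R n := waveWeight_mul_integral_wave k hR hm

/-- Energy of a neighbouring order expressed with the weight of order `m`. At the end of the range
the neighbour vanishes, and so does the factor on the right; the variants below have the same
structure. -/
theorem waveWeight_mul_waveEnergy_order_succ (hR : 0 ≤ R) (hm : |m| ≤ n) :
    waveWeight n m * ((n + m + 1) * waveEnergy k R n (m + 1)) = (n - m) * besselEnergy k R n := by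
  by_cases h : |m + 1| ≤ n
  · rw [← waveWeight_mul_waveEnergy k hR h]
    linear_combination -waveEnergy k R n (m + 1) * waveWeight_order_succ hm h
  · have h1 : (n : ℤ) = m := by rw [abs_le] at h hm; omega
    have h2 : (n : ℝ) = m := by exact_mod_cast h1
    rw [waveEnergy_eq_zero k R (not_le.1 h), h2]
    ring

theorem waveWeight_mul_waveEnergy_order_pred (hR : 0 ≤ R) (hm : |m| ≤ n) :
    waveWeight n m * ((n - m + 1) * waveEnergy k R n (m - 1)) = (n + m) * besselEnergy k R n := by
  by_cases h : |m - 1| ≤ n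
  · rw [← waveWeight_mul_waveEnergy k hR h]
    have := waveWeight_order_succ h (by rwa [sub_add_cancel])
    rw [sub_add_cancel] at this
    push_cast at this
    linear_combination waveEnergy k R n (m - 1) * this
  · have h1 : (n : ℤ) = -m := by rw [abs_le] at h hm; omega
    have h2 : (n : ℝ) = -m := by exact_mod_cast h1
    rw [waveEnergy_eq_zero k R (not_le.1 h), h2]
    ring

theorem waveWeight_succ_mul_waveEnergy (hR : 0 ≤ R) (hm : |m| ≤ (n + 1 : ℕ)) :
    waveWeight (n + 1) m * ((2 * n + 1) * (n + 1) ^ 2 * waveEnergy k R n m) =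
      (2 * n + 3) * ((n + 1) ^ 2 - m ^ 2) * besselEnergy k R n := by
  by_cases h : |m| ≤ n
  · rw [← waveWeight_mul_waveEnergy k hR h]
    linear_combination waveEnergy k R n m * waveWeight_degree_succ h
  · have h1 : |m| = n + 1 := by push_cast at hm; omega
    have h2 : (m : ℝ) ^ 2 = (n + 1) ^ 2 := by
      rw [← sq_abs]
      exact_mod_cast congrArg (fun x : ℤ => x ^ (2 : ℕ)) h1
    rw [waveEnergy_eq_zero k R (not_le.1 h), h2]
    ring

theorem waveWeight_succ_mul_waveEnergy_pred (hR : 0 ≤ R) (hm : |m| ≤ (n + 1 : ℕ)) :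
    waveWeight (n + 1) m * ((2 * n + 1) * (n + 1) ^ 2 * waveEnergy k R n (m - 1)) =
      (2 * n + 3) * ((n + m) * (n + m + 1)) * besselEnergy k R n := by
  by_cases h : |m - 1| ≤ n
  · rw [← waveWeight_mul_waveEnergy k hR h]
    have := waveWeight_degree_order_succ h
    rw [sub_add_cancel] at this
    push_cast at this
    linear_combination waveEnergy k R n (m - 1) * this
  · have h1 : ((n : ℤ) + m) * (n + m + 1) = 0 := by
      rw [abs_le] at h hm
      push_cast at hm
      rw [mul_eq_zero]
      omega
    have h2 : ((n : ℝ) + m) * (n + m + 1) = 0 := by exact_mod_cast h1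
    rw [waveEnergy_eq_zero k R (not_le.1 h), h2]
    ring

theorem waveWeight_succ_mul_waveEnergy_succ (hR : 0 ≤ R) (hm : |m| ≤ (n + 1 : ℕ)) :
    waveWeight (n + 1) m * ((2 * n + 1) * (n + 1) ^ 2 * waveEnergy k R n (m + 1)) =
      (2 * n + 3) * ((n - m) * (n - m + 1)) * besselEnergy k R n := by
  by_cases h : |m + 1| ≤ n
  · rw [← waveWeight_mul_waveEnergy k hR h]
    have := waveWeight_degree_order_succ (n := n) (m := -(m + 1)) (by rwa [abs_neg])
    rw [waveWeight_neg, show -(m + 1) + 1 = -m by ring, waveWeight_neg] at this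
    push_cast at this
    linear_combination waveEnergy k R n (m + 1) * this
  · have h1 : ((n : ℤ) - m) * (n - m + 1) = 0 := by
      rw [abs_le] at h hm
      push_cast at hm
      rw [mul_eq_zero]
      omega
    have h2 : ((n : ℝ) - m) * (n - m + 1) = 0 := by exact_mod_cast h1
    rw [waveEnergy_eq_zero k R (not_le.1 h), h2]
    ring

theorem waveWeight_mul_waveEnergy_degree_succ (hR : 0 ≤ R) (hm : |m| ≤ n) :
    waveWeight n m * ((2 * n + 3) * ((n + 1) ^ 2 - m ^ 2) * waveEnergy k R (n + 1) m) =
      (2 * n + 1) * (n + 1) ^ 2 * besselEnergy k R (n + 1) := by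
  rw [← waveWeight_mul_waveEnergy k hR (m := m) (by push_cast; omega)]
  linear_combination -waveEnergy k R (n + 1) m * waveWeight_degree_succ hm

theorem waveWeight_mul_waveEnergy_degree_order_succ (hR : 0 ≤ R) (hm : |m| ≤ n) :
    waveWeight n m * ((2 * n + 3) * ((n + m + 1) * (n + m + 2)) * waveEnergy k R (n + 1) (m + 1)) =
      (2 * n + 1) * (n + 1) ^ 2 * besselEnergy k R (n + 1) := by
  rw [← waveWeight_mul_waveEnergy k hR (m := m + 1) (by rw [abs_le] at hm ⊢; push_cast; omega)]
  linear_combination -waveEnergy k R (n + 1) (m + 1) * waveWeight_degree_order_succ hm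

theorem waveWeight_mul_waveEnergy_degree_succ_order_pred (hR : 0 ≤ R) (hm : |m| ≤ n) :
    waveWeight n m * ((2 * n + 3) * ((n - m + 1) * (n - m + 2)) * waveEnergy k R (n + 1) (m - 1)) =
      (2 * n + 1) * (n + 1) ^ 2 * besselEnergy k R (n + 1) := by
  rw [← waveWeight_mul_waveEnergy k hR (m := m - 1) (by rw [abs_le] at hm ⊢; push_cast; omega)]
  have := waveWeight_degree_order_succ (n := n) (m := -m) (by rwa [abs_neg])
  rw [waveWeight_neg, show -m + 1 = -(m - 1) by ring, waveWeight_neg] at this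
  push_cast at this
  linear_combination -waveEnergy k R (n + 1) (m - 1) * this

end

theorem integral_add_add {R : ℝ} {f g h : E3 → ℝ} (hf : IntegrableOn f (region R))
    (hg : IntegrableOn g (region R)) (hh : IntegrableOn h (region R)) :
    ∫ r in region R, (f r + g r + h r) =
      (∫ r in region R, f r) + (∫ r in region R, g r) + ∫ r in region R, h r := by
  rw [← integral_add hf hg]
  exact integral_add (hf.add hg) hh

theorem sum_norm_cartesian_sq (P M Z : ℂ) :
    ∑ i, ‖cartesian P M Z i‖ ^ 2 = (‖P‖ ^ 2 + ‖M‖ ^ 2) / 2 + ‖Z‖ ^ 2 := by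
  have h := parallelogram_law_with_norm ℝ P M
  rw [Fin.sum_univ_three]
  simp only [cartesian, Matrix.cons_val_zero, Matrix.cons_val_one, Matrix.cons_val_two,
    Matrix.tail_cons, Matrix.head_cons, norm_div, norm_mul, Complex.norm_ofNat, Complex.norm_I]
  linarith

theorem integral_norm_combination_sq (k R : ℝ) {n n' : ℕ} (hn : n ≠ n') (m : ℤ) (x y : ℝ) :
    ∫ r in region R, ‖x * wave k n m r + y * wave k n' m r‖ ^ 2 =
      x ^ 2 * waveEnergy k R n m + y ^ 2 * waveEnergy k R n' m := by
  have h : ∀ r, ‖x * wave k n m r + y * wave k n' m r‖ ^ 2 = x ^ 2 * ‖wave k n m r‖ ^ 2 +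
      y ^ 2 * ‖wave k n' m r‖ ^ 2 + 2 * x * y * (wave k n m r * conj (wave k n' m r)).re := by
    intro r
    rw [← Complex.normSq_eq_norm_sq, Complex.normSq_add, map_mul, map_mul, Complex.normSq_ofReal,
      Complex.normSq_ofReal, map_mul, Complex.conj_ofReal, mul_mul_mul_comm, ← Complex.ofReal_mul,
      Complex.re_ofReal_mul, Complex.normSq_eq_norm_sq, Complex.normSq_eq_norm_sq]
    ring
  have c1 := continuous_wave k n m
  have c2 := continuous_wave k n' m
  have i1 : IntegrableOn (fun r => x ^ 2 * ‖wave k n m r‖ ^ 2) (region R) :=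
    integrable_region (by fun_prop) R
  have i2 : IntegrableOn (fun r => y ^ 2 * ‖wave k n' m r‖ ^ 2) (region R) :=
    integrable_region (by fun_prop) R
  have i3 : IntegrableOn (fun r => 2 * x * y * (wave k n m r * conj (wave k n' m r)).re) (region R) :=
    integrable_region (continuous_const.mul
      (Complex.continuous_re.comp (c1.mul (Complex.continuous_conj.comp c2)))) R
  have hc : IntegrableOn (fun r => wave k n m r * conj (wave k n' m r)) (region R) :=
    (c1.mul (Complex.continuous_conj.comp c2)).continuousOn.integrableOn_compact
      (isCompact_closedBall _ _)
  have h0 : ∫ r in region R, (wave k n m r * conj (wave k n' m r)).re = 0 := by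
    have := integral_re hc
    rw [integral_wave_mul_conj k R hn m] at this
    exact this
  simp only [h]
  rw [integral_add_add i1 i2 i3, integral_const_mul, integral_const_mul,
    integral_const_mul, h0, waveEnergy, waveEnergy]
  ring

/-- All three components have degree `n`, so each weighted energy is a multiple of one radial
integral. The multiples add up to `n(n+1)`, the factor divided out in the weight. -/
theorem vecWeight_mul_integral_te (k : ℝ) {R : ℝ} (hR : 0 ≤ R) {n : ℕ} {m : ℤ} (hn : 1 ≤ n)
    (hm : |m| ≤ n) : vecWeight n m * ∫ r in region R, ∑ i, ‖te k n m i r‖ ^ 2 =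
      besselEnergy k R n := by
  have h : ∀ r, ∑ i, ‖te k n m i r‖ ^ 2 = (n + m + 1) ^ 2 / 2 * ‖wave k n (m + 1) r‖ ^ 2 +
      (n - m + 1) ^ 2 / 2 * ‖wave k n (m - 1) r‖ ^ 2 + m ^ 2 * ‖wave k n m r‖ ^ 2 := by
    intro r
    have e1 : ‖(n + m + 1 : ℂ)‖ ^ 2 = (n + m + 1) ^ 2 := by
      rw [show (n + m + 1 : ℂ) = ((n + m + 1 : ℝ) : ℂ) by push_cast; rfl, Complex.norm_real,
        Real.norm_eq_abs, sq_abs]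
    have e2 : ‖(n - m + 1 : ℂ)‖ ^ 2 = (n - m + 1) ^ 2 := by
      rw [show (n - m + 1 : ℂ) = ((n - m + 1 : ℝ) : ℂ) by push_cast; rfl, Complex.norm_real,
        Real.norm_eq_abs, sq_abs]
    have e3 : ‖(-m : ℂ)‖ ^ 2 = m ^ 2 := by
      rw [norm_neg, Complex.norm_intCast, sq_abs]
    simp only [te]
    rw [sum_norm_cartesian_sq, norm_mul, norm_mul, norm_mul, mul_pow, mul_pow, mul_pow, e1, e2, e3]
    ring
  have c := fun l => continuous_wave k n l
  have i : ∀ (a : ℝ) (l : ℤ), IntegrableOn (fun r => a * ‖wave k n l r‖ ^ 2) (region R) :=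
    fun a l => integrable_region (by fun_prop) R
  simp only [h]
  rw [integral_add_add (i _ _) (i _ _) (i _ _), integral_const_mul,
    integral_const_mul, integral_const_mul, ← waveEnergy, ← waveEnergy, ← waveEnergy, vecWeight]
  have h1 := waveWeight_mul_waveEnergy_order_succ k hR hm
  have h2 := waveWeight_mul_waveEnergy_order_pred k hR hm
  have h3 := waveWeight_mul_waveEnergy k hR hm
  have hn0 : (n : ℝ) ≠ 0 := by positivity
  have hn1 : (n + 1 : ℝ) ≠ 0 := by positivity
  field_simp
  linear_combination (n + m + 1) * h1 + (n - m + 1) * h2 + 2 * m ^ 2 * h3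

/-- Every component mixes two scalar waves of the same order whose degrees differ by 2. They are
orthogonal, so the energy splits into a lower-degree and an upper-degree part, summed separately in
`hL` and `hU`. -/
theorem vecWeight_mul_integral_tm (k : ℝ) {R : ℝ} (hR : 0 ≤ R) {n : ℕ} {m : ℤ}
    (hm : |m| ≤ (n + 1 : ℕ)) :
    vecWeight (n + 1) m * ∫ r in region R, ∑ i, ‖tm k (n + 1) m i r‖ ^ 2 =
      (n + 2) / (2 * n + 3) * besselEnergy k R n +
        (n + 1) / (2 * n + 3) * besselEnergy k R (n + 2) := by
  have hn1 : (n + 1 : ℝ) ≠ 0 := by positivity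
  have hn2 : (n + 2 : ℝ) ≠ 0 := by positivity
  have hn3 : (2 * n + 3 : ℝ) ≠ 0 := by positivity
  have hn5 : (2 * n + 5 : ℝ) ≠ 0 := by positivity
  have hn0 : (2 * n + 1 : ℝ) ≠ 0 := by positivity
  set α : ℝ := (n + 1) / (2 * n + 3) with hα
  set x : ℝ := α * (n + 2) with hx
  set yP : ℝ := α * ((n + m + 2) * (n + m + 3) / (n + 2)) with hyP
  set yM : ℝ := α * ((n - m + 2) * (n - m + 3) / (n + 2)) with hyM
  set yZ : ℝ := α * ((n - m + 2) * (n + m + 2) / (n + 2)) with hyZ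
  have eα : ((n + 1 : ℕ) : ℂ) / (2 * (n + 1 : ℕ) + 1) = (α : ℂ) := by
    rw [hα]; push_cast; congr 1; ring
  have hP : ∀ r, tmPlus k (n + 1) m r =
      (-x : ℝ) * wave k n (m + 1) r + yP * wave k (n + 2) (m + 1) r := by
    intro r
    rw [tmPlus, eα, Nat.add_sub_cancel, hx, hyP]
    push_cast
    rw [show (n + 1 + 1 : ℂ) = n + 2 by ring]
    ring
  have hM : ∀ r, tmMinus k (n + 1) m r =
      x * wave k n (m - 1) r + (-yM : ℝ) * wave k (n + 2) (m - 1) r := by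
    intro r
    rw [tmMinus, eα, Nat.add_sub_cancel, hx, hyM]
    push_cast
    rw [show (n + 1 + 1 : ℂ) = n + 2 by ring]
    ring
  have hZ : ∀ r, tmAxial k (n + 1) m r = x * wave k n m r + yZ * wave k (n + 2) m r := by
    intro r
    rw [tmAxial, eα, Nat.add_sub_cancel, hx, hyZ]
    push_cast
    rw [show (n + 1 + 1 : ℂ) = n + 2 by ring]
    ring
  have h : ∀ r, ∑ i, ‖tm k (n + 1) m i r‖ ^ 2 =
      1 / 2 * ‖(-x : ℝ) * wave k n (m + 1) r + yP * wave k (n + 2) (m + 1) r‖ ^ 2 +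
      1 / 2 * ‖x * wave k n (m - 1) r + (-yM : ℝ) * wave k (n + 2) (m - 1) r‖ ^ 2 +
      1 * ‖x * wave k n m r + yZ * wave k (n + 2) m r‖ ^ 2 := by
    intro r
    simp only [tm]
    rw [sum_norm_cartesian_sq, hP, hM, hZ]
    ring
  have i : ∀ (a x y : ℝ) (l : ℤ), IntegrableOn
      (fun r => a * ‖x * wave k n l r + y * wave k (n + 2) l r‖ ^ 2) (region R) := fun a x y l => by
    have c1 := continuous_wave k n l
    have c2 := continuous_wave k (n + 2) l
    exact integrable_region (by fun_prop) R
  simp only [h]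
  rw [integral_add_add (i _ _ _ _) (i _ _ _ _) (i _ _ _ _), integral_const_mul, integral_const_mul,
    integral_const_mul, integral_norm_combination_sq k R (by omega),
    integral_norm_combination_sq k R (by omega), integral_norm_combination_sq k R (by omega), vecWeight]
  have g1 := waveWeight_succ_mul_waveEnergy k hR hm
  have g2 := waveWeight_succ_mul_waveEnergy_pred k hR hm
  have g3 := waveWeight_succ_mul_waveEnergy_succ k hR hm
  have u1 := waveWeight_mul_waveEnergy_degree_succ k hR hm
  have u2 := waveWeight_mul_waveEnergy_degree_order_succ k hR hm
  have u3 := waveWeight_mul_waveEnergy_degree_succ_order_pred k hR hm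
  have e2 : n + 1 + 1 = n + 2 := rfl
  rw [e2] at u1 u2 u3
  set W := waveWeight (n + 1) m
  have hL : W * (waveEnergy k R n (m + 1) / 2 + waveEnergy k R n (m - 1) / 2 + waveEnergy k R n m) *
      (n + 1) = (2 * n + 3) * besselEnergy k R n := by
    apply mul_left_cancel₀ (mul_ne_zero hn0 hn1)
    linear_combination g1 + g2 / 2 + g3 / 2
  have hU : W * (((n + m + 2) * (n + m + 3)) ^ 2 * waveEnergy k R (n + 2) (m + 1) / 2 +
      ((n - m + 2) * (n - m + 3)) ^ 2 * waveEnergy k R (n + 2) (m - 1) / 2 +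
      ((n - m + 2) * (n + m + 2)) ^ 2 * waveEnergy k R (n + 2) m) =
      (2 * n + 3) * (n + 2) ^ 3 * besselEnergy k R (n + 2) := by
    apply mul_left_cancel₀ hn5
    push_cast at u1 u2 u3
    linear_combination (n - m + 2) * (n + m + 2) * u1 + (n + m + 2) * (n + m + 3) * u2 / 2 +
      (n - m + 2) * (n - m + 3) * u3 / 2
  have key : W / ((n + 1 : ℕ) * ((n + 1 : ℕ) + 1)) * (1 / 2 * ((-x) ^ 2 * waveEnergy k R n (m + 1) +
      yP ^ 2 * waveEnergy k R (n + 2) (m + 1)) + 1 / 2 * (x ^ 2 * waveEnergy k R n (m - 1) +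
      (-yM) ^ 2 * waveEnergy k R (n + 2) (m - 1)) + 1 * (x ^ 2 * waveEnergy k R n m +
      yZ ^ 2 * waveEnergy k R (n + 2) m)) = 1 / ((n + 1) * (n + 2)) * (α ^ 2 * ((n + 2) ^ 2 *
      (W * (waveEnergy k R n (m + 1) / 2 + waveEnergy k R n (m - 1) / 2 + waveEnergy k R n m)) +
      1 / (n + 2) ^ 2 * (W * (((n + m + 2) * (n + m + 3)) ^ 2 * waveEnergy k R (n + 2) (m + 1) / 2 +
      ((n - m + 2) * (n - m + 3)) ^ 2 * waveEnergy k R (n + 2) (m - 1) / 2 +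
      ((n - m + 2) * (n + m + 2)) ^ 2 * waveEnergy k R (n + 2) m)))) := by
    rw [hx, hyP, hyM, hyZ]
    push_cast
    rw [show (n + 1 + 1 : ℝ) = n + 2 by ring]
    field_simp
    ring
  rw [key, hU, eq_div_of_mul_eq hn1 hL, hα]
  field_simp

/-! ### The mode coefficients as weighted energies -/

theorem sphBessel_sub_one (n : ℕ) {x : ℝ} (hx : x ≠ 0) :
    sphBessel (n - 1) x = x ^ n * x⁻¹ * besselEntire (n - 1) (x ^ 2) := by
  cases n with
  | zero => simpa using sphBessel_neg_one hx
  | succ n =>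
    have e : ((n + 1 : ℕ) : ℤ) - 1 = n := by push_cast; ring
    rw [e, sphBessel_natCast, pow_succ x n, mul_inv_cancel_right₀ hx]

/-- The recurrence eliminates `j_{n+1}` from `j_n² - j_{n-1} j_{n+1}`, which gives the stated
bracket. -/
theorem besselEnergy_eq {k R : ℝ} (hk : k ≠ 0) (hR : R ≠ 0) (n : ℕ) : besselEnergy k R n =
    R ^ 3 / 2 * (sphBessel (n - 1) (k * R) ^ 2 + sphBessel n (k * R) ^ 2 -
      (2 * n + 1) / (k * R) * sphBessel (n - 1) (k * R) * sphBessel n (k * R)) := by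
  have hx : k * R ≠ 0 := mul_ne_zero hk hR
  have h := besselEntire_recurrence n ((k * R) ^ 2)
  rw [sphBessel_sub_one n hx, sphBessel_natCast, besselEnergy, ← mul_pow]
  generalize k * R = x at *
  field_simp
  rw [pow_mul']
  linear_combination (-(x ^ n) ^ 2 * besselEntire (n - 1) (x ^ 2)) * h

/-- The integral of the squared norm of a vector wave over the ball. -/
def vectorEnergy (k R : ℝ) (p : ℕ+) : ℝ := ∫ r in region R, ∑ i, ‖vectorWave k p i r‖ ^ 2

theorem vectorEnergy_nonneg (k R : ℝ) (p : ℕ+) : 0 ≤ vectorEnergy k R p :=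
  integral_nonneg fun _ => Finset.sum_nonneg fun _ _ => sq_nonneg _

theorem modeResistance_eq (η : ℝ) {k R : ℝ} (hk : k ≠ 0) (hR : 0 < R) (p : ℕ+) :
    modeResistance η k R p = η * k ^ 2 / 2 * (vecWeight (degree p) (order p) * vectorEnergy k R p) := by
  obtain ⟨hn, hm, -⟩ := mode_numbering p
  by_cases hp : Odd (p : ℕ)
  · simp only [modeResistance, vectorEnergy, vectorWave, if_pos hp]
    rw [vecWeight_mul_integral_te k hR.le hn hm, besselEnergy_eq hk hR.ne']
    push_cast
    ring
  · simp only [modeResistance, vectorEnergy, vectorWave, if_neg hp]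
    generalize order p = m at *
    obtain ⟨n, hn'⟩ : ∃ n, degree p = n + 1 := ⟨degree p - 1, by omega⟩
    rw [hn'] at hm ⊢
    rw [vecWeight_mul_integral_tm k hR.le hm, besselEnergy_eq hk hR.ne', besselEnergy_eq hk hR.ne']
    have e1 : ((n + 1 : ℕ) : ℤ) - 2 = n - 1 := by push_cast; ring
    have e2 : ((n + 1 : ℕ) : ℤ) - 1 = n := by push_cast; ring
    have e3 : ((n + 2 : ℕ) : ℤ) - 1 = (n + 1 : ℕ) := by push_cast; ring
    have e4 : ((n + 1 : ℕ) : ℤ) + 1 = (n + 2 : ℕ) := by push_cast; ring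
    rw [e1, e2, e3, e4]
    push_cast
    have h1 : (2 * (n + 1) + 1 : ℝ) = 2 * n + 3 := by ring
    have h2 : (n + 1 + 1 : ℝ) = n + 2 := by ring
    have h3 : (2 * (n + 1) - 1 : ℝ) = 2 * n + 1 := by ring
    have h4 : (2 * (n + 1) + 3 : ℝ) = 2 * (n + 2) + 1 := by ring
    rw [h1, h2, h3, h4]
    ring

theorem modeResistance_nonneg {η k R : ℝ} (hη : 0 ≤ η) (hk : k ≠ 0) (hR : 0 < R) (p : ℕ+) :
    0 ≤ modeResistance η k R p := by
  rw [modeResistance_eq η hk hR]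
  have := vecWeight_nonneg (degree p) (order p)
  have := vectorEnergy_nonneg k R p
  positivity

theorem continuous_vectorWave (k : ℝ) (p : ℕ+) (i : Fin 3) : Continuous (vectorWave k p i) := by
  obtain ⟨hn, -, -⟩ := mode_numbering p
  obtain ⟨n, hn'⟩ : ∃ n, degree p = n + 1 := ⟨degree p - 1, by omega⟩
  unfold vectorWave
  split_ifs
  · rw [hn']
    exact continuous_te k n _ i
  · rw [hn']
    exact continuous_tm k n _ i

/-- A wave of zero energy vanishes almost everywhere on the ball. This settles the degenerate case
of the normalization without a proof that the energies are positive. -/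
theorem waveCoeff_eq_zero {k R : ℝ} {p : ℕ+} (h : vectorEnergy k R p = 0) (J : E3 → C3) :
    waveCoeff R J (vectorWave k p) = 0 := by
  have hc : Continuous fun r => ∑ i, ‖vectorWave k p i r‖ ^ 2 :=
    continuous_finsetSum _ fun i _ => (continuous_vectorWave k p i).norm.pow 2
  have h0 := (integral_eq_zero_iff_of_nonneg (μ := ballMeasure R)
    (fun r => Finset.sum_nonneg fun i _ => sq_nonneg ‖vectorWave k p i r‖)
    (integrable_region hc R)).1 h
  refine integral_eq_zero_of_ae ?_
  filter_upwards [h0] with r hr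
  have hr' := (Finset.sum_eq_zero_iff_of_nonneg fun i _ => sq_nonneg _).1 hr
  refine Finset.sum_eq_zero fun i hi => ?_
  have := hr' i hi
  rw [norm_eq_zero.1 (pow_eq_zero_iff two_ne_zero |>.1 this)]
  simp

/-- The energy contained in the mode coefficient cancels the squared normalization of the mode, and
so does the constant between the mode and its vector wave. What remains is the summand of the kernel
expansion. -/
theorem modeResistance_mul_norm_coeff_sq (η : ℝ) {k R : ℝ} (hk : k ≠ 0) (hR : 0 < R) (J : E3 → C3)
    (p : ℕ+) : modeResistance η k R p * ‖coeff k R J p‖ ^ 2 = η * k ^ 2 / 2 *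
      (vecWeight (degree p) (order p) * ‖waveCoeff R J (vectorWave k p)‖ ^ 2) := by
  obtain ⟨K, hK, hmode⟩ := exists_mode_eq hk p
  have hN : ∫ x in region R, ‖mode k p x‖ ^ 2 = ‖K‖ ^ 2 * vectorEnergy k R p := by
    rw [vectorEnergy, ← integral_const_mul]
    refine integral_congr_ae (Eventually.of_forall fun r => ?_)
    beta_reduce
    rw [EuclideanSpace.norm_sq_eq, Finset.mul_sum]
    simp only [hmode, norm_mul, mul_pow]
  have hcoeff : coeff k R J p = ((1 / Real.sqrt (‖K‖ ^ 2 * vectorEnergy k R p) : ℝ) : ℂ) * conj K *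
      waveCoeff R J (vectorWave k p) := by
    rw [coeff, waveCoeff, ← integral_const_mul]
    refine integral_congr_ae (Eventually.of_forall fun r => ?_)
    beta_reduce
    rw [Finset.mul_sum]
    refine Finset.sum_congr rfl fun i _ => ?_
    rw [normalizedMode, hN, PiLp.smul_apply, smul_eq_mul, hmode, map_mul, map_mul, Complex.conj_ofReal]
    ring
  rw [modeResistance_eq η hk hR]
  rcases (vectorEnergy_nonneg k R p).eq_or_lt with h0 | h0
  · rw [waveCoeff_eq_zero h0.symm, ← h0]
    simp
  · have hK' : 0 < ‖K‖ := norm_pos_iff.2 hK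
    rw [hcoeff, norm_mul, norm_mul, Complex.norm_real, RCLike.norm_conj, mul_pow, mul_pow,
      Real.norm_eq_abs, sq_abs, div_pow, Real.sq_sqrt (by positivity)]
    field_simp

/-! ### Numbering of the modes and summation of the series -/

/-- The number of the mode with degree `n + 1`, order `m` and polarization `l`. -/
def modeIndex (x : ℕ × ℤ × ℕ) : ℕ+ :=
  (2 * (((x.1 : ℤ) + 1) * (x.1 + 2) + x.2.1 - 1) + (x.2.2 : ℤ)).toNat.toPNat'

theorem modeIndex_spec {n : ℕ} {m : ℤ} {l : ℕ} (hm : |m| ≤ (n + 1 : ℕ)) (hl : l = 1 ∨ l = 2) :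
    degree (modeIndex (n, m, l)) = n + 1 ∧ order (modeIndex (n, m, l)) = m ∧
      polarization (modeIndex (n, m, l)) = l := by
  refine mode_numbering_unique (n + 1) m l (by omega) hm hl _ ?_
  -- Positivity makes the truncation in `toNat` and the default value of `toPNat'` irrelevant.
  have hpos : 0 < 2 * (((n : ℤ) + 1) * (n + 2) + m - 1) + (l : ℤ) := by
    rw [abs_le] at hm
    push_cast at hm
    nlinarith [(Int.natCast_nonneg n), (by omega : (1 : ℤ) ≤ l)]
  rw [modeIndex, Nat.toPNat'_coe, if_pos (by dsimp only; omega), Int.toNat_of_nonneg hpos.le]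
  push_cast
  ring

/-- The triples that number the modes of degree at most `N`. -/
def modeTriples (N : ℕ) : Finset (ℕ × ℤ × ℕ) :=
  ((Finset.range N) ×ˢ (Finset.Icc (-(N + 1 : ℕ) : ℤ) (N + 1 : ℕ)) ×ˢ {1, 2}).filter
    fun x => |x.2.1| ≤ (x.1 + 1 : ℕ)

theorem mem_modeTriples {N n : ℕ} {m : ℤ} {l : ℕ} : (n, m, l) ∈ modeTriples N ↔
    n < N ∧ |m| ≤ (n + 1 : ℕ) ∧ (l = 1 ∨ l = 2) := by
  simp only [modeTriples, Finset.mem_filter, Finset.mem_product, Finset.mem_range, Finset.mem_Icc,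
    Finset.mem_insert, Finset.mem_singleton]
  constructor
  · rintro ⟨⟨h1, -, h2⟩, h3⟩
    exact ⟨h1, h3, h2⟩
  · rintro ⟨h1, h3, h2⟩
    have := abs_le.1 h3
    refine ⟨⟨h1, ⟨by push_cast at *; omega, by push_cast at *; omega⟩, h2⟩, h3⟩

theorem injOn_modeIndex (N : ℕ) : Set.InjOn modeIndex (modeTriples N) := by
  rintro ⟨n, m, l⟩ hx ⟨n', m', l'⟩ hx' h
  rw [Finset.mem_coe, mem_modeTriples] at hx hx'
  obtain ⟨h1, h2, h3⟩ := modeIndex_spec hx.2.1 hx.2.2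
  obtain ⟨h1', h2', h3'⟩ := modeIndex_spec hx'.2.1 hx'.2.2
  rw [h] at h1 h2 h3
  have e1 : n = n' := by omega
  subst e1
  rw [← h2, ← h3, h2', h3']

/-- The modes of degree at most `N`. -/
def lowModes (N : ℕ) : Finset ℕ+ := (modeTriples N).image modeIndex

theorem mem_lowModes {N : ℕ} {p : ℕ+} : p ∈ lowModes N ↔ degree p ≤ N := by
  rw [lowModes, Finset.mem_image]
  constructor
  · rintro ⟨⟨n, m, l⟩, hx, rfl⟩
    rw [mem_modeTriples] at hx
    rw [(modeIndex_spec hx.2.1 hx.2.2).1]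
    omega
  · intro h
    obtain ⟨hn, hm, hp⟩ := mode_numbering p
    have hl : polarization p = 1 ∨ polarization p = 2 := by
      unfold polarization
      split_ifs <;> simp
    have e : degree p - 1 + 1 = degree p := by omega
    refine ⟨(degree p - 1, order p, polarization p),
      mem_modeTriples.2 ⟨by omega, by rwa [e], hl⟩, PNat.eq ?_⟩
    have hpos : 0 < (p : ℕ) := p.2
    have e' : ((degree p - 1 : ℕ) : ℤ) = degree p - 1 := by omega
    have e'' : 2 * ((((degree p - 1 : ℕ) : ℤ) + 1) * ((degree p - 1 : ℕ) + 2) + order p - 1) +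
        (polarization p : ℤ) = ((p : ℕ) : ℤ) := by
      rw [hp, e']
      ring
    rw [modeIndex]
    simp only [e'']
    rw [Int.toNat_natCast, Nat.toPNat'_coe, if_pos hpos]

theorem tendsto_lowModes : Tendsto lowModes atTop atTop :=
  tendsto_atTop_finset_of_monotone (fun _ _ h _ hp => mem_lowModes.2 ((mem_lowModes.1 hp).trans h))
    fun p => ⟨degree p, mem_lowModes.2 le_rfl⟩

/-- The window of orders is wider than needed at low degrees; the surplus terms vanish because the
waves do. -/
theorem sum_lowModes (k R : ℝ) (J : E3 → C3) (N : ℕ) :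
    ∑ p ∈ lowModes N, vecWeight (degree p) (order p) * ‖waveCoeff R J (vectorWave k p)‖ ^ 2 =
      modeSum k R J (N + 1) N := by
  rw [lowModes, Finset.sum_image (injOn_modeIndex N)]
  set b : ℕ × ℤ × ℕ → ℝ := fun x => vecWeight (x.1 + 1) x.2.1 *
    ‖waveCoeff R J (if x.2.2 = 1 then te k (x.1 + 1) x.2.1 else tm k (x.1 + 1) x.2.1)‖ ^ 2
  have h1 : ∀ x ∈ modeTriples N, vecWeight (degree (modeIndex x)) (order (modeIndex x)) *
      ‖waveCoeff R J (vectorWave k (modeIndex x))‖ ^ 2 = b x := by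
    rintro ⟨n, m, l⟩ hx
    rw [mem_modeTriples] at hx
    obtain ⟨e1, e2, e3⟩ := modeIndex_spec hx.2.1 hx.2.2
    have hv : vectorWave k (modeIndex (n, m, l)) =
        if l = 1 then te k (n + 1) m else tm k (n + 1) m := by
      funext i r
      rw [vectorWave, e1, e2]
      unfold polarization at e3
      split_ifs at e3 with ho
      · rw [if_pos ho, if_pos e3.symm]
      · rw [if_neg ho, if_neg (by omega)]
    rw [hv, e1, e2]
  rw [Finset.sum_congr rfl h1, modeTriples, Finset.sum_filter_of_ne, Finset.sum_product]
  · refine Finset.sum_congr rfl fun n _ => ?_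
    rw [Finset.sum_product]
    refine Finset.sum_congr rfl fun m _ => ?_
    rw [Finset.sum_insert (by decide), Finset.sum_singleton]
    simp [mul_add]
  · rintro ⟨n, m, l⟩ _ hne
    by_contra hm
    apply hne
    have hm' : ((n + 1 : ℕ) : ℤ) < |m| := not_le.1 hm
    have : waveCoeff R J (if l = 1 then te k (n + 1) m else tm k (n + 1) m) = 0 := by
      split_ifs <;> simp [waveCoeff, te_eq_zero hm', tm_eq_zero hm']
    simp [this]

/-- The sets of modes of bounded degree exhaust all modes, and the partial sums over them increase
to the power. For non-negative terms this bounds every finite sum, so the series is summable with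
the same limit. -/
theorem exists_hasSum_power {R : ℝ} {J : E3 → C3} (hJ : Integrable J (ballMeasure R)) (hR : 0 < R)
    {ω μ η k : ℝ} (hk : 0 < k) (hη0 : 0 ≤ η) (hη : ω * μ = η * k) :
    ∃ P : ℝ, Tendsto (truncatedPower ω μ k R J) (𝓝[>] (0 : ℝ)) (𝓝 P) ∧
      HasSum (fun p : ℕ+ => modeResistance η k R p * ‖coeff k R J p‖ ^ 2) P := by
  obtain ⟨P, hP, hsum⟩ := exists_tendsto_truncatedPower hJ ω μ hk
  refine ⟨P, hP, ?_⟩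
  set a : ℕ+ → ℝ := fun p => modeResistance η k R p * ‖coeff k R J p‖ ^ 2 with ha
  have hnonneg : ∀ p, 0 ≤ a p := fun p =>
    mul_nonneg (modeResistance_nonneg hη0 hk.ne' hR p) (sq_nonneg _)
  have hpartial : ∀ N, ∑ p ∈ lowModes N, a p = ω * μ * k / 2 * modeSum k R J (N + 1) N := by
    intro N
    rw [← sum_lowModes, Finset.mul_sum]
    refine Finset.sum_congr rfl fun p _ => ?_
    rw [ha]
    simp only [modeResistance_mul_norm_coeff_sq η hk.ne' hR]
    rw [hη]
    ring
  have hlim : Tendsto (fun N => ∑ p ∈ lowModes N, a p) atTop (𝓝 P) := by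
    rw [← tendsto_add_atTop_iff_nat 1]
    refine hsum.congr fun n => ?_
    rw [hpartial]
  have hmono : Monotone fun N => ∑ p ∈ lowModes N, a p := fun N N' h =>
    Finset.sum_le_sum_of_subset_of_nonneg
      (fun _ hp => mem_lowModes.2 ((mem_lowModes.1 hp).trans h)) fun p _ _ => hnonneg p
  have hsummable : Summable a := by
    refine summable_of_sum_le hnonneg (c := P) fun u => ?_
    obtain ⟨N, hN⟩ := (tendsto_lowModes.eventually_ge_atTop u).exists
    exact (Finset.sum_le_sum_of_subset_of_nonneg hN fun p _ _ => hnonneg p).trans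
      (hmono.ge_of_tendsto hlim N)
  rw [tendsto_nhds_unique hlim (hsummable.hasSum.comp tendsto_lowModes)]
  exact hsummable.hasSum

/-! ### Measurability and the expectations -/

theorem continuous_normalizedMode {k : ℝ} (hk : k ≠ 0) (R : ℝ) (p : ℕ+) (i : Fin 3) :
    Continuous fun r => normalizedMode k R p r i := by
  obtain ⟨K, -, hmode⟩ := exists_mode_eq hk p
  simp only [normalizedMode, PiLp.smul_apply, smul_eq_mul, hmode]
  exact continuous_const.mul (continuous_const.mul (continuous_vectorWave k p i))

theorem aestronglyMeasurable_coeff {Ω : Type*} [MeasurableSpace Ω] {Pr : Measure Ω}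
    [SFinite Pr] {k R : ℝ} (hk : k ≠ 0) {J : Ω → E3 → C3}
    (hJ : AEStronglyMeasurable (fun z : Ω × E3 => J z.1 z.2) (Pr.prod (ballMeasure R))) (p : ℕ+) :
    AEStronglyMeasurable (fun s => coeff k R (J s) p) Pr := by
  unfold coeff
  refine AEStronglyMeasurable.integral_prod_right'
    (f := fun z : Ω × E3 => ∑ i, J z.1 z.2 i * conj (normalizedMode k R p z.2 i)) ?_
  refine Finset.aestronglyMeasurable_fun_sum _ fun i _ => AEStronglyMeasurable.mul ?_ ?_
  · exact (EuclideanSpace.proj i : C3 →L[ℂ] ℂ).continuous.comp_aestronglyMeasurable hJ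
  · have h : StronglyMeasurable fun r => conj (normalizedMode k R p r i) :=
      (Complex.continuous_conj.comp (continuous_normalizedMode hk R p i)).stronglyMeasurable
    exact (h.comp_measurable measurable_snd).aestronglyMeasurable

end

end SphericalModes

theorem proposition1
    {Ω : Type*} [MeasurableSpace Ω] (Pr : Measure Ω) [IsProbabilityMeasure Pr]
    (ω μ η k R : ℝ) (hω : 0 < ω) (hμ : 0 < μ) (hk : 0 < k) (hR : 0 < R)
    (hη : ω * μ = η * k)
    (J : Ω → E3 → C3)
    (hJmeas : AEStronglyMeasurable (fun z : Ω × E3 => J z.1 z.2)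
      (Pr.prod (volume.restrict (region R))))
    (hJ : ∀ᵐ s ∂Pr, MemLp (J s) 2 (volume.restrict (region R))) :
    (∀ p : ℕ+, 0 ≤ modeResistance η k R p) ∧
    (∀ᵐ s ∂Pr,
      Tendsto (truncatedPower ω μ k R (J s)) (𝓝[>] (0 : ℝ))
        (𝓝 (transmitPower ω μ k R (J s))) ∧
      HasSum (fun p : ℕ+ => modeResistance η k R p * ‖coeff k R (J s) p‖ ^ 2)
        (transmitPower ω μ k R (J s))) ∧
    AEMeasurable (fun s => transmitPower ω μ k R (J s)) Pr ∧
    ∫⁻ s, ENNReal.ofReal (transmitPower ω μ k R (J s)) ∂Pr =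
      ∫⁻ s, ∑' p : ℕ+,
        ENNReal.ofReal (modeResistance η k R p * ‖coeff k R (J s) p‖ ^ 2) ∂Pr ∧
    ∫ s, transmitPower ω μ k R (J s) ∂Pr =
      ∫ s, ∑' p : ℕ+, modeResistance η k R p * ‖coeff k R (J s) p‖ ^ 2 ∂Pr := by
  have hη0 : 0 < η := pos_of_mul_pos_left (hη ▸ mul_pos hω hμ) hk.le
  have hnonneg := fun p => modeResistance_nonneg hη0.le hk.ne' hR p
  have hterm : ∀ s p, 0 ≤ modeResistance η k R p * ‖coeff k R (J s) p‖ ^ 2 := fun s p =>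
    mul_nonneg (hnonneg p) (sq_nonneg _)
  have hmain : ∀ᵐ s ∂Pr,
      Tendsto (truncatedPower ω μ k R (J s)) (𝓝[>] (0 : ℝ)) (𝓝 (transmitPower ω μ k R (J s))) ∧
      HasSum (fun p : ℕ+ => modeResistance η k R p * ‖coeff k R (J s) p‖ ^ 2)
        (transmitPower ω μ k R (J s)) := by
    filter_upwards [hJ] with s hs
    -- The ball has finite measure, so a square integrable sample is integrable, which is all the
    -- expansion needs.
    obtain ⟨P, hP, hsum⟩ := exists_hasSum_power (hs.integrable one_le_two) hR hk hη0.le hη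
    rw [transmitPower, hP.limUnder_eq]
    exact ⟨hP, hsum⟩
  have hofReal : ∀ᵐ s ∂Pr, ENNReal.ofReal (transmitPower ω μ k R (J s)) =
      ∑' p : ℕ+, ENNReal.ofReal (modeResistance η k R p * ‖coeff k R (J s) p‖ ^ 2) := by
    filter_upwards [hmain] with s hs
    rw [← hs.2.tsum_eq, ENNReal.ofReal_tsum_of_nonneg (hterm s) hs.2.summable]
  refine ⟨hnonneg, hmain, ?_, lintegral_congr_ae hofReal, integral_congr_ae ?_⟩
  -- The power is defined through a limit with no evident measurability; it is almost surely equal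
  -- to the sum of the measurable mode terms, taken in `[0, ∞]` and converted back.
  · have hmeas : AEMeasurable (fun s => (∑' p : ℕ+, ENNReal.ofReal
        (modeResistance η k R p * ‖coeff k R (J s) p‖ ^ 2)).toReal) Pr := by
      refine (AEMeasurable.tsum fun p => ?_).ennreal_toReal
      exact (((aestronglyMeasurable_coeff hk.ne' hJmeas p).norm.aemeasurable.pow_const 2).const_mul
        _).ennreal_ofReal
    refine hmeas.congr ?_
    filter_upwards [hofReal, hmain] with s hs hs'
    rw [← hs, ENNReal.toReal_ofReal (hs'.2.nonneg (hterm s))]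
  · filter_upwards [hmain] with s hs using hs.2.tsum_eq.symm
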